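/- Let $(M,\mathsf c)$ be an oriented conformal $4$-manifold, $(B,\mathsf c_B)$ a conformal $3$-manifold and $\pi\colon M\to B$ a smooth surjective conformal submersion, i.e. $d\pi_x$ is surjective and restricts to a conformal linear isomorphism from the horizontal space $\mathcal H_x=(\ker d\pi_x)^\perp$ onto $T_{\pi(x)}B$ for all $x\in M$. Suppose that the (one-dimensional) fibres of $\pi$ are oriented, and let $\xi$ be the positively oriented weightless unit vector field (section of $L^{-1}TM$, where $L$ is the density line bundle) tangent to the fibres. A Weyl derivative is a covariant derivative $D$ on $L$; it induces a unique torsion-free connection $D$ on $TM$ preserving $\mathsf c$ (its Weyl connection), and adding a $1$-form $\gamma$ to $D$ means $(D+\gamma)\mu=D\mu+\gamma\mu$ for sections $\mu$ of $L$. The Faraday curvature $F^D$ of $D$ is its curvature $2$-form on $L$. The Hodge star operator $*$ on $M$ is normalized, as in the convention $\iota_X(*\alpha)=*(\langle X,\cdot\rangle\wedge\alpha)$ with $*1$ the orientation, so that $*(e_1\wedge e_2)=-e_3\wedge e_4$ for an oriented orthonormal coframe; a $2$-form $F$ is selfdual if $*F=F$, and $\mathsf c$ is selfdual if its Weyl curvature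 $W$, as a $2$-form with values in $\mathfrak{so}(TM)$, satisfies $*W=W$. Let $D^0$ be the minimal Weyl derivative of $\xi$, i.e. the unique Weyl derivative with $D^0_\xi\xi=0$ and $\operatorname{tr}D^0\xi=0$, let $\omega=-(*d^{0}\xi)(\xi,\cdot)$, where $d^0\xi(X,Y)=\langle D^0_X\xi,Y\rangle-\langle D^0_Y\xi,X\rangle$, and put $D^B=D^0+\omega$. Suppose that $\xi$ is selfdual, i.e. that $F^{D^0}$ is selfdual. If the fibres of $\pi$ are connected, then $D^B$ descends to $B$: there is a Weyl derivative on $(B,\mathsf c_B)$ whose pullback to $L\cong\pi^*L_B$ is $D^0+\omega$. Moreover, whenever $D^B$ descends to a Weyl derivative on $B$ (also denoted $D^B$), this is Einstein-Weyl, i.e. the symmetric traceless part of the Ricci tensor of its Weyl connection vanishes, if and only if $\mathsf c$ is selfdual. -/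

import Mathlib

open Bundle Set
open scoped Manifold ContDiff Topology

noncomputable section

namespace WeylGeometry

/-- The model space of an `n`-manifold. -/
abbrev Model (n : ℕ) : Type := EuclideanSpace ℝ (Fin n)

section Basics

variable (n : ℕ) (M : Type*) [TopologicalSpace M] [ChartedSpace (Model n) M]
  [IsManifold (𝓡 n) ∞ M]

/-- Smooth Riemannian metrics on an `n`-manifold. -/
abbrev Metric : Type _ :=
  ContMDiffRiemannianMetric (𝓡 n) ∞ (Model n) (fun x : M => TangentSpace (𝓡 n) x)

/-- A conformal structure: a class of smooth Riemannian metrics of the form `e^{2f} g`. -/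
structure ConformalStructure where
  metrics : Set (Metric n M)
  nonempty : metrics.Nonempty
  mem_iff : ∀ g ∈ metrics, ∀ g' : Metric n M, g' ∈ metrics ↔
    ∃ f : M → ℝ, ContMDiff (𝓡 n) 𝓘(ℝ, ℝ) ∞ f ∧
      ∀ x (v w : TangentSpace (𝓡 n) x), g'.inner x v w = Real.exp (2 * f x) * g.inner x v w

/-- An orientation of an `n`-manifold, given by a nowhere vanishing smooth `n`-form (only the
class of the form up to multiplication by positive functions will matter). -/
structure OrientationForm where
  form : (x : M) → (TangentSpace (𝓡 n) x) [⋀^Fin n]→ₗ[ℝ] ℝ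
  ne_zero : ∀ x, form x ≠ 0
  smooth : ∀ (x : M) (X : Fin n → (y : M) → TangentSpace (𝓡 n) y),
    (∀ i, ContMDiffAt (𝓡 n) ((𝓡 n).prod 𝓘(ℝ, Model n)) ∞ (T% (X i)) x) →
    ContMDiffAt (𝓡 n) 𝓘(ℝ, ℝ) ∞ (fun y => form y (fun i => X i y)) x

end Basics

section Structures

variable {n : ℕ} {M : Type*} [TopologicalSpace M] [ChartedSpace (Model n) M]
  [IsManifold (𝓡 n) ∞ M]

/-- The metrics of a conformal class. They correspond to the gauges (length scales, i.e. positive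
sections `μ` of the density bundle `L`) via `g = μ⁻² c`; the metric `e^{2f} g` belongs to the
length scale `e^{-f} μ`. -/
abbrev ConformalStructure.Gauge (C : ConformalStructure n M) : Type _ := {g // g ∈ C.metrics}

/-- A Weyl derivative `D` on a conformal manifold, together with its Weyl connection on the
tangent bundle: `conn` is a smooth torsion-free connection which preserves the conformal structure.
For a gauge `g = μ⁻² c`, `form g` is the 1-form `μ⁻¹ D μ` of the covariant derivative on densities,
so that `D g = -2 (form g) ⊗ g`. -/
structure WeylDerivative (C : ConformalStructure n M) where
  conn : CovariantDerivative (𝓡 n) (Model n) (fun x : M => TangentSpace (𝓡 n) x)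
  smooth : CovariantDerivative.ContMDiffCovariantDerivative conn ∞
  torsion_eq_zero : conn.torsion = 0
  form : C.Gauge → (x : M) → TangentSpace (𝓡 n) x →L[ℝ] ℝ
  conn_metric : ∀ (g : C.Gauge) (x : M) (Y Z : (y : M) → TangentSpace (𝓡 n) y),
    MDifferentiableAt (𝓡 n) ((𝓡 n).prod 𝓘(ℝ, Model n)) (T% Y) x →
    MDifferentiableAt (𝓡 n) ((𝓡 n).prod 𝓘(ℝ, Model n)) (T% Z) x →
    ∀ v : TangentSpace (𝓡 n) x,
      mvfderiv (𝓡 n) (fun y => g.1.inner y (Y y) (Z y)) x v =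
        g.1.inner x (conn Y x v) (Z x) + g.1.inner x (Y x) (conn Z x v)
          - 2 * form g x v * g.1.inner x (Y x) (Z x)

/-- A congruence on a conformal manifold: a weightless unit vector field `ξ`, i.e. a unit section
of `L⁻¹ TM`. In the gauge `g = μ⁻² c` it is the `g`-unit vector field `μ ξ`. -/
structure Congruence (C : ConformalStructure n M) where
  field : C.Gauge → (x : M) → TangentSpace (𝓡 n) x
  smooth : ∀ g, ContMDiff (𝓡 n) ((𝓡 n).prod 𝓘(ℝ, Model n)) ∞ (T% (field g))
  unit : ∀ (g : C.Gauge) (x : M), g.1.inner x (field g x) (field g x) = 1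
  weight : ∀ (g g' : C.Gauge) (f : M → ℝ),
    (∀ x (v w : TangentSpace (𝓡 n) x), g'.1.inner x v w = Real.exp (2 * f x) * g.1.inner x v w) →
    ∀ x, field g' x = Real.exp (-f x) • field g x

/-- Orthonormal frames of a tangent space. -/
def IsOrthonormalFrame (g : Metric n M) (x : M) (e : Fin n → TangentSpace (𝓡 n) x) : Prop :=
  ∀ i j, g.inner x (e i) (e j) = if i = j then 1 else 0

/-- Positively oriented orthonormal frames of a tangent space. -/
def IsOrientedFrame (g : Metric n M) (o : OrientationForm n M) (x : M)
    (e : Fin n → TangentSpace (𝓡 n) x) : Prop :=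
  IsOrthonormalFrame g x e ∧ 0 < o.form x e

/-- The exterior derivative of a 1-form, `dθ(X,Y) = X(θ(Y)) - Y(θ(X)) - θ([X,Y])`, evaluated
on tangent vectors by extending them to vector fields. -/
def extDerivOneForm (θ : (x : M) → TangentSpace (𝓡 n) x →L[ℝ] ℝ) (x : M)
    (v w : TangentSpace (𝓡 n) x) : ℝ :=
  let V : (y : M) → TangentSpace (𝓡 n) y := FiberBundle.extend (Model n) v
  let W : (y : M) → TangentSpace (𝓡 n) y := FiberBundle.extend (Model n) w
  mvfderiv (𝓡 n) (fun y => θ y (W y)) x v - mvfderiv (𝓡 n) (fun y => θ y (V y)) x w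
    - θ x (VectorField.mlieBracket (𝓡 n) V W x)

/-- The curvature `R_{u,v} w = ∇_u ∇_v w - ∇_v ∇_u w - ∇_{[u,v]} w`, evaluated on tangent vectors
by extending them to vector fields. -/
def curvature (D : CovariantDerivative (𝓡 n) (Model n) (fun x : M => TangentSpace (𝓡 n) x))
    (x : M) (u v w : TangentSpace (𝓡 n) x) : TangentSpace (𝓡 n) x :=
  let U : (y : M) → TangentSpace (𝓡 n) y := FiberBundle.extend (Model n) u
  let V : (y : M) → TangentSpace (𝓡 n) y := FiberBundle.extend (Model n) v
  let W : (y : M) → TangentSpace (𝓡 n) y := FiberBundle.extend (Model n) w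
  D (fun y => D W y (V y)) x u - D (fun y => D W y (U y)) x v
    - D W x (VectorField.mlieBracket (𝓡 n) U V x)

namespace WeylDerivative

variable {C : ConformalStructure n M} (D : WeylDerivative C) (g : C.Gauge) (x : M)
  (e : Fin n → TangentSpace (𝓡 n) x)

/-- The Faraday curvature of `D`: the curvature 2-form of `D` on densities, which is `d(μ⁻¹ D μ)`
for every gauge. -/
def faraday (v w : TangentSpace (𝓡 n) x) : ℝ := extDerivOneForm (D.form g) x v w

/-- The Ricci tensor `Ric(v,w) = tr (u ↦ R_{u,v} w)`; the trace is taken in an orthonormal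
frame `e`. -/
def ricci (v w : TangentSpace (𝓡 n) x) : ℝ :=
  ∑ i, g.1.inner x (curvature D.conn x (e i) v w) (e i)

/-- The scalar curvature, i.e. the trace of the Ricci tensor with respect to `g`. -/
def scalar : ℝ := ∑ i, D.ricci g x e (e i) (e i)

/-- The symmetric traceless part of the Ricci tensor. -/
def ricciSymTracefree (v w : TangentSpace (𝓡 n) x) : ℝ :=
  (D.ricci g x e v w + D.ricci g x e w v) / 2 - D.scalar g x e / n * g.1.inner x v w

/-- The Einstein-Weyl condition. -/
def IsEinsteinWeyl : Prop :=
  ∀ (g : C.Gauge) (x : M) (e : Fin n → TangentSpace (𝓡 n) x), IsOrthonormalFrame g.1 x e →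
    ∀ v w, D.ricciSymTracefree g x e v w = 0

/-- The normalized Ricci tensor `r`. -/
def normalizedRicci (v w : TangentSpace (𝓡 n) x) : ℝ :=
  ((D.ricci g x e v w + D.ricci g x e w v) / 2
      - D.scalar g x e / (2 * (n - 1)) * g.1.inner x v w) / (n - 2)
    + (D.ricci g x e v w - D.ricci g x e w v) / (2 * n)

/-- `g(⟦r(a), b⟧ w, z)`, where `⟦γ, b⟧ w = γ(b) w + γ(w) b - g(b, w) γ♯`. -/
def ricciBracket (a b w z : TangentSpace (𝓡 n) x) : ℝ :=
  D.normalizedRicci g x e a b * g.1.inner x w z + D.normalizedRicci g x e a w * g.1.inner x b z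
    - g.1.inner x b w * D.normalizedRicci g x e a z

/-- The Weyl curvature `g(W_{u,v} w, z)`, where `R_{u,v} = W_{u,v} - ⟦r(u), v⟧ + ⟦r(v), u⟧`. The
normalization of `r` is the one for which `W` has no trace. -/
def weyl (u v w z : TangentSpace (𝓡 n) x) : ℝ :=
  g.1.inner x (curvature D.conn x u v w) z + D.ricciBracket g x e u v w z
    - D.ricciBracket g x e v u w z

/-- The derivative `v ↦ D_v ξ` of a congruence, in the gauge `g`: as `ξ = μ⁻¹ X` with `X` the unit
vector field representing `ξ`, it is `D_v X - (μ⁻¹ D_v μ) X`. -/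
def derivCongruence (ξ : Congruence C) : TangentSpace (𝓡 n) x →L[ℝ] TangentSpace (𝓡 n) x :=
  D.conn (ξ.field g) x - (D.form g x).smulRight (ξ.field g x)

/-- `D` is the minimal Weyl derivative of `ξ`: `D_ξ ξ = 0` and `tr D ξ = 0`. -/
def IsMinimal (ξ : Congruence C) : Prop :=
  ∀ (g : C.Gauge) (x : M), D.derivCongruence g x ξ (ξ.field g x) = 0 ∧
    LinearMap.trace ℝ (TangentSpace (𝓡 n) x) (D.derivCongruence g x ξ).toLinearMap = 0

/-- The 2-form `d^D ξ`, in the gauge `g`. -/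
def extDerivCongruence (ξ : Congruence C) (v w : TangentSpace (𝓡 n) x) : ℝ :=
  g.1.inner x (D.derivCongruence g x ξ v) w - g.1.inner x (D.derivCongruence g x ξ w) v

end WeylDerivative

end Structures

section DimensionFour

variable {M : Type*} [TopologicalSpace M] [ChartedSpace (Model 4) M] [IsManifold (𝓡 4) ∞ M]

/-- The star operator on 2-forms of an oriented 4-manifold, computed in a positively oriented
orthonormal frame `e` (so that `o.form / o.form e` is the volume form `*1`). The sign is that of
the convention `ι_X (*α) = *(X♭ ∧ α)` for forms of all degrees: `*(e⁰ ∧ e¹) = -(e² ∧ e³)`. -/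
def hodgeStar (o : OrientationForm 4 M) (x : M) (e : Fin 4 → TangentSpace (𝓡 4) x)
    (α : TangentSpace (𝓡 4) x → TangentSpace (𝓡 4) x → ℝ) (v w : TangentSpace (𝓡 4) x) : ℝ :=
  -(1 / 2) * ∑ i, ∑ j, o.form x ![v, w, e i, e j] / o.form x e * α (e i) (e j)

/-- The conformal structure is selfdual: its Weyl curvature, as a 2-form with values in the skew
endomorphisms, satisfies `*W = W`. -/
def ConformalStructure.IsSelfdual (C : ConformalStructure 4 M) (o : OrientationForm 4 M) : Prop :=
  ∀ (D : WeylDerivative C) (g : C.Gauge) (x : M) (e : Fin 4 → TangentSpace (𝓡 4) x),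
    IsOrientedFrame g.1 o x e → ∀ u v w z,
      hodgeStar o x e (fun a b => D.weyl g x e a b w z) u v = D.weyl g x e u v w z

namespace WeylDerivative

variable {C : ConformalStructure 4 M} (D : WeylDerivative C)

/-- The Faraday curvature of `D` is a selfdual 2-form. -/
def HasSelfdualFaraday (o : OrientationForm 4 M) : Prop :=
  ∀ (g : C.Gauge) (x : M) (e : Fin 4 → TangentSpace (𝓡 4) x), IsOrientedFrame g.1 o x e →
    ∀ v w, hodgeStar o x e (D.faraday g x) v w = D.faraday g x v w

/-- The 1-form `ω = -(*d^D ξ)(ξ, ·)`. -/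
def twistForm (o : OrientationForm 4 M) (ξ : Congruence C) (g : C.Gauge) (x : M)
    (e : Fin 4 → TangentSpace (𝓡 4) x) (v : TangentSpace (𝓡 4) x) : ℝ :=
  -hodgeStar o x e (D.extDerivCongruence g x ξ) (ξ.field g x) v

end WeylDerivative

end DimensionFour

section Submersions

variable {m n : ℕ} {M B : Type*} [TopologicalSpace M] [ChartedSpace (Model m) M]
  [IsManifold (𝓡 m) ∞ M] [TopologicalSpace B] [ChartedSpace (Model n) B] [IsManifold (𝓡 n) ∞ B]

/-- The horizontal vectors at `x`: those orthogonal to the kernel of `dp`. -/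
def IsHorizontal (p : M → B) (g : Metric m M) (x : M) (v : TangentSpace (𝓡 m) x) : Prop :=
  ∀ u : TangentSpace (𝓡 m) x, mfderiv (𝓡 m) (𝓡 n) p x u = 0 → g.inner x u v = 0

/-- Conformal submersions between conformal manifolds. -/
structure IsConformalSubmersion (C : ConformalStructure m M) (CB : ConformalStructure n B)
    (p : M → B) : Prop where
  smooth : ContMDiff (𝓡 m) (𝓡 n) ∞ p
  surjective : Function.Surjective p
  submersion : ∀ x, Function.Surjective (mfderiv (𝓡 m) (𝓡 n) p x)
  conformal : ∀ (g : C.Gauge) (h : CB.Gauge) (x : M), ∃ c : ℝ, 0 < c ∧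
    ∀ v w : TangentSpace (𝓡 m) x, IsHorizontal (n := n) p g.1 x v →
      IsHorizontal (n := n) p g.1 x w →
        h.1.inner (p x) (mfderiv (𝓡 m) (𝓡 n) p x v) (mfderiv (𝓡 m) (𝓡 n) p x w) =
          c * g.1.inner x v w

/-- The gauge `g` on `M` is the pullback of the gauge `h` on `B` under the identification of the
density bundle `L` of `M` with the pullback of that of `B`, i.e., `p : (M, g) → (B, h)` is a
Riemannian submersion. -/
def IsPullbackGauge {C : ConformalStructure m M} {CB : ConformalStructure n B} (p : M → B)
    (g : C.Gauge) (h : CB.Gauge) : Prop :=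
  ∀ (x : M) (v w : TangentSpace (𝓡 m) x), IsHorizontal (n := n) p g.1 x v →
    IsHorizontal (n := n) p g.1 x w →
      h.1.inner (p x) (mfderiv (𝓡 m) (𝓡 n) p x v) (mfderiv (𝓡 m) (𝓡 n) p x w) =
        g.1.inner x v w

/-- The fibres of `p` are tangent to the congruence `ξ`. -/
def IsTangentToFibres {C : ConformalStructure m M} (p : M → B) (ξ : Congruence C) : Prop :=
  ∀ (g : C.Gauge) (x : M) (v : TangentSpace (𝓡 m) x),
    mfderiv (𝓡 m) (𝓡 n) p x v = 0 ↔ ∃ t : ℝ, v = t • ξ.field g x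

end Submersions

/-- The Weyl derivative `DB` on `B` is the one to which `D⁰ + ω` descends, i.e.
`p^* DB = D⁰ + ω` as Weyl derivatives on `M`, where `ω = -(*d⁰ξ)(ξ, ·)`. -/
def IsDescentOf {M B : Type*} [TopologicalSpace M] [ChartedSpace (Model 4) M]
    [IsManifold (𝓡 4) ∞ M] [TopologicalSpace B] [ChartedSpace (Model 3) B]
    [IsManifold (𝓡 3) ∞ B] {C : ConformalStructure 4 M} {CB : ConformalStructure 3 B}
    (o : OrientationForm 4 M) (p : M → B) (ξ : Congruence C) (D0 : WeylDerivative C)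
    (DB : WeylDerivative CB) : Prop :=
  ∀ (g : C.Gauge) (h : CB.Gauge), IsPullbackGauge p g h →
    ∀ (x : M) (e : Fin 4 → TangentSpace (𝓡 4) x), IsOrientedFrame g.1 o x e →
      ∀ v : TangentSpace (𝓡 4) x,
        DB.form h (p x) (mfderiv (𝓡 4) (𝓡 3) p x v) =
          D0.form g x v + D0.twistForm o ξ g x e v

end WeylGeometry

end

open WeylGeometry

set_option linter.unusedSectionVars false
set_option linter.unusedSimpArgs false

open Bundle Set
open scoped Manifold ContDiff Topology

noncomputable section

namespace WeylGeometry

/-! ### Germs of smooth functions and vector fields. -/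

section Calculus

variable {n : ℕ} {M : Type*} [TopologicalSpace M] [ChartedSpace (Model n) M]
  [IsManifold (𝓡 n) ∞ M]

/-! Fix a gauge `h` on `B`, its pullback `g` on `M`, and an oriented adapted frame: `E 0` is the
vertical unit field and `E 1`, `E 2`, `E 3` are the horizontal lifts of an `h`-orthonormal frame.
The geometry is then encoded in the structure functions c_abc = g([E_a, E_b], E_c). Relatedness
under `p` gives c_0ij = 0 for horizontal i, j, and identifies c_ijk with the structure functions of
the base. If α is the 1-form of D⁰ in the gauge `g`, minimality says α(E_0) = 0 and c_0i0 = -α_i,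
while c_jk0 = -ω_i for (i, j, k) cyclic.

Descent. The form α + ω vanishes on `E 0`. The Jacobi identity gives F_0i = E_0(α_i) and F_jk =
E_0(ω_i) for the Faraday curvature F of D⁰. With the sign of the star used here selfduality means
F_0i = -F_jk, so E_0(α_i + ω_i) = 0 (`IsAdaptedFrame.dir_zero_eq_zero`). Hence α + ω is locally the
pullback of a form on `B`; connectedness of the fibres makes the local forms agree
(`exists_descended_form`), and the Koszul formula turns the resulting smooth 1-form into a Weyl
derivative (`ConformalStructure.exists_weylDerivative`).

Einstein-Weyl. For any Weyl connection D on `M`, selfduality of the Weyl curvature at a point means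
that the 3 × 3 matrix of antiselfdual-antiselfdual components of the curvature of D has no symmetric
tracefree part (`symTracefreeVanishes_of_bracketComp`, `asdComp_bracketComp_eq_zero`). Since so(4) =
so(3) ⊕ so(3), this matrix depends only on the antiselfdual part of the connection coefficients of D
(`asdComp_curvature`). That part consists of the coefficients of D^B, pulled back from `B`, plus
terms linear in γ = D - D⁰ - ω/2 (`asdComp_koszul`). In the curvature, γ contributes only a skew
matrix and a multiple of the identity (`symTracefreeVanishes_asd_iff`). The symmetric tracefree part
is therefore that of the curvature of D^B, written as a 3 × 3 matrix by identifying 2-forms with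
vectors in dimension 3, and this is the symmetric tracefree Ricci tensor of D^B
(`ricComp_symTracefree_iff`). -/

instance isManifold_minSmoothness_two : IsManifold (𝓡 n) (minSmoothness ℝ 2) M := by
  rw [minSmoothness_of_isRCLikeNormedField]
  infer_instance

instance isManifold_minSmoothness_three : IsManifold (𝓡 n) (minSmoothness ℝ 3) M := by
  rw [minSmoothness_of_isRCLikeNormedField]
  infer_instance

/-- Vector fields, without any regularity. -/
abbrev VField (n : ℕ) (M : Type*) [TopologicalSpace M] [ChartedSpace (Model n) M] : Type _ :=
  (x : M) → TangentSpace (𝓡 n) x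

/-- Smoothness of a vector field on a neighbourhood of a point. -/
def SmoothNear (V : VField n M) (x : M) : Prop :=
  ∀ᶠ y in 𝓝 x, ContMDiffAt (𝓡 n) ((𝓡 n).prod 𝓘(ℝ, Model n)) ∞ (T% V) y

/-- Smoothness of a function on a neighbourhood of a point. -/
def FnSmoothNear (f : M → ℝ) (x : M) : Prop :=
  ∀ᶠ y in 𝓝 x, ContMDiffAt (𝓡 n) 𝓘(ℝ, ℝ) ∞ f y

/-- The derivative of a function along a vector field. -/
def dir (V : VField n M) (f : M → ℝ) (x : M) : ℝ := mvfderiv (𝓡 n) f x (V x)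

variable {V W U : VField n M} {f h : M → ℝ} {x : M}

/-- Smoothness near a point, unlike smoothness at it, passes to nearby points. Identities between
first derivatives thus hold on a neighbourhood and can be differentiated again. -/
lemma SmoothNear.eventually (hV : SmoothNear V x) : ∀ᶠ y in 𝓝 x, SmoothNear V y :=
  eventually_eventually_nhds.2 hV

lemma FnSmoothNear.eventually (hf : FnSmoothNear (n := n) f x) :
    ∀ᶠ y in 𝓝 x, FnSmoothNear (n := n) f y :=
  eventually_eventually_nhds.2 hf

lemma SmoothNear.at (hV : SmoothNear V x) :
    ContMDiffAt (𝓡 n) ((𝓡 n).prod 𝓘(ℝ, Model n)) ∞ (T% V) x := hV.self_of_nhds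

lemma FnSmoothNear.at (hf : FnSmoothNear (n := n) f x) :
    ContMDiffAt (𝓡 n) 𝓘(ℝ, ℝ) ∞ f x := Filter.Eventually.self_of_nhds hf

lemma SmoothNear.mdiff (hV : SmoothNear V x) :
    MDifferentiableAt (𝓡 n) ((𝓡 n).prod 𝓘(ℝ, Model n)) (T% V) x :=
  hV.at.mdifferentiableAt (by simp)

lemma FnSmoothNear.mdiff (hf : FnSmoothNear (n := n) f x) :
    MDifferentiableAt (𝓡 n) 𝓘(ℝ, ℝ) f x :=
  hf.at.mdifferentiableAt (by simp)

lemma SmoothNear.congr (hV : SmoothNear V x) (h : ∀ᶠ y in 𝓝 x, W y = V y) : SmoothNear W x := by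
  filter_upwards [hV, h.eventually_nhds] with y h1 h2
  refine h1.congr_of_eventuallyEq ?_
  filter_upwards [h2] with z hz
  simp [hz]

lemma FnSmoothNear.congr (hV : FnSmoothNear (n := n) f x) (h' : ∀ᶠ y in 𝓝 x, h y = f y) :
    FnSmoothNear (n := n) h x := by
  filter_upwards [hV, h'.eventually_nhds] with y h1 h2
  exact h1.congr_of_eventuallyEq h2

lemma SmoothNear.add (hV : SmoothNear V x) (hW : SmoothNear W x) : SmoothNear (V + W) x := by
  filter_upwards [hV, hW] with y h1 h2 using h1.add_section h2

lemma SmoothNear.sub (hV : SmoothNear V x) (hW : SmoothNear W x) : SmoothNear (V - W) x := by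
  filter_upwards [hV, hW] with y h1 h2 using h1.sub_section h2

lemma SmoothNear.smul (hW : SmoothNear W x) (hf : FnSmoothNear (n := n) f x) :
    SmoothNear (f • W) x := by
  filter_upwards [hf, hW] with y h1 h2 using h1.smul_section h2

lemma SmoothNear.sum {ι : Type*} {s : Finset ι} {V : ι → VField n M}
    (hV : ∀ i ∈ s, SmoothNear (V i) x) : SmoothNear (fun y => ∑ i ∈ s, V i y) x := by
  have := (Filter.eventually_all_finset s).2 hV
  filter_upwards [this] with y h1 using ContMDiffAt.sum_section h1

lemma smoothNear_extend (v : TangentSpace (𝓡 n) x) :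
    SmoothNear (FiberBundle.extend (Model n) v : VField n M) x := by
  obtain ⟨s, hs, h⟩ := FiberBundle.exists_contMDiffOn_extend (k := ∞) (𝓡 n) (Model n) v
  filter_upwards [eventually_eventually_nhds.2 hs] with y hy
  exact h.contMDiffAt hy

lemma FnSmoothNear.const (c : ℝ) : FnSmoothNear (n := n) (fun _ : M => c) x :=
  Filter.Eventually.of_forall fun _ => contMDiffAt_const

lemma FnSmoothNear.add (hf : FnSmoothNear (n := n) f x) (hh : FnSmoothNear (n := n) h x) :
    FnSmoothNear (n := n) (fun y => f y + h y) x := by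
  filter_upwards [hf, hh] with y h1 h2 using h1.add h2

lemma FnSmoothNear.sub (hf : FnSmoothNear (n := n) f x) (hh : FnSmoothNear (n := n) h x) :
    FnSmoothNear (n := n) (fun y => f y - h y) x := by
  filter_upwards [hf, hh] with y h1 h2 using h1.sub h2

lemma FnSmoothNear.mul (hf : FnSmoothNear (n := n) f x) (hh : FnSmoothNear (n := n) h x) :
    FnSmoothNear (n := n) (fun y => f y * h y) x := by
  filter_upwards [hf, hh] with y h1 h2 using h1.mul h2

lemma FnSmoothNear.neg (hf : FnSmoothNear (n := n) f x) :
    FnSmoothNear (n := n) (fun y => - f y) x := by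
  filter_upwards [hf] with y h1 using h1.neg

lemma FnSmoothNear.sum {ι : Type*} {s : Finset ι} {f : ι → M → ℝ}
    (hf : ∀ i ∈ s, FnSmoothNear (n := n) (f i) x) :
    FnSmoothNear (n := n) (fun y => ∑ i ∈ s, f i y) x := by
  have := (Filter.eventually_all_finset s).2 hf
  filter_upwards [this] with y h1
  exact ContMDiffAt.sum h1

lemma FnSmoothNear.comp {φ : ℝ → ℝ} (hf : FnSmoothNear (n := n) f x)
    (hφ : ∀ᶠ y in 𝓝 x, ContDiffAt ℝ ∞ φ (f y)) :
    FnSmoothNear (n := n) (fun y => φ (f y)) x := by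
  filter_upwards [hf, hφ] with y h1 h2
  exact ContMDiffAt.comp y h2.contMDiffAt h1

lemma contMDiffAt_mfderiv_apply {m : ℕ} {B : Type*} [TopologicalSpace B] [ChartedSpace (Model m) B]
    [IsManifold (𝓡 m) ∞ B] {p : M → B}
    (hV : ContMDiffAt (𝓡 n) ((𝓡 n).prod 𝓘(ℝ, Model n)) ∞ (T% V) x)
    (hp : ContMDiffAt (𝓡 n) (𝓡 m) ∞ p x) :
    ContMDiffAt (𝓡 n) ((𝓡 m).prod 𝓘(ℝ, Model m)) ∞
      (fun y => (⟨p y, mfderiv (𝓡 n) (𝓡 m) p y (V y)⟩ : TangentBundle (𝓡 m) B)) x :=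
  ContMDiffAt.clm_apply_of_inCoordinates (b₁ := id) (b₂ := p) (m₀ := x)
    (hp.mfderiv_const (m := ∞) (by simp)) hV hp

lemma contMDiffAt_dir (hV : ContMDiffAt (𝓡 n) ((𝓡 n).prod 𝓘(ℝ, Model n)) ∞ (T% V) x)
    (hf : ContMDiffAt (𝓡 n) 𝓘(ℝ, ℝ) ∞ f x) : ContMDiffAt (𝓡 n) 𝓘(ℝ, ℝ) ∞ (dir V f) x := by
  have h1 : ContMDiffAt (𝓡 n) (𝓘(ℝ, ℝ).prod 𝓘(ℝ, ℝ)) ∞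
      (fun y => (⟨f y, mfderiv (𝓡 n) 𝓘(ℝ, ℝ) f y (V y)⟩ : TangentBundle 𝓘(ℝ, ℝ) ℝ)) x :=
    ContMDiffAt.clm_apply_of_inCoordinates (b₁ := id) (b₂ := f) (m₀ := x)
      (hf.mfderiv_const (m := ∞) (by simp)) hV hf
  exact (contMDiff_snd_tangentBundle_modelSpace ℝ 𝓘(ℝ, ℝ)).contMDiffAt.comp x h1

lemma FnSmoothNear.dir (hf : FnSmoothNear (n := n) f x) (hV : SmoothNear V x) :
    FnSmoothNear (n := n) (dir V f) x := by
  filter_upwards [hf, hV] with y h1 h2 using contMDiffAt_dir h2 h1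

lemma SmoothNear.bracket (hV : SmoothNear V x) (hW : SmoothNear W x) :
    SmoothNear (VectorField.mlieBracket (𝓡 n) V W) x := by
  have : IsManifold (𝓡 n) (∞ + 1) M := by simpa using (inferInstance : IsManifold (𝓡 n) ∞ M)
  filter_upwards [hV, hW] with y h1 h2
  exact ContMDiffAt.mlieBracket_vectorField (m := ⊤) (n := ⊤) h1 h2
    (by simp [minSmoothness_of_isRCLikeNormedField])

lemma dir_add (hf : FnSmoothNear (n := n) f x) (hh : FnSmoothNear (n := n) h x) :
    dir V (fun y => f y + h y) x = dir V f x + dir V h x := by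
  simp [dir, mvfderiv_fun_add hf.mdiff hh.mdiff]

lemma dir_sub (hf : FnSmoothNear (n := n) f x) (hh : FnSmoothNear (n := n) h x) :
    dir V (fun y => f y - h y) x = dir V f x - dir V h x := by
  simp [dir, mvfderiv_fun_sub hf.mdiff hh.mdiff]

lemma dir_mul (hf : FnSmoothNear (n := n) f x) (hh : FnSmoothNear (n := n) h x) :
    dir V (fun y => f y * h y) x = dir V f x * h x + f x * dir V h x := by
  simp [dir, mvfderiv_fun_mul hf.mdiff hh.mdiff]; ring

@[simp] lemma dir_const (c : ℝ) : dir V (fun _ => c) x = 0 := by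
  simp [dir, mvfderiv_const]

lemma dir_const_mul (c : ℝ) (hf : FnSmoothNear (n := n) f x) :
    dir V (fun y => c * f y) x = c * dir V f x := by
  rw [dir_mul (.const c) hf]; simp

lemma dir_neg : dir V (fun y => - f y) x = - dir V f x := by
  simp [dir, mvfderiv_fun_neg]

lemma dir_congr (h' : ∀ᶠ y in 𝓝 x, f y = h y) : dir V f x = dir V h x := by
  have : mfderiv (𝓡 n) 𝓘(ℝ, ℝ) f x = mfderiv (𝓡 n) 𝓘(ℝ, ℝ) h x := Filter.EventuallyEq.mfderiv_eq h'
  simp only [dir, mvfderiv, this]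
  rfl

/-- Apply the Jacobi identity to V, W and f Z, where Z is an auxiliary field with Z x ≠ 0, and
expand by the Leibniz rule. Jacobi for V, W, Z cancels every term in which Z is differentiated,
leaving a multiple of Z x whose coefficient must vanish. In dimension zero there is no such Z, and
both sides are trivially zero. -/
lemma dir_bracket (hV : SmoothNear V x) (hW : SmoothNear W x) (hf : FnSmoothNear (n := n) f x) :
    dir (VectorField.mlieBracket (𝓡 n) V W) f x = dir V (dir W f) x - dir W (dir V f) x := by
  rcases subsingleton_or_nontrivial (TangentSpace (𝓡 n) x) with hs | hs
  · have h0 : ∀ (v : TangentSpace (𝓡 n) x) , v = 0 := fun v => Subsingleton.elim _ _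
    simp [dir, h0 (V x), h0 (W x), h0 (VectorField.mlieBracket (𝓡 n) V W x)]
  obtain ⟨z, hz⟩ := exists_ne (0 : TangentSpace (𝓡 n) x)
  set Z : VField n M := FiberBundle.extend (Model n) z with hZ
  have hZx : Z x = z := by simp [hZ]
  have hZs : SmoothNear Z x := smoothNear_extend z
  have two : ∀ {U : VField n M}, SmoothNear U x →
      ContMDiffAt (𝓡 n) ((𝓡 n).prod 𝓘(ℝ, Model n)) (minSmoothness ℝ 2) (T% U) x := by
    intro U hU
    rw [minSmoothness_of_isRCLikeNormedField]
    exact hU.at.of_le ENat.LEInfty.out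
  have key := VectorField.leibniz_identity_mlieBracket_apply (two hV) (two hW)
    (two (hZs.smul hf))
  have expand : ∀ {U : VField n M}, SmoothNear U x → ∀ᶠ y in 𝓝 x,
      VectorField.mlieBracket (𝓡 n) U (f • Z) y
        = (dir U f • Z + f • VectorField.mlieBracket (𝓡 n) U Z) y := by
    intro U hU
    filter_upwards [hZs.eventually, hf.eventually] with y h1 h2
    exact VectorField.mlieBracket_smul_right h2.mdiff h1.mdiff
  have step : ∀ {U V : VField n M}, SmoothNear U x → SmoothNear V x →
      VectorField.mlieBracket (𝓡 n) V (VectorField.mlieBracket (𝓡 n) U (f • Z)) x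
        = dir V (dir U f) x • Z x + dir U f x • VectorField.mlieBracket (𝓡 n) V Z x
          + (dir V f x • VectorField.mlieBracket (𝓡 n) U Z x
          + f x • VectorField.mlieBracket (𝓡 n) V (VectorField.mlieBracket (𝓡 n) U Z) x) := by
    intro U V hU hV
    have : VectorField.mlieBracket (𝓡 n) V (VectorField.mlieBracket (𝓡 n) U (f • Z)) x
        = VectorField.mlieBracket (𝓡 n) V (dir U f • Z + f • VectorField.mlieBracket (𝓡 n) U Z) x :=
      Filter.EventuallyEq.mlieBracket_vectorField_eq (Filter.EventuallyEq.rfl) (expand hU)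
    rw [this, VectorField.mlieBracket_add_right (hZs.smul (hf.dir hU)).mdiff
        ((hU.bracket hZs).smul hf).mdiff,
      VectorField.mlieBracket_smul_right (hf.dir hU).mdiff hZs.mdiff,
      VectorField.mlieBracket_smul_right hf.mdiff (hU.bracket hZs).mdiff]
    rfl
  rw [step hW hV, step hV hW, (expand (hV.bracket hW)).self_of_nhds] at key
  have key2 := VectorField.leibniz_identity_mlieBracket_apply (two hV) (two hW) (two hZs)
  simp only [Pi.add_apply, Pi.smul_apply', key2, hZx] at key
  have : (dir V (dir W f) x - dir W (dir V f) x
      - dir (VectorField.mlieBracket (𝓡 n) V W) f x) • z = 0 := by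
    rw [← sub_eq_zero] at key
    rw [← key]
    module
  have := (smul_eq_zero.1 this).resolve_right hz
  linarith

end Calculus

/-! ### Orthonormal frames of a metric and their smooth extensions. -/

section MetricFrames

variable {n : ℕ} {M : Type*} [TopologicalSpace M] [ChartedSpace (Model n) M]
  [IsManifold (𝓡 n) ∞ M]

/-- The fields live along a map `b`, so that the lemma also covers the metric of the base evaluated
on vectors dp(V). -/
lemma contMDiffAt_metric (g : Metric n M) {m : ℕ} {N : Type*} [TopologicalSpace N]
    [ChartedSpace (Model m) N] {b : N → M} {v w : (y : N) → TangentSpace (𝓡 n) (b y)} {x : N}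
    (hv : ContMDiffAt (𝓡 m) ((𝓡 n).prod 𝓘(ℝ, Model n)) ∞
      (fun y => (⟨b y, v y⟩ : TangentBundle (𝓡 n) M)) x)
    (hw : ContMDiffAt (𝓡 m) ((𝓡 n).prod 𝓘(ℝ, Model n)) ∞
      (fun y => (⟨b y, w y⟩ : TangentBundle (𝓡 n) M)) x) :
    ContMDiffAt (𝓡 m) 𝓘(ℝ, ℝ) ∞ (fun y => g.inner (b y) (v y) (w y)) x := by
  have hb : ContMDiffAt (𝓡 m) (𝓡 n) ∞ b x := (contMDiffAt_totalSpace.1 hv).1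
  have : ContMDiffAt (𝓡 m) ((𝓡 n).prod 𝓘(ℝ, ℝ)) ∞
      (fun y ↦ TotalSpace.mk' ℝ (E := Bundle.Trivial M ℝ) (b y)
        (g.inner (b y) (v y) (w y))) x :=
    ContMDiffAt.clm_bundle_apply₂ (F₁ := Model n) (F₂ := Model n)
      (g.contMDiff.contMDiffAt.comp x hb) hv hw
  exact (contMDiffAt_totalSpace.1 this).2

lemma FnSmoothNear.metric (g : Metric n M) {V W : VField n M} {x : M} (hV : SmoothNear V x)
    (hW : SmoothNear W x) : FnSmoothNear (n := n) (fun y => g.inner y (V y) (W y)) x := by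
  filter_upwards [hV, hW] with y h1 h2
  exact contMDiffAt_metric g h1 h2

lemma finrank_tangentSpace (x : M) : Module.finrank ℝ (TangentSpace (𝓡 n) x) = n := by
  change Module.finrank ℝ (EuclideanSpace ℝ (Fin n)) = n
  simp

instance finiteDimensional_tangentSpace (x : M) : FiniteDimensional ℝ (TangentSpace (𝓡 n) x) :=
  inferInstanceAs (FiniteDimensional ℝ (EuclideanSpace ℝ (Fin n)))

variable {g : Metric n M} {x : M} {e : Fin n → TangentSpace (𝓡 n) x}

lemma IsOrthonormalFrame.linearIndependent (he : IsOrthonormalFrame g x e) :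
    LinearIndependent ℝ e := by
  rw [Fintype.linearIndependent_iff]
  intro c hc i
  have := congrArg (fun v => g.inner x v (e i)) hc
  simpa [he _ i] using this

/-- An orthonormal frame as a basis. -/
def IsOrthonormalFrame.basis (he : IsOrthonormalFrame g x e) :
    Module.Basis (Fin n) ℝ (TangentSpace (𝓡 n) x) :=
  basisOfLinearIndependentOfCardEqFinrank' e he.linearIndependent
    (by rw [finrank_tangentSpace, Fintype.card_fin])

@[simp] lemma IsOrthonormalFrame.basis_apply (he : IsOrthonormalFrame g x e) (i : Fin n) :
    he.basis i = e i := by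
  simp [IsOrthonormalFrame.basis]

lemma IsOrthonormalFrame.sum_eq (he : IsOrthonormalFrame g x e) (v : TangentSpace (𝓡 n) x) :
    ∑ i, g.inner x v (e i) • e i = v := by
  conv_rhs => rw [← he.basis.sum_repr v]
  refine Finset.sum_congr rfl fun i _ => ?_
  have : g.inner x v (e i) = he.basis.repr v i := by
    conv_lhs => rw [← he.basis.sum_repr v]
    simp [he _ i]
  rw [this, he.basis_apply]

lemma IsOrthonormalFrame.ext (he : IsOrthonormalFrame g x e) {v w : TangentSpace (𝓡 n) x}
    (h : ∀ i, g.inner x v (e i) = g.inner x w (e i)) : v = w := by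
  rw [← he.sum_eq v, ← he.sum_eq w]
  simp [h]

lemma IsOrthonormalFrame.inner_eq (he : IsOrthonormalFrame g x e) (v w : TangentSpace (𝓡 n) x) :
    g.inner x v w = ∑ i, g.inner x v (e i) * g.inner x w (e i) := by
  conv_lhs => rw [← he.sum_eq w]
  simp [mul_comm]

/-- The trace of a bilinear form does not depend on the orthonormal frame. -/
lemma IsOrthonormalFrame.trace_eq {A : Type*} [AddCommGroup A] [Module ℝ A]
    {e' : Fin n → TangentSpace (𝓡 n) x}
    (he : IsOrthonormalFrame g x e) (he' : IsOrthonormalFrame g x e')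
    (T : TangentSpace (𝓡 n) x →ₗ[ℝ] TangentSpace (𝓡 n) x →ₗ[ℝ] A) :
    ∑ i, T (e' i) (e' i) = ∑ i, T (e i) (e i) := by
  have h1 : ∀ i, T (e' i) (e' i)
      = ∑ j, ∑ k, (g.inner x (e' i) (e j) * g.inner x (e' i) (e k)) • T (e j) (e k) := by
    intro i
    conv_lhs => rw [← he.sum_eq (e' i)]
    simp only [map_sum, map_smul, LinearMap.sum_apply, LinearMap.smul_apply, smul_smul,
      Finset.smul_sum]
    rw [Finset.sum_comm]
    refine Finset.sum_congr rfl fun j _ => Finset.sum_congr rfl fun k _ => ?_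
    rw [mul_comm]
  simp only [h1]
  rw [Finset.sum_comm]
  refine Finset.sum_congr rfl fun j _ => ?_
  rw [Finset.sum_comm]
  have h2 : ∀ k, ∑ i, (g.inner x (e' i) (e j) * g.inner x (e' i) (e k)) • T (e j) (e k)
      = (if j = k then (1 : ℝ) else 0) • T (e j) (e k) := by
    intro k
    rw [← Finset.sum_smul, ← he j k, he'.inner_eq (e j) (e k)]
    congr 1
    exact Finset.sum_congr rfl fun i _ => by rw [g.symm x (e' i), g.symm x (e' i)]
  simp [h2]

lemma exists_isOrthonormalFrame (g : Metric n M) (x : M) :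
    ∃ e : Fin n → TangentSpace (𝓡 n) x, IsOrthonormalFrame g x e := by
  -- Makes each tangent space an inner product space, with `g` as its inner product.
  let _ : RiemannianBundle (fun x : M => TangentSpace (𝓡 n) x) := ⟨g.toRiemannianMetric⟩
  let b := stdOrthonormalBasis ℝ (TangentSpace (𝓡 n) x)
  let b' := b.reindex (finCongr (finrank_tangentSpace x))
  refine ⟨b', fun i j => ?_⟩
  have := orthonormal_iff_ite.1 b'.orthonormal i j
  exact this

/-- Local extension of orthonormal frames (Gram-Schmidt). -/
lemma IsOrthonormalFrame.exists_extension (he : IsOrthonormalFrame g x e) :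
    ∃ E : Fin n → VField n M, (∀ i, E i x = e i) ∧ (∀ i, SmoothNear (E i) x) ∧
      ∀ᶠ y in 𝓝 x, IsOrthonormalFrame g y (fun i => E i y) := by
  have key : ∀ s : Finset (Fin n), ∃ E : Fin n → VField n M, (∀ i, E i x = e i) ∧
      (∀ i, SmoothNear (E i) x) ∧
      ∀ᶠ y in 𝓝 x, ∀ i ∈ s, ∀ j ∈ s, g.inner y (E i y) (E j y) = if i = j then 1 else 0 := by
    intro s
    induction s using Finset.induction_on with
    | empty =>
      exact ⟨fun i => FiberBundle.extend (Model n) (e i), by simp, fun i => smoothNear_extend _,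
        by simp⟩
    | insert a s ha ih =>
      obtain ⟨E, hE, hs, ho⟩ := ih
      -- Gram-Schmidt. The vectors are already orthonormal at `x`, so nothing is subtracted there
      -- and `V x = e a`. In particular `V` has norm 1 at `x` and can be normalized nearby.
      let V : VField n M := E a - fun y => ∑ i ∈ s, g.inner y (E a y) (E i y) • E i y
      have hV : SmoothNear V x := (hs a).sub (SmoothNear.sum fun i _ =>
        (hs i).smul (f := fun y => g.inner y (E a y) (E i y)) (.metric g (hs a) (hs i)))
      have hVx : V x = e a := by
        simp only [V, Pi.sub_apply, hE]
        rw [Finset.sum_eq_zero, sub_zero]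
        intro i hi
        rw [he a i, if_neg (by rintro rfl; exact ha hi), zero_smul]
      have hN := FnSmoothNear.metric g hV hV
      have hpos : ∀ᶠ y in 𝓝 x, 0 < g.inner y (V y) (V y) := by
        refine hN.at.continuousAt.eventually (lt_mem_nhds ?_)
        simp only [hVx]
        rw [he a a]; simp
      have hf : FnSmoothNear (n := n) (fun y => (Real.sqrt (g.inner y (V y) (V y)))⁻¹) x :=
        hN.comp (φ := fun t => (Real.sqrt t)⁻¹) (hpos.mono fun y hy =>
          (Real.contDiffAt_sqrt hy.ne').inv (Real.sqrt_pos.2 hy).ne')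
      refine ⟨Function.update E a (fun y => (Real.sqrt (g.inner y (V y) (V y)))⁻¹ • V y),
        fun i => ?_, fun i => ?_, ?_⟩
      · by_cases h : i = a
        · subst h; simp [hVx, he i i]
        · simp [h, hE]
      · by_cases h : i = a
        · subst h; rw [Function.update_self]; exact hV.smul hf
        · simpa [h] using hs i
      · filter_upwards [hpos, ho] with y hy hoy
        have hVE : ∀ i ∈ s, g.inner y (V y) (E i y) = 0 := by
          intro i hi
          simp only [V, Pi.sub_apply, map_sub, sub_apply, map_sum,
            sum_apply, map_smul, smul_apply, smul_eq_mul]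
          rw [Finset.sum_eq_single i]
          · rw [hoy i hi i hi]; simp
          · intro j hj hji; rw [hoy j hj i hi, if_neg hji, mul_zero]
          · exact fun h => (h hi).elim
        have hne : ∀ i ∈ s, i ≠ a := by rintro i hi rfl; exact ha hi
        intro i hi j hj
        rcases Finset.mem_insert.1 hi with rfl | hi' <;> rcases Finset.mem_insert.1 hj with rfl | hj'
        · have := Real.mul_self_sqrt hy.le
          have h0 := (Real.sqrt_pos.2 hy).ne'
          simp only [Function.update_self, map_smul, smul_apply, smul_eq_mul,
            if_true]
          field_simp
          rw [sq, this]
        · simp [hne j hj', (hne j hj').symm, hVE j hj']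
        · rw [g.symm]; simp [hne i hi', hVE i hi']
        · simp [hne i hi', hne j hj', hoy i hi' j hj']
  obtain ⟨E, h1, h2, h3⟩ := key Finset.univ
  exact ⟨E, h1, h2, h3.mono fun y hy i j => hy i (by simp) j (by simp)⟩

/-- Smoothness of a vector field can be tested on an orthonormal frame. -/
lemma smoothNear_of_frame {E : Fin n → VField n M} (hE : ∀ i, SmoothNear (E i) x)
    (ho : ∀ᶠ y in 𝓝 x, IsOrthonormalFrame g y (fun i => E i y)) {V : VField n M}
    (hV : ∀ i, FnSmoothNear (n := n) (fun y => g.inner y (V y) (E i y)) x) : SmoothNear V x := by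
  have h : SmoothNear (fun y => ∑ i, g.inner y (V y) (E i y) • E i y) x :=
    SmoothNear.sum fun i _ => (hE i).smul (hV i)
  refine h.congr ?_
  filter_upwards [ho] with y hy
  exact (hy.sum_eq (V y)).symm

end MetricFrames

/-! ### Connections on the tangent bundle; tensoriality of the curvature. -/

section Connections

variable {n : ℕ} {M : Type*} [TopologicalSpace M] [ChartedSpace (Model n) M]
  [IsManifold (𝓡 n) ∞ M]

variable (n M) in
/-- Connections on the tangent bundle. -/
abbrev Conn : Type _ := CovariantDerivative (𝓡 n) (Model n) (fun x : M => TangentSpace (𝓡 n) x)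

/-- The derivative of a vector field along another one. -/
def nabla (D : Conn n M) (V W : VField n M) : VField n M := fun y => D W y (V y)

/-- The curvature operator on vector fields. -/
def curvatureField (D : Conn n M) (U V W : VField n M) (x : M) : TangentSpace (𝓡 n) x :=
  nabla D U (nabla D V W) x - nabla D V (nabla D U W) x
    - nabla D (VectorField.mlieBracket (𝓡 n) U V) W x

lemma curvature_eq (D : Conn n M) (x : M) (u v w : TangentSpace (𝓡 n) x) :
    curvature D x u v w = curvatureField D (FiberBundle.extend (Model n) u)
      (FiberBundle.extend (Model n) v) (FiberBundle.extend (Model n) w) x := by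
  have : ∀ (W : VField n M) (v : TangentSpace (𝓡 n) x),
      D W x (FiberBundle.extend (Model n) v x) = D W x v := by simp
  simp only [curvature, curvatureField, nabla, this]
  rfl

variable {U U' V V' W W' : VField n M} {f : M → ℝ} {x : M} {D : Conn n M}

/-- The smoothness condition on a connection is tested on global sections. Since a connection is
local, a germ may be replaced by its product with a bump function; this is where the Hausdorff
property enters. -/
lemma SmoothNear.exists_global [T2Space M] (hW : SmoothNear W x) :
    ∃ W' : VField n M, ContMDiff (𝓡 n) ((𝓡 n).prod 𝓘(ℝ, Model n)) ∞ (T% W') ∧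
      ∀ᶠ y in 𝓝 x, W' y = W y := by
  obtain ⟨u, hu, huo, hxu⟩ := eventually_nhds_iff.1 hW
  obtain ⟨ψ, -, hψ⟩ := (SmoothBumpFunction.nhds_basis_tsupport (I := 𝓡 n) x).mem_iff.1
    (huo.mem_nhds hxu)
  refine ⟨(ψ : M → ℝ) • W, ContMDiffOn.smul_section_of_tsupport ψ.contMDiff.contMDiffOn huo hψ
    fun y hy => (hu y hy).contMDiffWithinAt, ?_⟩
  filter_upwards [ψ.eventuallyEq_one] with y hy
  simp [hy]

lemma nabla_congr (hW : SmoothNear W x) (h : ∀ᶠ y in 𝓝 x, W' y = W y) :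
    nabla D V W' x = nabla D V W x := by
  have := D.isCovariantDerivativeOnUniv.congr_of_eventuallyEq (hW.congr h).mdiff hW.mdiff
    Filter.univ_mem h
  exact congrArg (fun L => L (V x)) this

lemma nabla_add (hW : SmoothNear W x) (hW' : SmoothNear W' x) :
    nabla D V (W + W') x = nabla D V W x + nabla D V W' x := by
  have := D.isCovariantDerivativeOnUniv.add hW.mdiff hW'.mdiff
  exact congrArg (fun L => L (V x)) this

lemma nabla_smul (hW : SmoothNear W x) (hf : FnSmoothNear (n := n) f x) :
    nabla D V (f • W) x = f x • nabla D V W x + dir V f x • W x := by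
  have := D.isCovariantDerivativeOnUniv.leibniz hW.mdiff hf.mdiff
  exact congrArg (fun L => L (V x)) this

lemma nabla_sum_smul {ι : Type*} {s : Finset ι} {f : ι → M → ℝ} {E : ι → VField n M}
    (hE : ∀ i ∈ s, SmoothNear (E i) x) (hf : ∀ i ∈ s, FnSmoothNear (n := n) (f i) x) :
    nabla D V (fun y => ∑ i ∈ s, f i y • E i y) x
      = ∑ i ∈ s, (f i x • nabla D V (E i) x + dir V (f i) x • E i x) := by
  classical
  induction s using Finset.induction_on with
  | empty =>
    have : nabla D V (0 : VField n M) x = 0 := by simp [nabla]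
    simp only [Finset.sum_empty]
    exact this
  | insert a s ha ih =>
    simp only [Finset.sum_insert ha]
    have h1 : SmoothNear (fun y => ∑ i ∈ s, f i y • E i y) x :=
      SmoothNear.sum fun i hi => (hE i (by simp [hi])).smul (hf i (by simp [hi]))
    rw [← ih (fun i hi => hE i (by simp [hi])) (fun i hi => hf i (by simp [hi])),
      ← nabla_smul (hE a (by simp)) (hf a (by simp)),
      ← nabla_add ((hE a (by simp)).smul (hf a (by simp))) h1]
    rfl

lemma SmoothNear.nabla [T2Space M]
    (hD : CovariantDerivative.ContMDiffCovariantDerivative D ∞)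
    (hV : SmoothNear V x) (hW : SmoothNear W x) : SmoothNear (nabla D V W) x := by
  obtain ⟨W', hW', h⟩ := hW.exists_global
  have hs : SmoothNear (WeylGeometry.nabla D V W') x := by
    have h1 := hD.contMDiff.contMDiff (σ := W') (by simpa using hW'.contMDiffOn)
    filter_upwards [hV] with y hy
    exact ContMDiffAt.clm_bundle_apply (F₁ := Model n) (F₂ := Model n)
      (h1.contMDiffAt Filter.univ_mem) hy
  refine hs.congr ?_
  filter_upwards [hW.eventually, h.eventually_nhds] with y h1 h2
  exact (nabla_congr h1 h2).symm

/-- Expressions in a vector field which only depend on its value at `x`. -/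
structure TensorialNear {A : Type*} [AddCommGroup A] [Module ℝ A] (T : VField n M → A) (x : M) :
    Prop where
  add : ∀ {V W}, SmoothNear V x → SmoothNear W x → T (V + W) = T V + T W
  smul : ∀ {V} {f : M → ℝ}, SmoothNear V x → FnSmoothNear (n := n) f x → T (f • V) = f x • T V
  congr : ∀ {V W}, SmoothNear W x → (∀ᶠ y in 𝓝 x, V y = W y) → T V = T W

namespace TensorialNear

variable {A : Type*} [AddCommGroup A] [Module ℝ A] {T : VField n M → A}

lemma sum_smul (hT : TensorialNear T x) {ι : Type*} {s : Finset ι} {f : ι → M → ℝ}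
    {E : ι → VField n M} (hE : ∀ i ∈ s, SmoothNear (E i) x)
    (hf : ∀ i ∈ s, FnSmoothNear (n := n) (f i) x) :
    T (fun y => ∑ i ∈ s, f i y • E i y) = ∑ i ∈ s, f i x • T (E i) := by
  classical
  induction s using Finset.induction_on with
  | empty =>
    have : T (fun y => (0 : ℝ) • (0 : VField n M) y) = (0 : ℝ) • T 0 :=
      hT.smul (V := 0) (f := fun _ => 0)
        (Filter.Eventually.of_forall fun y => contMDiff_zeroSection _ _ y) (.const 0)
    simpa using this
  | insert a s ha ih =>
    simp only [Finset.sum_insert ha]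
    have h1 : SmoothNear (fun y => ∑ i ∈ s, f i y • E i y) x :=
      SmoothNear.sum fun i hi => (hE i (by simp [hi])).smul (hf i (by simp [hi]))
    rw [← ih (fun i hi => hE i (by simp [hi])) (fun i hi => hf i (by simp [hi])),
      ← hT.smul (hE a (by simp)) (hf a (by simp)),
      ← hT.add ((hE a (by simp)).smul (hf a (by simp))) h1]
    rfl

lemma eq_sum (hT : TensorialNear T x) {g : Metric n M} {E : Fin n → VField n M}
    (hE : ∀ i, SmoothNear (E i) x) (ho : ∀ᶠ y in 𝓝 x, IsOrthonormalFrame g y (fun i => E i y))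
    (hV : SmoothNear V x) : T V = ∑ i, g.inner x (V x) (E i x) • T (E i) := by
  rw [← hT.sum_smul (fun i _ => hE i)
    (f := fun i y => g.inner y (V y) (E i y)) (fun i _ => .metric g hV (hE i))]
  refine (hT.congr hV ?_).symm
  filter_upwards [ho] with y hy
  exact hy.sum_eq (V y)

/-- In a local frame, an expression linear over functions becomes a sum whose coefficients are
components at `x`, so it sees only the value of the field at `x`. -/
lemma eq (hT : TensorialNear T x) (g : Metric n M) (hV : SmoothNear V x) (hW : SmoothNear W x)
    (h : V x = W x) : T V = T W := by
  obtain ⟨e, he⟩ := exists_isOrthonormalFrame g x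
  obtain ⟨E, -, hE, ho⟩ := he.exists_extension
  rw [hT.eq_sum hE ho hV, hT.eq_sum hE ho hW, h]

end TensorialNear

section Curvature

variable [T2Space M] (hD : CovariantDerivative.ContMDiffCovariantDerivative D ∞)
include hD

/-- The terms with one derivative of `f` cancel by symmetry in U and V. Those with two leave U(Vf) -
V(Uf), which `dir_bracket` matches with the bracket term. -/
lemma curvatureField_smul_right (hU : SmoothNear U x) (hV : SmoothNear V x)
    (hW : SmoothNear W x) (hf : FnSmoothNear (n := n) f x) :
    curvatureField D U V (f • W) x = f x • curvatureField D U V W x := by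
  have step : ∀ {U V : VField n M}, SmoothNear U x → SmoothNear V x →
      nabla D U (nabla D V (f • W)) x = (f x • nabla D U (nabla D V W) x
        + dir U f x • nabla D V W x) + (dir V f x • nabla D U W x + dir U (dir V f) x • W x) := by
    intro U V hU hV
    rw [← nabla_smul (hV.nabla hD hW) hf, ← nabla_smul hW (hf.dir hV),
      ← nabla_add ((hV.nabla hD hW).smul hf) (hW.smul (hf.dir hV))]
    refine nabla_congr (((hV.nabla hD hW).smul hf).add (hW.smul (hf.dir hV))) ?_
    filter_upwards [hW.eventually, hf.eventually] with y h1 h2 using nabla_smul h1 h2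
  simp only [curvatureField]
  rw [step hU hV, step hV hU, nabla_smul hW hf, dir_bracket hU hV hf]
  module

lemma curvatureField_add_right (hU : SmoothNear U x) (hV : SmoothNear V x)
    (hW : SmoothNear W x) (hW' : SmoothNear W' x) :
    curvatureField D U V (W + W') x = curvatureField D U V W x + curvatureField D U V W' x := by
  have step : ∀ {U V : VField n M}, SmoothNear U x → SmoothNear V x →
      nabla D U (nabla D V (W + W')) x
        = nabla D U (nabla D V W) x + nabla D U (nabla D V W') x := by
    intro U V hU hV
    rw [← nabla_add (hV.nabla hD hW) (hV.nabla hD hW')]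
    refine nabla_congr ((hV.nabla hD hW).add (hV.nabla hD hW')) ?_
    filter_upwards [hW.eventually, hW'.eventually] with y h1 h2 using nabla_add h1 h2
  simp only [curvatureField]
  rw [step hU hV, step hV hU, nabla_add hW hW']
  abel

lemma curvatureField_congr_right (hU : SmoothNear U x) (hV : SmoothNear V x)
    (hW : SmoothNear W x) (h : ∀ᶠ y in 𝓝 x, W' y = W y) :
    curvatureField D U V W' x = curvatureField D U V W x := by
  have step : ∀ {U V : VField n M}, SmoothNear U x → SmoothNear V x →
      nabla D U (nabla D V W') x = nabla D U (nabla D V W) x := by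
    intro U V hU hV
    refine nabla_congr (hV.nabla hD hW) ?_
    filter_upwards [hW.eventually, h.eventually_nhds] with y h1 h2 using nabla_congr h1 h2
  simp only [curvatureField]
  rw [step hU hV, step hV hU, nabla_congr hW h]

omit hD [T2Space M] in
lemma curvatureField_swap : curvatureField D U V W x = - curvatureField D V U W x := by
  have : nabla D (VectorField.mlieBracket (𝓡 n) U V) W x
      = - nabla D (VectorField.mlieBracket (𝓡 n) V U) W x := by
    simp only [nabla]
    rw [VectorField.mlieBracket_swap_apply, map_neg]
  simp only [curvatureField, this]
  abel

/-- The derivative V(f) arising from D_V (f D_U W) cancels the one in [f U, V] = f [U, V] - V(f) U.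
-/
lemma curvatureField_smul_left (hU : SmoothNear U x) (hW : SmoothNear W x)
    (hf : FnSmoothNear (n := n) f x) :
    curvatureField D (f • U) V W x = f x • curvatureField D U V W x := by
  have h1 : nabla D (f • U) W = f • nabla D U W := by
    ext1 y; simp [nabla]
  have h2 : ∀ Z, nabla D (f • U) Z x = f x • nabla D U Z x := fun Z => by simp [nabla]
  have h3 : nabla D (VectorField.mlieBracket (𝓡 n) (f • U) V) W x
      = - (dir V f x • nabla D U W x)
        + f x • nabla D (VectorField.mlieBracket (𝓡 n) U V) W x := by
    simp only [nabla]
    rw [VectorField.mlieBracket_smul_left hf.mdiff hU.mdiff]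
    simp [dir]
  simp only [curvatureField]
  rw [h1, h2, h3, nabla_smul (hU.nabla hD hW) hf]
  module

lemma curvatureField_add_left (hU : SmoothNear U x) (hU' : SmoothNear U' x)
    (hW : SmoothNear W x) :
    curvatureField D (U + U') V W x = curvatureField D U V W x + curvatureField D U' V W x := by
  have h1 : nabla D (U + U') W = nabla D U W + nabla D U' W := by
    ext1 y; simp [nabla]
  have h2 : ∀ Z, nabla D (U + U') Z x = nabla D U Z x + nabla D U' Z x :=
    fun Z => by simp [nabla]
  have h3 : nabla D (VectorField.mlieBracket (𝓡 n) (U + U') V) W x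
      = nabla D (VectorField.mlieBracket (𝓡 n) U V) W x
        + nabla D (VectorField.mlieBracket (𝓡 n) U' V) W x := by
    simp only [nabla]
    rw [VectorField.mlieBracket_add_left hU.mdiff hU'.mdiff]
    simp
  simp only [curvatureField]
  rw [h1, h2, h3, nabla_add (hU.nabla hD hW) (hU'.nabla hD hW)]
  abel

lemma curvatureField_congr_left (hU : SmoothNear U x) (hW : SmoothNear W x)
    (h : ∀ᶠ y in 𝓝 x, U' y = U y) :
    curvatureField D U' V W x = curvatureField D U V W x := by
  have h1 : ∀ Z, nabla D U' Z x = nabla D U Z x := fun Z => by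
    simp [nabla, h.self_of_nhds]
  have h2 : nabla D V (nabla D U' W) x = nabla D V (nabla D U W) x := by
    refine nabla_congr (hU.nabla hD hW) ?_
    filter_upwards [h] with y hy
    simp [nabla, hy]
  have h3 : VectorField.mlieBracket (𝓡 n) U' V x = VectorField.mlieBracket (𝓡 n) U V x :=
    Filter.EventuallyEq.mlieBracket_vectorField_eq h Filter.EventuallyEq.rfl
  simp only [curvatureField, h1, h2]
  simp only [nabla, h3]

lemma tensorialNear_curvatureField_right (hU : SmoothNear U x) (hV : SmoothNear V x) :
    TensorialNear (fun W => curvatureField D U V W x) x where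
  add h1 h2 := curvatureField_add_right hD hU hV h1 h2
  smul h1 h2 := curvatureField_smul_right hD hU hV h1 h2
  congr h1 h2 := curvatureField_congr_right hD hU hV h1 h2

lemma tensorialNear_curvatureField_left (hW : SmoothNear W x) :
    TensorialNear (fun U => curvatureField D U V W x) x where
  add h1 h2 := curvatureField_add_left hD h1 h2 hW
  smul h1 h2 := curvatureField_smul_left hD h1 hW h2
  congr h1 h2 := curvatureField_congr_left hD h1 hW h2

lemma tensorialNear_curvatureField_mid (hW : SmoothNear W x) :
    TensorialNear (fun V => curvatureField D U V W x) x where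
  add h1 h2 := by
    simp only [curvatureField_swap (U := U)]
    rw [curvatureField_add_left hD h1 h2 hW]
    abel
  smul h1 h2 := by
    simp only [curvatureField_swap (U := U)]
    rw [curvatureField_smul_left hD h1 hW h2, smul_neg]
  congr h1 h2 := by
    simp only [curvatureField_swap (U := U)]
    rw [curvatureField_congr_left hD h1 hW h2]

/-- The curvature can be computed with any smooth extensions of the tangent vectors. -/
lemma curvature_eq_curvatureField (g : Metric n M) (hU : SmoothNear U x) (hV : SmoothNear V x)
    (hW : SmoothNear W x) : curvature D x (U x) (V x) (W x) = curvatureField D U V W x := by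
  have e : ∀ v : TangentSpace (𝓡 n) x,
      SmoothNear (FiberBundle.extend (Model n) v : VField n M) x := smoothNear_extend
  rw [curvature_eq]
  rw [(tensorialNear_curvatureField_right hD (e _) (e _)).eq g (e (W x)) hW (by simp),
    (tensorialNear_curvatureField_mid hD hW).eq g (e (V x)) hV (by simp),
    (tensorialNear_curvatureField_left hD hW).eq g (e (U x)) hU (by simp)]

/-- The curvature as a trilinear map in a frame. -/
lemma curvature_eq_sum {g : Metric n M} {E : Fin n → VField n M}
    (hE : ∀ i, SmoothNear (E i) x) (ho : ∀ᶠ y in 𝓝 x, IsOrthonormalFrame g y (fun i => E i y))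
    (u v w : TangentSpace (𝓡 n) x) :
    curvature D x u v w = ∑ a, ∑ b, ∑ c, (g.inner x u (E a x) * g.inner x v (E b x)
      * g.inner x w (E c x)) • curvature D x (E a x) (E b x) (E c x) := by
  have e : ∀ v : TangentSpace (𝓡 n) x,
      SmoothNear (FiberBundle.extend (Model n) v : VField n M) x := smoothNear_extend
  rw [curvature_eq, (tensorialNear_curvatureField_left hD (e w)).eq_sum hE ho (e u)]
  refine Finset.sum_congr rfl fun a _ => ?_
  rw [(tensorialNear_curvatureField_mid hD (e w)).eq_sum hE ho (e v), Finset.smul_sum]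
  refine Finset.sum_congr rfl fun b _ => ?_
  rw [(tensorialNear_curvatureField_right hD (hE a) (hE b)).eq_sum hE ho (e w), Finset.smul_sum,
    Finset.smul_sum]
  refine Finset.sum_congr rfl fun c _ => ?_
  rw [curvature_eq_curvatureField hD g (hE a) (hE b) (hE c)]
  simp [smul_smul, mul_assoc]

end Curvature

end Connections

/-! ### Structure equations in an orthonormal frame. -/

section FrameCalculus

variable {n : ℕ} {M : Type*} [TopologicalSpace M] [ChartedSpace (Model n) M]
  [IsManifold (𝓡 n) ∞ M]

/-- Smooth orthonormal frames near a point. -/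
structure IsFrameNear (g : Metric n M) (E : Fin n → VField n M) (x : M) : Prop where
  smooth : ∀ i, SmoothNear (E i) x
  orthonormal : ∀ᶠ y in 𝓝 x, IsOrthonormalFrame g y (fun i => E i y)

lemma IsFrameNear.at {g : Metric n M} {E : Fin n → VField n M} {x : M} (h : IsFrameNear g E x) :
    IsOrthonormalFrame g x (fun i => E i x) := h.orthonormal.self_of_nhds

lemma IsFrameNear.eventually {g : Metric n M} {E : Fin n → VField n M} {x : M}
    (h : IsFrameNear g E x) : ∀ᶠ y in 𝓝 x, IsFrameNear g E y := by
  have h1 : ∀ᶠ y in 𝓝 x, ∀ i, SmoothNear (E i) y :=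
    Filter.eventually_all.2 fun i => (h.smooth i).eventually
  filter_upwards [h1, h.orthonormal.eventually_nhds] with y h1 h2 using ⟨h1, h2⟩

/-- The structure functions `g([E_a, E_b], E_c)` of a frame. -/
def structFn (g : Metric n M) (E : Fin n → VField n M) (a b c : Fin n) (x : M) : ℝ :=
  g.inner x (VectorField.mlieBracket (𝓡 n) (E a) (E b) x) (E c x)

/-- The connection coefficients `g(D_{E_a} E_b, E_c)` of a frame. -/
def connFn (D : Conn n M) (g : Metric n M) (E : Fin n → VField n M) (a b c : Fin n) (x : M) : ℝ :=
  g.inner x (nabla D (E a) (E b) x) (E c x)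

/-- The components `g(R(E_a, E_b) E_c, E_d)` of the curvature in a frame. -/
def curvFn (D : Conn n M) (g : Metric n M) (E : Fin n → VField n M) (a b c d : Fin n) (x : M) :
    ℝ :=
  g.inner x (curvature D x (E a x) (E b x) (E c x)) (E d x)

variable {g : Metric n M} {E : Fin n → VField n M} {x : M} {D : Conn n M}

lemma structFn_swap (a b c : Fin n) : structFn g E a b c x = - structFn g E b a c x := by
  simp only [structFn]
  rw [VectorField.mlieBracket_swap_apply]
  simp

lemma IsFrameNear.smooth_structFn (h : IsFrameNear g E x) (a b c : Fin n) :
    FnSmoothNear (n := n) (structFn g E a b c) x :=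
  .metric g ((h.smooth a).bracket (h.smooth b)) (h.smooth c)

lemma IsFrameNear.smooth_connFn [T2Space M]
    (hD : CovariantDerivative.ContMDiffCovariantDerivative D ∞) (h : IsFrameNear g E x)
    (a b c : Fin n) : FnSmoothNear (n := n) (connFn D g E a b c) x :=
  .metric g ((h.smooth a).nabla hD (h.smooth b)) (h.smooth c)

lemma IsFrameNear.bracket_eq (h : IsFrameNear g E x) (a b : Fin n) :
    VectorField.mlieBracket (𝓡 n) (E a) (E b) x = ∑ c, structFn g E a b c x • E c x :=
  (h.at.sum_eq _).symm

lemma curvFn_swap [T2Space M] (hD : CovariantDerivative.ContMDiffCovariantDerivative D ∞)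
    (h : IsFrameNear g E x) (a b c d : Fin n) :
    curvFn D g E a b c d x = - curvFn D g E b a c d x := by
  simp only [curvFn]
  rw [curvature_eq_curvatureField hD g (h.smooth a) (h.smooth b) (h.smooth c),
    curvature_eq_curvatureField hD g (h.smooth b) (h.smooth a) (h.smooth c), curvatureField_swap]
  simp

lemma IsFrameNear.nabla_nabla [T2Space M]
    (hD : CovariantDerivative.ContMDiffCovariantDerivative D ∞) (h : IsFrameNear g E x)
    (a b c d : Fin n) :
    g.inner x (nabla D (E a) (nabla D (E b) (E c)) x) (E d x)
      = dir (E a) (connFn D g E b c d) x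
        + ∑ f, connFn D g E b c f x * connFn D g E a f d x := by
  have h1 : nabla D (E a) (nabla D (E b) (E c)) x
      = nabla D (E a) (fun y => ∑ f, connFn D g E b c f y • E f y) x := by
    refine nabla_congr (SmoothNear.sum fun f _ => (h.smooth f).smul (h.smooth_connFn hD b c f)) ?_
    filter_upwards [h.orthonormal] with y hy
    exact (hy.sum_eq _).symm
  rw [h1, nabla_sum_smul (fun f _ => h.smooth f) (fun f _ => h.smooth_connFn hD b c f)]
  simp only [map_sum, map_add, map_smul, sum_apply, add_apply, smul_apply, smul_eq_mul,
    Finset.sum_add_distrib]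
  rw [add_comm]
  congr 1
  rw [Finset.sum_eq_single d]
  · rw [h.at d d]; simp
  · intro f _ hf
    rw [h.at f d, if_neg hf, mul_zero]
  · simp

/-- The second structure equation. -/
lemma IsFrameNear.curvFn_eq [T2Space M]
    (hD : CovariantDerivative.ContMDiffCovariantDerivative D ∞) (h : IsFrameNear g E x)
    (a b c d : Fin n) :
    curvFn D g E a b c d x = dir (E a) (connFn D g E b c d) x - dir (E b) (connFn D g E a c d) x
      + ∑ f, (connFn D g E b c f x * connFn D g E a f d x
        - connFn D g E a c f x * connFn D g E b f d x
        - structFn g E a b f x * connFn D g E f c d x) := by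
  have h3 : g.inner x (nabla D (VectorField.mlieBracket (𝓡 n) (E a) (E b)) (E c) x) (E d x)
      = ∑ f, structFn g E a b f x * connFn D g E f c d x := by
    simp only [nabla]
    rw [h.bracket_eq a b]
    simp [connFn, nabla]
  simp only [curvFn]
  rw [curvature_eq_curvatureField hD g (h.smooth a) (h.smooth b) (h.smooth c)]
  simp only [curvatureField, map_sub, sub_apply]
  rw [h.nabla_nabla hD, h.nabla_nabla hD, h3]
  simp only [Finset.sum_sub_distrib]
  ring

/-- The first Bianchi identity. -/
lemma curvFn_bianchi [T2Space M]
    (hD : CovariantDerivative.ContMDiffCovariantDerivative D ∞) (ht : D.torsion = 0)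
    (h : IsFrameNear g E x) (a b c d : Fin n) :
    curvFn D g E a b c d x + curvFn D g E b c a d x + curvFn D g E c a b d x = 0 := by
  have key : ∀ {U V : VField n M} {y : M}, SmoothNear U y → SmoothNear V y →
      nabla D U V y - nabla D V U y = VectorField.mlieBracket (𝓡 n) U V y := by
    intro U V y hU hV
    exact (CovariantDerivative.torsion_eq_zero_iff D).1 ht hU.mdiff hV.mdiff
  have two : ∀ {U : VField n M}, SmoothNear U x →
      ContMDiffAt (𝓡 n) ((𝓡 n).prod 𝓘(ℝ, Model n)) (minSmoothness ℝ 2) (T% U) x := by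
    intro U hU
    rw [minSmoothness_of_isRCLikeNormedField]
    exact hU.at.of_le ENat.LEInfty.out
  -- Without torsion, each of these combinations is an iterated bracket. Summed cyclically, the left
  -- sides give the curvature terms and the right sides give the Jacobi identity.
  have step : ∀ {U V W : VField n M}, SmoothNear U x → SmoothNear V x → SmoothNear W x →
      nabla D U (nabla D V W) x - nabla D U (nabla D W V) x
        - nabla D (VectorField.mlieBracket (𝓡 n) V W) U x
        = VectorField.mlieBracket (𝓡 n) U (VectorField.mlieBracket (𝓡 n) V W) x := by
    intro U V W hU hV hW
    rw [← key hU (hV.bracket hW)]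
    have h1 : nabla D U (nabla D V W) x
        = nabla D U (nabla D W V + VectorField.mlieBracket (𝓡 n) V W) x := by
      refine nabla_congr ((hW.nabla hD hV).add (hV.bracket hW)) ?_
      filter_upwards [hV.eventually, hW.eventually] with y h1 h2
      rw [Pi.add_apply, ← key h1 h2]; abel
    rw [h1, nabla_add (hW.nabla hD hV) (hV.bracket hW)]
    abel
  simp only [curvFn]
  rw [curvature_eq_curvatureField hD g (h.smooth a) (h.smooth b) (h.smooth c),
    curvature_eq_curvatureField hD g (h.smooth b) (h.smooth c) (h.smooth a),
    curvature_eq_curvatureField hD g (h.smooth c) (h.smooth a) (h.smooth b)]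
  have hsum : curvatureField D (E a) (E b) (E c) x + curvatureField D (E b) (E c) (E a) x
      + curvatureField D (E c) (E a) (E b) x = 0 := by
    have s1 := step (h.smooth a) (h.smooth b) (h.smooth c)
    have s2 := step (h.smooth b) (h.smooth c) (h.smooth a)
    have s3 := step (h.smooth c) (h.smooth a) (h.smooth b)
    have j := VectorField.leibniz_identity_mlieBracket_apply (two (h.smooth a)) (two (h.smooth b))
      (two (h.smooth c))
    rw [VectorField.mlieBracket_swap_apply (V := VectorField.mlieBracket (𝓡 n) (E a) (E b))] at j
    have j2 : VectorField.mlieBracket (𝓡 n) (E b) (VectorField.mlieBracket (𝓡 n) (E a) (E c)) x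
        = - VectorField.mlieBracket (𝓡 n) (E b) (VectorField.mlieBracket (𝓡 n) (E c) (E a)) x := by
      have hs : VectorField.mlieBracket (𝓡 n) (E a) (E c)
          = (fun _ => (-1 : ℝ) : M → ℝ) • VectorField.mlieBracket (𝓡 n) (E c) (E a) := by
        rw [VectorField.mlieBracket_swap]
        ext1 y; simp
      rw [hs, VectorField.mlieBracket_smul_right (FnSmoothNear.const (n := n) (-1)).mdiff
        ((h.smooth c).bracket (h.smooth a)).mdiff]
      simp [mvfderiv_const]
    rw [j2, ← s1, ← s2, ← s3, ← sub_eq_zero] at j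
    simp only [curvatureField]
    rw [← j]
    abel
  have := congrArg (fun v => g.inner x v (E d x)) hsum
  simpa using this

/-- A 1-form which is smooth near a point. -/
def FormSmoothNear (θ : (x : M) → TangentSpace (𝓡 n) x →L[ℝ] ℝ) (x : M) : Prop :=
  ∀ V : VField n M, SmoothNear V x → FnSmoothNear (n := n) (fun y => θ y (V y)) x

/-- The right side is skew and linear over functions in each field, so the particular extensions
built into the definition may be exchanged for any others with the same values at `x`. -/
lemma extDerivOneForm_eq (g : Metric n M) {θ : (x : M) → TangentSpace (𝓡 n) x →L[ℝ] ℝ}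
    (hθ : FormSmoothNear θ x) {U V : VField n M} (hU : SmoothNear U x) (hV : SmoothNear V x) :
    extDerivOneForm θ x (U x) (V x) = dir U (fun y => θ y (V y)) x - dir V (fun y => θ y (U y)) x
      - θ x (VectorField.mlieBracket (𝓡 n) U V x) := by
  set T : VField n M → VField n M → ℝ := fun U V =>
    dir U (fun y => θ y (V y)) x - dir V (fun y => θ y (U y)) x
      - θ x (VectorField.mlieBracket (𝓡 n) U V x) with hT
  have swap : ∀ U V, T U V = - T V U := by
    intro U V
    simp only [hT]
    rw [VectorField.mlieBracket_swap_apply]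
    simp only [map_neg]
    ring
  have tens : ∀ V : VField n M, SmoothNear V x → TensorialNear (fun U => T U V) x := by
    intro V hV
    refine ⟨fun {U W} hU hW => ?_, fun {U f} hU hf => ?_, fun {U W} hW hUW => ?_⟩
    · simp only [hT]
      rw [VectorField.mlieBracket_add_left hU.mdiff hW.mdiff]
      have := dir_add (V := V) (hθ U hU) (hθ W hW)
      simp only [Pi.add_apply, map_add]
      rw [this]
      simp only [dir, Pi.add_apply, map_add]
      ring
    · simp only [hT]
      rw [VectorField.mlieBracket_smul_left hf.mdiff hU.mdiff]
      have := dir_mul (V := V) hf (hθ U hU)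
      simp only [Pi.smul_apply', map_smul, map_add, smul_eq_mul]
      rw [this]
      simp only [dir, Pi.smul_apply', map_smul, smul_eq_mul]
      ring
    · simp only [hT]
      rw [Filter.EventuallyEq.mlieBracket_vectorField_eq (V := W) (W₁ := V) (W := V) hUW
        Filter.EventuallyEq.rfl]
      have := dir_congr (V := V) (f := fun y => θ y (U y)) (h := fun y => θ y (W y))
        (hUW.mono fun y hy => by rw [hy])
      rw [this]
      simp only [dir, hUW.self_of_nhds]
  have e : ∀ v : TangentSpace (𝓡 n) x,
      SmoothNear (FiberBundle.extend (Model n) v : VField n M) x := smoothNear_extend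
  have h1 : extDerivOneForm θ x (U x) (V x)
      = T (FiberBundle.extend (Model n) (U x)) (FiberBundle.extend (Model n) (V x)) := by
    simp [extDerivOneForm, hT, dir]
  rw [h1, (tens _ (e _)).eq g (e _) hU (by simp), swap, (tens _ hU).eq g (e _) hV (by simp), ← swap]

end FrameCalculus

/-! ### Weyl connections in a frame: Koszul formula and curvature symmetries. -/

section WeylFrames

variable {n : ℕ} {M : Type*} [TopologicalSpace M] [ChartedSpace (Model n) M]
  [IsManifold (𝓡 n) ∞ M] {C : ConformalStructure n M} (D : WeylDerivative C) {g : C.Gauge}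
  {E : Fin n → VField n M} {x : M}

lemma WeylDerivative.connFn_torsion (h : IsFrameNear g.1 E x) (a b c : Fin n) :
    connFn D.conn g.1 E a b c x - connFn D.conn g.1 E b a c x = structFn g.1 E a b c x := by
  have := (CovariantDerivative.torsion_eq_zero_iff D.conn).1 D.torsion_eq_zero
    (h.smooth a).mdiff (h.smooth b).mdiff
  simp only [structFn, ← this, connFn, nabla, map_sub, sub_apply]

lemma WeylDerivative.connFn_metric (h : IsFrameNear g.1 E x) (a b c : Fin n) :
    connFn D.conn g.1 E a b c x + connFn D.conn g.1 E a c b x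
      = 2 * D.form g x (E a x) * if b = c then 1 else 0 := by
  have h1 := D.conn_metric g x (E b) (E c) (h.smooth b).mdiff (h.smooth c).mdiff (E a x)
  have h2 : dir (E a) (fun y => g.1.inner y (E b y) (E c y)) x = 0 := by
    rw [dir_congr (h := fun _ => if b = c then (1 : ℝ) else 0)
      (h.orthonormal.mono fun y hy => hy b c)]
    simp
  change dir (E a) (fun y => g.1.inner y (E b y) (E c y)) x = _ at h1
  rw [h2, h.at b c, g.1.symm x (E b x)] at h1
  simp only [connFn, nabla]
  linarith

/-- The Koszul formula in an orthonormal frame. -/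
lemma WeylDerivative.connFn_eq (h : IsFrameNear g.1 E x) (a b c : Fin n) :
    connFn D.conn g.1 E a b c x = (structFn g.1 E a b c x - structFn g.1 E b c a x
      + structFn g.1 E c a b x) / 2 + D.form g x (E a x) * (if b = c then 1 else 0)
      + D.form g x (E b x) * (if a = c then 1 else 0)
      - D.form g x (E c x) * (if a = b then 1 else 0) := by
  have t1 := D.connFn_torsion h a b c
  have t2 := D.connFn_torsion h b c a
  have t3 := D.connFn_torsion h c a b
  have m1 := D.connFn_metric h a b c
  have m2 := D.connFn_metric h b c a
  have m3 := D.connFn_metric h c a b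
  have e1 : (if c = a then (1 : ℝ) else 0) = if a = c then 1 else 0 := by simp only [eq_comm]
  rw [e1] at m2
  linarith

lemma WeylDerivative.form_eq_connFn (h : IsFrameNear g.1 E x) (a b : Fin n) :
    D.form g x (E a x) = connFn D.conn g.1 E a b b x := by
  have := D.connFn_metric h a b b
  simp at this
  linarith

/-- Smoothness of the 1-form is not part of the data; it is recovered from that of the connection,
since the form on `E a` is the coefficient g(D_{E_a} E_0, E_0). A nonzero dimension supplies the
index 0. -/
lemma WeylDerivative.formSmoothNear [T2Space M] [NeZero n] (x : M) :
    FormSmoothNear (D.form g) x := by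
  intro V hV
  obtain ⟨e, he⟩ := exists_isOrthonormalFrame g.1 x
  obtain ⟨E, -, hE, ho⟩ := he.exists_extension
  have h : IsFrameNear g.1 E x := ⟨hE, ho⟩
  have hφ : ∀ a, FnSmoothNear (n := n) (fun y => D.form g y (E a y)) x := fun a =>
    (h.smooth_connFn D.smooth a 0 0).congr
      (h.eventually.mono fun y hy => D.form_eq_connFn hy a 0)
  refine (FnSmoothNear.sum (s := Finset.univ) fun a _ =>
    (FnSmoothNear.metric g.1 hV (hE a)).mul (hφ a)).congr ?_
  filter_upwards [ho] with y hy
  conv_lhs => rw [← hy.sum_eq (V y)]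
  simp

/-- The Weyl connection preserves the conformal structure, up to the Faraday curvature. -/
lemma WeylDerivative.curvFn_skew [T2Space M] [NeZero n] (h : IsFrameNear g.1 E x)
    (a b c d : Fin n) :
    curvFn D.conn g.1 E a b c d x + curvFn D.conn g.1 E a b d c x
      = 2 * (dir (E a) (fun y => D.form g y (E b y)) x - dir (E b) (fun y => D.form g y (E a y)) x
          - ∑ f, structFn g.1 E a b f x * D.form g x (E f x)) * if c = d then 1 else 0 := by
  have hφ := fun a => D.formSmoothNear (g := g) x (E a) (h.smooth a)
  have hd : ∀ a b, dir (E a) (connFn D.conn g.1 E b c d) x + dir (E a) (connFn D.conn g.1 E b d c) x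
      = 2 * (if c = d then 1 else 0) * dir (E a) (fun y => D.form g y (E b y)) x := by
    intro a b
    rw [← dir_add (h.smooth_connFn D.smooth b c d) (h.smooth_connFn D.smooth b d c),
      ← dir_const_mul _ (hφ b)]
    refine dir_congr (h.eventually.mono fun y hy => ?_)
    rw [D.connFn_metric hy]; ring
  have h1 := hd a b
  have h2 := hd b a
  have m := fun a b c => D.connFn_metric h a b c
  have hs : ∑ f, (connFn D.conn g.1 E b c f x * connFn D.conn g.1 E a f d x
        - connFn D.conn g.1 E a c f x * connFn D.conn g.1 E b f d x
        - structFn g.1 E a b f x * connFn D.conn g.1 E f c d x)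
      + ∑ f, (connFn D.conn g.1 E b d f x * connFn D.conn g.1 E a f c x
        - connFn D.conn g.1 E a d f x * connFn D.conn g.1 E b f c x
        - structFn g.1 E a b f x * connFn D.conn g.1 E f d c x)
      = - (2 * (if c = d then 1 else 0) * ∑ f, structFn g.1 E a b f x * D.form g x (E f x)) := by
    -- Metric compatibility reverses the last two indices of each right-hand factor up to a
    -- Kronecker term. The products then cancel in pairs and only the Kronecker terms survive.
    have e1 : ∀ f, connFn D.conn g.1 E b c f x * connFn D.conn g.1 E a f d x
        - connFn D.conn g.1 E a c f x * connFn D.conn g.1 E b f d x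
        - structFn g.1 E a b f x * connFn D.conn g.1 E f c d x
        + (connFn D.conn g.1 E b d f x * connFn D.conn g.1 E a f c x
        - connFn D.conn g.1 E a d f x * connFn D.conn g.1 E b f c x
        - structFn g.1 E a b f x * connFn D.conn g.1 E f d c x)
        = (2 * D.form g x (E a x) * connFn D.conn g.1 E b c f x
          - 2 * D.form g x (E b x) * connFn D.conn g.1 E a c f x) * (if f = d then 1 else 0)
          + (2 * D.form g x (E a x) * connFn D.conn g.1 E b d f x
          - 2 * D.form g x (E b x) * connFn D.conn g.1 E a d f x) * (if f = c then 1 else 0)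
          - 2 * (if c = d then 1 else 0) * (structFn g.1 E a b f x * D.form g x (E f x)) := by
      intro f
      have a1 := m a f d
      have a2 := m a f c
      have a3 := m b f d
      have a4 := m b f c
      have a5 := m f c d
      linear_combination connFn D.conn g.1 E b c f x * a1 + connFn D.conn g.1 E b d f x * a2
        - connFn D.conn g.1 E a c f x * a3 - connFn D.conn g.1 E a d f x * a4
        - structFn g.1 E a b f x * a5
    rw [← Finset.sum_add_distrib, Finset.sum_congr rfl fun f _ => e1 f, Finset.sum_sub_distrib,
      Finset.sum_add_distrib, ← Finset.mul_sum]
    simp only [mul_ite, mul_one, mul_zero, Finset.sum_ite_eq', Finset.mem_univ, if_true]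
    have b1 := m b c d
    have b2 := m a c d
    simp only [mul_ite, mul_one, mul_zero] at b1 b2
    split_ifs at b1 b2 ⊢ <;>
      linear_combination 2 * D.form g x (E a x) * b1 - 2 * D.form g x (E b x) * b2
  rw [h.curvFn_eq D.smooth, h.curvFn_eq D.smooth]
  linear_combination h1 - h2 + hs

end WeylFrames

/-! ### Pointwise algebra of curvature tensors in dimension 4. -/

section CurvatureAlgebra

/-- Ricci contraction of a curvature tensor, in components. -/
def ricComp {n : ℕ} (R : Fin n → Fin n → Fin n → Fin n → ℝ) (b c : Fin n) : ℝ :=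
  ∑ a, R a b c a

/-- The Kronecker symbol. -/
def kron {n : ℕ} (a b : Fin n) : ℝ := if a = b then 1 else 0

/-- Normalized Ricci tensor of a curvature tensor in dimension 4, in components. -/
def nricComp (R : Fin 4 → Fin 4 → Fin 4 → Fin 4 → ℝ) (b c : Fin 4) : ℝ :=
  ((ricComp R b c + ricComp R c b) / 2 - (∑ i, ricComp R i i) / 6 * kron b c) / 2
    + (ricComp R b c - ricComp R c b) / 8

/-- Subtraction of the part of a curvature tensor determined by a bilinear form. -/
def bracketComp (R : Fin 4 → Fin 4 → Fin 4 → Fin 4 → ℝ) (r : Fin 4 → Fin 4 → ℝ)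
    (a b c d : Fin 4) : ℝ :=
  R a b c d + (r a b * kron c d + r a c * kron b d - kron b c * r a d)
    - (r b a * kron c d + r b c * kron a d - kron a c * r b d)

/-- The antiselfdual components of a 2-form in dimension 4. -/
def asdComp (α : Fin 4 → Fin 4 → ℝ) : Fin 3 → ℝ :=
  ![α 0 1 + α 2 3, α 0 2 + α 3 1, α 0 3 + α 1 2]

/-- The antiselfdual part of a curvature tensor in dimension 4. -/
def asdCurv (R : Fin 4 → Fin 4 → Fin 4 → Fin 4 → ℝ) (i j : Fin 3) : ℝ :=
  asdComp (fun a b => asdComp (fun c d => R a b c d) j) i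

/-- A matrix whose symmetric tracefree part vanishes. -/
def SymTracefreeVanishes (N : Fin 3 → Fin 3 → ℝ) : Prop :=
  N 0 1 + N 1 0 = 0 ∧ N 1 2 + N 2 1 = 0 ∧ N 2 0 + N 0 2 = 0 ∧ N 0 0 = N 1 1 ∧ N 1 1 = N 2 2

/-- A bilinear form `r` contains no component of type S₀²Λ₋: its correction changes the
antiselfdual-antiselfdual block only by a skew matrix and a multiple of the identity. Hence `r` may
be arbitrary here. -/
lemma symTracefreeVanishes_of_bracketComp {R : Fin 4 → Fin 4 → Fin 4 → Fin 4 → ℝ}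
    {r : Fin 4 → Fin 4 → ℝ}
    (h : ∀ c d i, asdComp (fun a b => bracketComp R r a b c d) i = 0) :
    SymTracefreeVanishes (asdCurv R) := by
  have h' : ∀ i j, asdComp (fun a b => asdComp (fun c d => bracketComp R r a b c d) j) i = 0 := by
    intro i j
    have e0 := fun c d => h c d 0
    have e1 := fun c d => h c d 1
    have e2 := fun c d => h c d 2
    simp only [asdComp, Matrix.cons_val] at e0 e1 e2
    fin_cases i <;> fin_cases j <;> simp only [asdComp, Fin.zero_eta, Fin.mk_one, Fin.reduceFinMk,
      Matrix.cons_val]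
    · linarith [e0 0 1, e0 2 3]
    · linarith [e0 0 2, e0 3 1]
    · linarith [e0 0 3, e0 1 2]
    · linarith [e1 0 1, e1 2 3]
    · linarith [e1 0 2, e1 3 1]
    · linarith [e1 0 3, e1 1 2]
    · linarith [e2 0 1, e2 2 3]
    · linarith [e2 0 2, e2 3 1]
    · linarith [e2 0 3, e2 1 2]
  simp only [asdComp, bracketComp, kron] at h'
  simp only [SymTracefreeVanishes, asdCurv, asdComp]
  refine ⟨?_, ?_, ?_, ?_, ?_⟩
  · have h1 := h' 0 1; have h2 := h' 1 0
    simp at h1 h2 ⊢; linarith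
  · have h1 := h' 1 2; have h2 := h' 2 1
    simp at h1 h2 ⊢; linarith
  · have h1 := h' 2 0; have h2 := h' 0 2
    simp at h1 h2 ⊢; linarith
  · have h1 := h' 0 0; have h2 := h' 1 1
    simp at h1 h2 ⊢; linarith
  · have h1 := h' 1 1; have h2 := h' 2 2
    simp at h1 h2 ⊢; linarith

/-- Contracting the Bianchi identity shows that the skew part of the Ricci tensor is a multiple of
`F`. The coefficient 1/8 in `nricComp` makes r(a,b) - r(b,a) = -F(a,b), which cancels the trace part
F(a,b) δ_cd of `R`. -/
lemma bracketComp_skew {R : Fin 4 → Fin 4 → Fin 4 → Fin 4 → ℝ} {F : Fin 4 → Fin 4 → ℝ}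
    (h1 : ∀ a b c d, R a b c d = - R b a c d)
    (h2 : ∀ a b c d, R a b c d + R a b d c = 2 * F a b * kron c d)
    (h3 : ∀ a b c d, R a b c d + R b c a d + R c a b d = 0) (a b c d : Fin 4) :
    bracketComp R (nricComp R) a b d c = - bracketComp R (nricComp R) a b c d := by
  have hr : nricComp R a b - nricComp R b a = - F a b := by
    have h4 : ricComp R a b - ricComp R b a = - (4 * F a b) := by
      have : ∀ e, R e a b e - R e b a e = - F a b := fun e => by
        have h5 := h3 e a b e
        have h6 := h2 a b e e
        have h7 := h1 b e a e
        simp [kron] at h6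
        linarith
      simp only [ricComp, ← Finset.sum_sub_distrib, this]
      simp
    have hk : kron a b = kron b a := by simp [kron, eq_comm]
    simp only [nricComp, hk]
    linarith
  have hk : kron d c = kron c d := by simp [kron, eq_comm]
  have := h2 a b c d
  simp only [bracketComp, hk]
  linear_combination this + 2 * kron c d * hr

-- Split the antiselfdual part in the first pair according to the second pair. The Λ₋⊗Λ₊ block is
-- determined by the tracefree symmetric Ricci tensor, so subtracting the `r` terms removes it. In
-- the Λ₋⊗Λ₋ block the same subtraction removes the skew part and the trace, and `hN` disposes of
-- the rest.
set_option maxHeartbeats 4000000 in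
lemma asdComp_bracketComp_eq_zero {R : Fin 4 → Fin 4 → Fin 4 → Fin 4 → ℝ} {F : Fin 4 → Fin 4 → ℝ}
    (h1 : ∀ a b c d, R a b c d = - R b a c d)
    (h2 : ∀ a b c d, R a b c d + R a b d c = 2 * F a b * kron c d)
    (h3 : ∀ a b c d, R a b c d + R b c a d + R c a b d = 0)
    (hN : SymTracefreeVanishes (asdCurv R)) (c d : Fin 4) (i : Fin 3) :
    asdComp (fun a b => bracketComp R (nricComp R) a b c d) i = 0 := by
  have sk := bracketComp_skew h1 h2 h3
  have z : ∀ a c d, R a a c d = 0 := fun a c d => by linarith [h1 a a c d]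
  have q : ∀ a b c, R a b c c = F a b := fun a b c => by
    have := h2 a b c c; simp [kron] at this; linarith
  have q' : ∀ a b c d, c ≠ d → R a b d c = - R a b c d := fun a b c d h => by
    have := h2 a b c d; simp [kron, h] at this; linarith
  have t10 := h1 1 0
  have t20 := h1 2 0
  have t30 := h1 3 0
  have t21 := h1 2 1
  have t31 := h1 3 1
  have t32 := h1 3 2
  have s10 := fun a b => q' a b 0 1 (by decide)
  have s20 := fun a b => q' a b 0 2 (by decide)
  have s30 := fun a b => q' a b 0 3 (by decide)
  have s21 := fun a b => q' a b 1 2 (by decide)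
  have s31 := fun a b => q' a b 1 3 (by decide)
  have s32 := fun a b => q' a b 2 3 (by decide)
  obtain ⟨n1, n2, n3, n4, n5⟩ := hN
  simp only [asdCurv, asdComp, Matrix.cons_val, z, t10, t20, t30, t21, t31, t32, s10, s20, s30,
    s21, s31, s32, q, neg_neg] at n1 n2 n3 n4 n5
  have b1 := h3 0 1 2
  have b2 := h3 0 1 3
  have b3 := h3 0 2 3
  have b4 := h3 1 2 3
  have b10 := b1 0; have b11 := b1 1; have b12 := b1 2; have b13 := b1 3
  have b20 := b2 0; have b21 := b2 1; have b22 := b2 2; have b23 := b2 3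
  have b30 := b3 0; have b31 := b3 1; have b32 := b3 2; have b33 := b3 3
  have b40 := b4 0; have b41 := b4 1; have b42 := b4 2; have b43 := b4 3
  clear b1 b2 b3 b4 h1 h2 h3 q'
  simp only [z, t10, t20, t30, t21, t31, t32, s10, s20, s30,
    s21, s31, s32, q, neg_neg] at b10 b11 b12 b13 b20 b21 b22 b23 b30 b31 b32 b33 b40 b41 b42 b43
  have hr : ∀ b c, nricComp R b c = ((ricComp R b c + ricComp R c b) / 2
    - (∑ i, ricComp R i i) / 6 * kron b c) / 2 + (ricComp R b c - ricComp R c b) / 8 :=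
      fun b c => rfl
  have k : ∀ a b : Fin 4, kron a b = if a = b then 1 else 0 := fun a b => rfl
  -- From here on the problem is linear: the components of `r` become unknowns tied to `R` by the
  -- sixteen equations below, and the Bianchi identities and `hN` supply the remaining relations.
  generalize nricComp R = r at hr sk ⊢
  have r00 := hr 0 0; have r01 := hr 0 1; have r02 := hr 0 2; have r03 := hr 0 3
  have r10 := hr 1 0; have r11 := hr 1 1; have r12 := hr 1 2; have r13 := hr 1 3
  have r20 := hr 2 0; have r21 := hr 2 1; have r22 := hr 2 2; have r23 := hr 2 3
  have r30 := hr 3 0; have r31 := hr 3 1; have r32 := hr 3 2; have r33 := hr 3 3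
  clear hr
  simp [ricComp, Fin.sum_univ_four, kron, z, t10, t20, t30, t21, t31, t32, s10, s20, s30, s21, s31,
    s32, q] at r00 r01 r02 r03 r10 r11 r12 r13 r20 r21 r22 r23 r30 r31 r32 r33
  -- By the skewness `sk`, it is enough to treat c < d.
  have main : ∀ c d : Fin 4, c < d → asdComp (fun a b => bracketComp R r a b c d) i = 0 := by
    clear sk
    intro c d hcd
    fin_cases i <;> fin_cases c <;> fin_cases d <;>
    first
    | exact absurd hcd (by decide)
    | (simp [asdComp, bracketComp, kron, z, t10, t20, t30, t21, t31, t32, s10, s20, s30, s21, s31,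
        s32, q]
       linarith)
  have neg : asdComp (fun a b => bracketComp R r a b d c) i
      = - asdComp (fun a b => bracketComp R r a b c d) i := by
    have sk' := fun a b => sk a b c d
    simp only [asdComp, sk']
    fin_cases i <;> simp <;> ring
  rcases lt_trichotomy c d with hcd | rfl | hcd
  · exact main c d hcd
  · linarith
  · linarith [main d c hcd]

end CurvatureAlgebra

/-! ### Multilinearity of the curvature at a point. -/

section Multilinear

variable {n : ℕ} {M : Type*} [TopologicalSpace M] [ChartedSpace (Model n) M]
  [IsManifold (𝓡 n) ∞ M]

lemma IsOrthonormalFrame.eq_of_isLinearMap {g : Metric n M} {x : M}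
    {e : Fin n → TangentSpace (𝓡 n) x} (he : IsOrthonormalFrame g x e)
    {F G : TangentSpace (𝓡 n) x → ℝ} (hF : IsLinearMap ℝ F) (hG : IsLinearMap ℝ G)
    (h : ∀ i, F (e i) = G (e i)) (v : TangentSpace (𝓡 n) x) : F v = G v := by
  have : hF.mk' F = hG.mk' G := he.basis.ext fun i => by simp [h]
  exact congrArg (fun L => L v) this

lemma IsOrthonormalFrame.trace_eq' {g : Metric n M} {x : M}
    {e e' : Fin n → TangentSpace (𝓡 n) x} (he : IsOrthonormalFrame g x e)
    (he' : IsOrthonormalFrame g x e')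
    {T : TangentSpace (𝓡 n) x → TangentSpace (𝓡 n) x → ℝ}
    (h1 : ∀ w, IsLinearMap ℝ (fun v => T v w)) (h2 : ∀ v, IsLinearMap ℝ (T v)) :
    ∑ i, T (e' i) (e' i) = ∑ i, T (e i) (e i) :=
  he.trace_eq he' (LinearMap.mk₂ ℝ T (fun _ _ w => (h1 w).map_add _ _)
    (fun _ _ w => (h1 w).map_smul _ _) (fun v _ _ => (h2 v).map_add _ _)
    (fun _ v _ => (h2 v).map_smul _ _))

variable [T2Space M] {D : Conn n M} (hD : CovariantDerivative.ContMDiffCovariantDerivative D ∞)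
  (g : Metric n M) {x : M}
include hD g

lemma isLinearMap_curvature₁ (v w : TangentSpace (𝓡 n) x) :
    IsLinearMap ℝ (fun u => curvature D x u v w) := by
  obtain ⟨e, he⟩ := exists_isOrthonormalFrame g x
  obtain ⟨E, -, hE, ho⟩ := he.exists_extension
  refine ⟨fun u u' => ?_, fun c u => ?_⟩ <;>
  simp only [curvature_eq_sum hD hE ho _ v w, map_add, add_apply, map_smul, smul_apply,
    smul_eq_mul, add_mul, add_smul, Finset.sum_add_distrib, Finset.smul_sum, smul_smul, mul_assoc]

lemma isLinearMap_curvature₂ (u w : TangentSpace (𝓡 n) x) :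
    IsLinearMap ℝ (fun v => curvature D x u v w) := by
  obtain ⟨e, he⟩ := exists_isOrthonormalFrame g x
  obtain ⟨E, -, hE, ho⟩ := he.exists_extension
  refine ⟨fun v v' => ?_, fun c v => ?_⟩
  · simp only [curvature_eq_sum hD hE ho u _ w, map_add, add_apply, add_mul, mul_add, add_smul,
      Finset.sum_add_distrib]
  · simp only [curvature_eq_sum hD hE ho u _ w, map_smul, smul_apply, smul_eq_mul, Finset.smul_sum, smul_smul,
      mul_assoc, mul_left_comm c]

lemma isLinearMap_curvature₃ (u v : TangentSpace (𝓡 n) x) :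
    IsLinearMap ℝ (fun w => curvature D x u v w) := by
  obtain ⟨e, he⟩ := exists_isOrthonormalFrame g x
  obtain ⟨E, -, hE, ho⟩ := he.exists_extension
  refine ⟨fun w w' => ?_, fun c w => ?_⟩
  · simp only [curvature_eq_sum hD hE ho u v _, map_add, add_apply, mul_add, add_smul,
      Finset.sum_add_distrib]
  · simp only [curvature_eq_sum hD hE ho u v _, map_smul, smul_apply, smul_eq_mul, Finset.smul_sum, smul_smul,
      mul_assoc, mul_left_comm c]

end Multilinear

/-! ### Ricci and Weyl tensors under a change of gauge and frame. -/

section WeylTensor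

variable {n : ℕ} {M : Type*} [TopologicalSpace M] [ChartedSpace (Model n) M]
  [IsManifold (𝓡 n) ∞ M] [T2Space M] {C : ConformalStructure n M} (D : WeylDerivative C)
  (g : C.Gauge) {x : M} (e : Fin n → TangentSpace (𝓡 n) x)

namespace WeylDerivative

lemma isLinearMap_ricci₁ (w : TangentSpace (𝓡 n) x) :
    IsLinearMap ℝ (fun v => D.ricci g x e v w) := by
  refine ⟨fun u u' => ?_, fun c u => ?_⟩ <;>
  simp only [ricci, (isLinearMap_curvature₂ D.smooth g.1 _ w).map_add,
    (isLinearMap_curvature₂ D.smooth g.1 _ w).map_smul, map_add, add_apply, map_smul, smul_apply,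
    Finset.sum_add_distrib, Finset.smul_sum]

lemma isLinearMap_ricci₂ (v : TangentSpace (𝓡 n) x) :
    IsLinearMap ℝ (fun w => D.ricci g x e v w) := by
  refine ⟨fun u u' => ?_, fun c u => ?_⟩ <;>
  simp only [ricci, (isLinearMap_curvature₃ D.smooth g.1 _ v).map_add,
    (isLinearMap_curvature₃ D.smooth g.1 _ v).map_smul, map_add, add_apply, map_smul, smul_apply,
    Finset.sum_add_distrib, Finset.smul_sum]

lemma isLinearMap_normalizedRicci₁ (w : TangentSpace (𝓡 n) x) :
    IsLinearMap ℝ (fun v => D.normalizedRicci g x e v w) := by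
  have h1 := D.isLinearMap_ricci₁ g e w
  have h2 := D.isLinearMap_ricci₂ g e w
  refine ⟨fun u u' => ?_, fun c u => ?_⟩ <;>
  simp only [normalizedRicci, h1.map_add, h1.map_smul, h2.map_add, h2.map_smul, map_add, add_apply,
    map_smul, smul_apply, smul_eq_mul] <;> ring

lemma isLinearMap_normalizedRicci₂ (w : TangentSpace (𝓡 n) x) :
    IsLinearMap ℝ (fun v => D.normalizedRicci g x e w v) := by
  have h1 := D.isLinearMap_ricci₁ g e w
  have h2 := D.isLinearMap_ricci₂ g e w
  refine ⟨fun u u' => ?_, fun c u => ?_⟩ <;>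
  simp only [normalizedRicci, h1.map_add, h1.map_smul, h2.map_add, h2.map_smul, map_add, add_apply,
    map_smul, smul_apply, smul_eq_mul] <;> ring

lemma isLinearMap_weyl₁ (v w z : TangentSpace (𝓡 n) x) :
    IsLinearMap ℝ (fun u => D.weyl g x e u v w z) := by
  have h1 := fun a => D.isLinearMap_normalizedRicci₁ g e a
  have h2 := fun a => D.isLinearMap_normalizedRicci₂ g e a
  have h3 := isLinearMap_curvature₁ D.smooth g.1 v w
  refine ⟨fun u u' => ?_, fun c u => ?_⟩ <;>
  simp only [weyl, ricciBracket, (h1 _).map_add, (h1 _).map_smul, (h2 _).map_add, (h2 _).map_smul,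
    h3.map_add, h3.map_smul, map_add, add_apply, map_smul, smul_apply, smul_eq_mul] <;> ring

lemma isLinearMap_weyl₂ (u w z : TangentSpace (𝓡 n) x) :
    IsLinearMap ℝ (fun v => D.weyl g x e u v w z) := by
  have h1 := fun a => D.isLinearMap_normalizedRicci₁ g e a
  have h2 := fun a => D.isLinearMap_normalizedRicci₂ g e a
  have h3 := isLinearMap_curvature₂ D.smooth g.1 u w
  refine ⟨fun u u' => ?_, fun c u => ?_⟩ <;>
  simp only [weyl, ricciBracket, (h1 _).map_add, (h1 _).map_smul, (h2 _).map_add, (h2 _).map_smul,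
    h3.map_add, h3.map_smul, map_add, add_apply, map_smul, smul_apply, smul_eq_mul] <;> ring

lemma isLinearMap_weyl₃ (u v z : TangentSpace (𝓡 n) x) :
    IsLinearMap ℝ (fun w => D.weyl g x e u v w z) := by
  have h2 := fun a => D.isLinearMap_normalizedRicci₂ g e a
  have h3 := isLinearMap_curvature₃ D.smooth g.1 u v
  refine ⟨fun u u' => ?_, fun c u => ?_⟩ <;>
  simp only [weyl, ricciBracket, (h2 _).map_add, (h2 _).map_smul,
    h3.map_add, h3.map_smul, map_add, add_apply, map_smul, smul_apply, smul_eq_mul] <;> ring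

lemma isLinearMap_weyl₄ (u v w : TangentSpace (𝓡 n) x) :
    IsLinearMap ℝ (fun z => D.weyl g x e u v w z) := by
  have h2 := fun a => D.isLinearMap_normalizedRicci₂ g e a
  refine ⟨fun u u' => ?_, fun c u => ?_⟩ <;>
  simp only [weyl, ricciBracket, (h2 _).map_add, (h2 _).map_smul,
    map_add, add_apply, map_smul, smul_apply, smul_eq_mul] <;> ring

variable {D g e} {g' : C.Gauge} {e' : Fin n → TangentSpace (𝓡 n) x} {t : ℝ}

/-- The rescaled frame `t • e'` is `g`-orthonormal and the trace does not depend on the orthonormal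
frame; the two factors of `t` are absorbed by `g'`. Only the connection matters for the Ricci
tensor. -/
lemma ricci_eq_of_conformal (he : IsOrthonormalFrame g.1 x e) (he' : IsOrthonormalFrame g'.1 x e')
    (hg : ∀ v w, g'.1.inner x v w = t ^ 2 * g.1.inner x v w) (v w : TangentSpace (𝓡 n) x) :
    D.ricci g' x e' v w = D.ricci g x e v w := by
  have h : IsOrthonormalFrame g.1 x (fun i => t • e' i) := fun i j => by
    rw [← he' i j, hg]
    simp only [map_smul, smul_apply, smul_eq_mul]; ring
  have c := isLinearMap_curvature₁ D.smooth g.1 v w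
  rw [ricci, ricci, ← he.trace_eq' h (T := fun a b => g.1.inner x (curvature D.conn x a v w) b)]
  · refine Finset.sum_congr rfl fun i _ => ?_
    simp only [hg, c.map_smul, map_smul, smul_apply, smul_eq_mul]; ring
  · intro b
    constructor <;> intros <;> simp [c.map_add, c.map_smul]
  · intro b
    constructor <;> intros <;> simp

lemma scalar_eq_of_conformal (he : IsOrthonormalFrame g.1 x e)
    (he' : IsOrthonormalFrame g'.1 x e')
    (hg : ∀ v w, g'.1.inner x v w = t ^ 2 * g.1.inner x v w) :
    t ^ 2 * D.scalar g' x e' = D.scalar g x e := by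
  have h : IsOrthonormalFrame g.1 x (fun i => t • e' i) := fun i j => by
    rw [← he' i j, hg]
    simp only [map_smul, smul_apply, smul_eq_mul]; ring
  rw [scalar, scalar, ← he.trace_eq' h (D.isLinearMap_ricci₁ g e) (D.isLinearMap_ricci₂ g e),
    Finset.mul_sum]
  refine Finset.sum_congr rfl fun i _ => ?_
  rw [ricci_eq_of_conformal he he' hg, (D.isLinearMap_ricci₁ g e _).map_smul,
    (D.isLinearMap_ricci₂ g e _).map_smul]
  simp only [smul_eq_mul]; ring

lemma weyl_eq_of_conformal (he : IsOrthonormalFrame g.1 x e)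
    (he' : IsOrthonormalFrame g'.1 x e')
    (hg : ∀ v w, g'.1.inner x v w = t ^ 2 * g.1.inner x v w) (u v w z : TangentSpace (𝓡 n) x) :
    D.weyl g' x e' u v w z = t ^ 2 * D.weyl g x e u v w z := by
  have hr : ∀ v w, D.normalizedRicci g' x e' v w = D.normalizedRicci g x e v w := by
    intro v w
    simp only [normalizedRicci, ricci_eq_of_conformal he he' hg, hg,
      ← scalar_eq_of_conformal (D := D) he he' hg]
    ring
  simp only [weyl, ricciBracket, hr, hg]
  ring

end WeylDerivative

end WeylTensor

/-! ### Frame independence and conformal invariance of the star on 2-forms. -/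

section Hodge

variable {M : Type*} [TopologicalSpace M] [ChartedSpace (Model 4) M] [IsManifold (𝓡 4) ∞ M]
  {o : OrientationForm 4 M} {x : M}

lemma isLinearMap_alternating₁ {V : Type*} [AddCommGroup V] [Module ℝ V] (f : V [⋀^Fin 4]→ₗ[ℝ] ℝ)
    (b c d : V) : IsLinearMap ℝ (fun a => f ![a, b, c, d]) :=
  ⟨fun a a' => (f.toMultilinearMap.cons_add ![b, c, d] a a'),
    fun t a => (f.toMultilinearMap.cons_smul ![b, c, d] t a)⟩

lemma alternating_swap₁ {V : Type*} [AddCommGroup V] [Module ℝ V] (f : V [⋀^Fin 4]→ₗ[ℝ] ℝ)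
    (a b c d : V) : f ![b, a, c, d] = - f ![a, b, c, d] := by
  rw [← f.map_swap ![a, b, c, d] (show (0 : Fin 4) ≠ 1 by decide)]
  congr 1; ext i; fin_cases i <;> rfl

lemma alternating_swap₂ {V : Type*} [AddCommGroup V] [Module ℝ V] (f : V [⋀^Fin 4]→ₗ[ℝ] ℝ)
    (a b c d : V) : f ![a, c, b, d] = - f ![a, b, c, d] := by
  rw [← f.map_swap ![a, b, c, d] (show (1 : Fin 4) ≠ 2 by decide)]
  congr 1; ext i; fin_cases i <;> rfl

lemma alternating_swap₃ {V : Type*} [AddCommGroup V] [Module ℝ V] (f : V [⋀^Fin 4]→ₗ[ℝ] ℝ)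
    (a b c d : V) : f ![a, b, d, c] = - f ![a, b, c, d] := by
  rw [← f.map_swap ![a, b, c, d] (show (2 : Fin 4) ≠ 3 by decide)]
  congr 1; ext i; fin_cases i <;> rfl

lemma isLinearMap_alternating₂ {V : Type*} [AddCommGroup V] [Module ℝ V] (f : V [⋀^Fin 4]→ₗ[ℝ] ℝ)
    (a c d : V) : IsLinearMap ℝ (fun b => f ![a, b, c, d]) := by
  have h := isLinearMap_alternating₁ f a c d
  constructor <;> intros <;>
  simp only [alternating_swap₁ f _ a c d, h.map_add, h.map_smul, smul_neg, neg_add]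

lemma isLinearMap_alternating₃ {V : Type*} [AddCommGroup V] [Module ℝ V] (f : V [⋀^Fin 4]→ₗ[ℝ] ℝ)
    (a b d : V) : IsLinearMap ℝ (fun c => f ![a, b, c, d]) := by
  have h := isLinearMap_alternating₂ f a b d
  constructor <;> intros <;>
  simp only [alternating_swap₂ f a _ b d, h.map_add, h.map_smul, smul_neg, neg_add]

lemma isLinearMap_alternating₄ {V : Type*} [AddCommGroup V] [Module ℝ V] (f : V [⋀^Fin 4]→ₗ[ℝ] ℝ)
    (a b c : V) : IsLinearMap ℝ (fun d => f ![a, b, c, d]) := by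
  have h := isLinearMap_alternating₃ f a b c
  constructor <;> intros <;>
  simp only [alternating_swap₃ f a b _ c, h.map_add, h.map_smul, smul_neg, neg_add]

lemma isLinearMap_hodgeStar₁ (e : Fin 4 → TangentSpace (𝓡 4) x)
    (α : TangentSpace (𝓡 4) x → TangentSpace (𝓡 4) x → ℝ) (w : TangentSpace (𝓡 4) x) :
    IsLinearMap ℝ (fun v => hodgeStar o x e α v w) := by
  have h := fun a b c => isLinearMap_alternating₁ (o.form x) a b c
  constructor <;> intros <;>
  simp only [hodgeStar, (h _ _ _).map_add, (h _ _ _).map_smul, add_div, add_mul,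
    Finset.sum_add_distrib, smul_eq_mul, mul_div_assoc, mul_assoc, ← Finset.mul_sum] <;> ring

lemma isLinearMap_hodgeStar₂ (e : Fin 4 → TangentSpace (𝓡 4) x)
    (α : TangentSpace (𝓡 4) x → TangentSpace (𝓡 4) x → ℝ) (v : TangentSpace (𝓡 4) x) :
    IsLinearMap ℝ (fun w => hodgeStar o x e α v w) := by
  have h := fun a b c => isLinearMap_alternating₂ (o.form x) a b c
  constructor <;> intros <;>
  simp only [hodgeStar, (h _ _ _).map_add, (h _ _ _).map_smul, add_div, add_mul,
    Finset.sum_add_distrib, smul_eq_mul, mul_div_assoc, mul_assoc, ← Finset.mul_sum] <;> ring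

variable {g g' : Metric 4 M} {e e' : Fin 4 → TangentSpace (𝓡 4) x} {t : ℝ}

/-- The transition matrix between the two frames is orthogonal, so its determinant squares to 1; the
common orientation makes it positive. -/
lemma IsOrientedFrame.form_eq (he : IsOrientedFrame g o x e) (he' : IsOrientedFrame g o x e') :
    o.form x e' = o.form x e := by
  have h1 : o.form x e' = o.form x e * he.1.basis.det e' := by
    have := (o.form x).eq_smul_basis_det he.1.basis
    conv_lhs => rw [this]
    have e1 : (fun i => he.1.basis i) = e := funext he.1.basis_apply
    simp [e1]
  have h2 : (he.1.basis.det e') ^ 2 = 1 := by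
    rw [Module.Basis.det_apply, sq]
    nth_rewrite 1 [← Matrix.det_transpose]
    rw [← Matrix.det_mul, ← Matrix.det_one (n := Fin 4)]
    congr 1
    ext i j
    have e1 : ∀ i j, he.1.basis.toMatrix e' i j = g.inner x (e' j) (e i) := by
      intro i j
      rw [Module.Basis.toMatrix_apply]
      conv_rhs => rw [← he.1.basis.sum_repr (e' j)]
      simp [he.1 _ i]
    simp only [Matrix.mul_apply, Matrix.transpose_apply, e1, Matrix.one_apply]
    rw [← he.1.inner_eq, he'.1 i j]
  have h3 := he.2
  have h4 := he'.2
  rw [h1] at h4 ⊢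
  have h5 : 0 < he.1.basis.det e' := pos_of_mul_pos_right h4 h3.le |> fun h => h
  have : he.1.basis.det e' = 1 := by nlinarith
  rw [this, mul_one]

/-- The double trace is independent of the frame, and `t • e'` is an oriented frame for `g`.
Rescaling produces t⁴ from the two volume slots and the two slots of `α`, and t⁴ again from the
normalization by the volume of the frame. The balance is special to 2-forms in dimension 4. -/
lemma hodgeStar_eq_of_conformal (ht : 0 < t) (he : IsOrientedFrame g o x e)
    (he' : IsOrientedFrame g' o x e') (hg : ∀ v w, g'.inner x v w = t ^ 2 * g.inner x v w)
    {α : TangentSpace (𝓡 4) x → TangentSpace (𝓡 4) x → ℝ}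
    (h1 : ∀ w, IsLinearMap ℝ (fun v => α v w)) (h2 : ∀ v, IsLinearMap ℝ (α v))
    (v w : TangentSpace (𝓡 4) x) : hodgeStar o x e' α v w = hodgeStar o x e α v w := by
  have hform : o.form x (fun i => t • e' i) = t ^ 4 * o.form x e' := by
    have := (o.form x).toMultilinearMap.map_smul_univ (fun _ => t) e'
    simpa using this
  have h : IsOrientedFrame g o x (fun i => t • e' i) := by
    refine ⟨fun i j => ?_, ?_⟩
    · rw [← he'.1 i j, hg]
      simp only [map_smul, smul_apply, smul_eq_mul]; ring
    · rw [hform]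
      have := he'.2
      positivity
  have l3 := fun a b d => isLinearMap_alternating₃ (o.form x) a b d
  have l4 := fun a b d => isLinearMap_alternating₄ (o.form x) a b d
  have key : ∑ i, ∑ j, o.form x ![v, w, t • e' i, t • e' j] * α (t • e' i) (t • e' j)
      = ∑ i, ∑ j, o.form x ![v, w, e i, e j] * α (e i) (e j) := by
    have s1 : ∀ a, ∑ j, o.form x ![v, w, a, t • e' j] * α a (t • e' j)
        = ∑ j, o.form x ![v, w, a, e j] * α a (e j) := by
      intro a
      refine he.1.trace_eq' h.1 (T := fun b c => o.form x ![v, w, a, b] * α a c) ?_ ?_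
      · intro c
        constructor <;> intros <;> simp only [(l4 _ _ _).map_add, (l4 _ _ _).map_smul,
          smul_eq_mul] <;> ring
      · intro c
        constructor <;> intros <;> simp only [(h2 _).map_add, (h2 _).map_smul,
          smul_eq_mul] <;> ring
    rw [Finset.sum_congr rfl fun i _ => s1 (t • e' i), Finset.sum_comm]
    rw [Finset.sum_comm (γ := Fin 4)]
    rw [Finset.sum_comm, Finset.sum_comm (f := fun i j => o.form x ![v, w, e i, e j] * α (e i) (e j))]
    refine Finset.sum_congr rfl fun j _ => ?_
    refine he.1.trace_eq' h.1 (T := fun b c => o.form x ![v, w, b, e j] * α c (e j)) ?_ ?_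
    · intro c
      constructor <;> intros <;> simp only [(l3 _ _ _).map_add, (l3 _ _ _).map_smul,
        smul_eq_mul] <;> ring
    · intro c
      constructor <;> intros <;> simp only [(h1 _).map_add, (h1 _).map_smul,
        smul_eq_mul] <;> ring
  have hf := he.form_eq h
  rw [hform] at hf
  have h0 : o.form x e' ≠ 0 := he'.2.ne'
  simp only [hodgeStar, ← hf, div_mul_eq_mul_div, ← Finset.sum_div, ← key]
  simp only [(l3 _ _ _).map_smul, (l4 _ _ _).map_smul, (h1 _).map_smul, (h2 _).map_smul,
    smul_eq_mul]
  have : ∀ i j, t * (t * o.form x ![v, w, e' i, e' j]) * (t * (t * α (e' i) (e' j)))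
      = t ^ 4 * (o.form x ![v, w, e' i, e' j] * α (e' i) (e' j)) := fun i j => by ring
  simp only [this, ← Finset.mul_sum]
  rw [mul_div_mul_left _ _ (pow_ne_zero 4 ht.ne')]

end Hodge

/-! ### Selfduality read off in an oriented frame. -/

section Selfduality

variable {M : Type*} [TopologicalSpace M] [ChartedSpace (Model 4) M] [IsManifold (𝓡 4) ∞ M]
  {o : OrientationForm 4 M} {x : M}

lemma hodgeStar_swap (e : Fin 4 → TangentSpace (𝓡 4) x)
    (α : TangentSpace (𝓡 4) x → TangentSpace (𝓡 4) x → ℝ) (v w : TangentSpace (𝓡 4) x) :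
    hodgeStar o x e α w v = - hodgeStar o x e α v w := by
  simp only [hodgeStar, alternating_swap₁ (o.form x) v w, neg_div, neg_mul, Finset.sum_neg_distrib,
    mul_neg]

/-- The star operator on an oriented orthonormal frame. -/
lemma hodgeStar_frame {e : Fin 4 → TangentSpace (𝓡 4) x} (he : o.form x e ≠ 0)
    {α : TangentSpace (𝓡 4) x → TangentSpace (𝓡 4) x → ℝ} (hα : ∀ v w, α w v = - α v w) :
    hodgeStar o x e α (e 0) (e 1) = - α (e 2) (e 3) ∧
    hodgeStar o x e α (e 2) (e 3) = - α (e 0) (e 1) ∧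
    hodgeStar o x e α (e 0) (e 2) = - α (e 3) (e 1) ∧
    hodgeStar o x e α (e 3) (e 1) = - α (e 0) (e 2) ∧
    hodgeStar o x e α (e 0) (e 3) = - α (e 1) (e 2) ∧
    hodgeStar o x e α (e 1) (e 2) = - α (e 0) (e 3) := by
  set f := o.form x with hf
  have z1 : ∀ a c d, f ![a, a, c, d] = 0 := fun a c d => by
    linarith [alternating_swap₁ f a a c d]
  have z2 : ∀ a b d, f ![a, b, b, d] = 0 := fun a b d => by
    linarith [alternating_swap₂ f a b b d]
  have z3 : ∀ a b c, f ![a, b, c, c] = 0 := fun a b c => by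
    linarith [alternating_swap₃ f a b c c]
  have z4 : ∀ a b d, f ![a, b, a, d] = 0 := fun a b d => by
    rw [alternating_swap₂, z1, neg_zero]
  have z5 : ∀ a b c, f ![a, b, c, b] = 0 := fun a b c => by
    rw [alternating_swap₃, z2, neg_zero]
  have z6 : ∀ a b c, f ![a, b, c, a] = 0 := fun a b c => by
    rw [alternating_swap₃, z4, neg_zero]
  have p0 : f ![e 0, e 1, e 2, e 3] = f e := by
    congr 1; ext i; fin_cases i <;> rfl
  have s1 := alternating_swap₁ f
  have s2 := alternating_swap₂ f
  have s3 := alternating_swap₃ f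
  have p1 : f ![e 0, e 1, e 3, e 2] = - f e := by rw [s3, p0]
  have p2 : f ![e 0, e 2, e 1, e 3] = - f e := by rw [s2, p0]
  have p3 : f ![e 0, e 2, e 3, e 1] = f e := by rw [s3, p2, neg_neg]
  have p4 : f ![e 0, e 3, e 1, e 2] = f e := by rw [s2, p1, neg_neg]
  have p5 : f ![e 0, e 3, e 2, e 1] = - f e := by rw [s3, p4]
  have p6 : f ![e 1, e 2, e 0, e 3] = f e := by rw [s2, s1, p0, neg_neg]
  have p7 : f ![e 1, e 2, e 3, e 0] = - f e := by rw [s3, p6]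
  have p8 : f ![e 2, e 3, e 0, e 1] = f e := by rw [s2, s1, p3, neg_neg]
  have p9 : f ![e 2, e 3, e 1, e 0] = - f e := by rw [s3, p8]
  have p10 : f ![e 3, e 1, e 0, e 2] = f e := by rw [s2, s1, p4, neg_neg]
  have p11 : f ![e 3, e 1, e 2, e 0] = - f e := by rw [s3, p10]
  have q : f e / f e = 1 := div_self he
  have q' : - f e / f e = -1 := by rw [neg_div, q]
  refine ⟨?_, ?_, ?_, ?_, ?_, ?_⟩ <;>
  simp only [hodgeStar, ← hf, Fin.sum_univ_four, z2, z3, z4, z5, z6, p0, p1, p2, p3, p4, p5, p6,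
    p7, p8, p9, p10, p11, q, q', zero_div, zero_mul, add_zero, zero_add]
  · linarith [hα (e 2) (e 3)]
  · linarith [hα (e 0) (e 1)]
  · linarith [hα (e 1) (e 3)]
  · linarith [hα (e 0) (e 2)]
  · linarith [hα (e 1) (e 2)]
  · linarith [hα (e 0) (e 3)]

/-- A 2-form is selfdual if and only if its antiselfdual components vanish. -/
lemma hodgeStar_eq_iff {g : Metric 4 M} {e : Fin 4 → TangentSpace (𝓡 4) x}
    (he : IsOrientedFrame g o x e)
    {α : TangentSpace (𝓡 4) x → TangentSpace (𝓡 4) x → ℝ}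
    (h1 : ∀ w, IsLinearMap ℝ (fun v => α v w)) (hα : ∀ v w, α w v = - α v w) :
    (∀ v w, hodgeStar o x e α v w = α v w) ↔ ∀ i, asdComp (fun a b => α (e a) (e b)) i = 0 := by
  obtain ⟨t1, t2, t3, t4, t5, t6⟩ := hodgeStar_frame he.2.ne' hα
  have h2 : ∀ v, IsLinearMap ℝ (α v) := by
    intro v
    have e : α v = fun w => - α w v := funext fun w => hα w v
    rw [e]
    constructor <;> intros <;> simp only [(h1 v).map_add, (h1 v).map_smul, smul_neg, neg_add]
  constructor
  · intro h i
    simp only [h] at t1 t2 t3 t4 t5 t6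
    fin_cases i <;> simp only [asdComp, Fin.zero_eta, Fin.mk_one, Fin.reduceFinMk, Matrix.cons_val]
      <;> linarith
  · intro h v w
    have c0 := h 0; have c1 := h 1; have c2 := h 2
    simp only [asdComp, Matrix.cons_val] at c0 c1 c2
    refine he.1.eq_of_isLinearMap (isLinearMap_hodgeStar₁ e α w) (h1 w) (fun a => ?_) v
    refine he.1.eq_of_isLinearMap (isLinearMap_hodgeStar₂ e α (e a)) (h2 (e a)) (fun b => ?_) w
    have hs := hodgeStar_swap (o := o) e α
    have d : ∀ a, hodgeStar o x e α (e a) (e a) = α (e a) (e a) := fun a => by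
      linarith [hs (e a) (e a), hα (e a) (e a)]
    fin_cases a <;> fin_cases b <;> simp only [Fin.zero_eta, Fin.mk_one, Fin.reduceFinMk, d]
    · linarith
    · linarith
    · linarith
    · linarith [hs (e 0) (e 1), hα (e 0) (e 1)]
    · linarith
    · linarith [hs (e 3) (e 1), hα (e 3) (e 1)]
    · linarith [hs (e 0) (e 2), hα (e 0) (e 2)]
    · linarith [hs (e 1) (e 2), hα (e 1) (e 2)]
    · linarith
    · linarith [hs (e 0) (e 3), hα (e 0) (e 3)]
    · linarith
    · linarith [hs (e 2) (e 3), hα (e 2) (e 3)]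

variable {C : ConformalStructure 4 M} [T2Space M] {E : Fin 4 → VField 4 M}

lemma weyl_eq_bracketComp (D : WeylDerivative C) {g : C.Gauge} (h : IsFrameNear g.1 E x)
    (a b c d : Fin 4) :
    D.weyl g x (fun i => E i x) (E a x) (E b x) (E c x) (E d x)
      = bracketComp (fun a b c d => curvFn D.conn g.1 E a b c d x)
          (nricComp (fun a b c d => curvFn D.conn g.1 E a b c d x)) a b c d := by
  have hk : ∀ a b, g.1.inner x (E a x) (E b x) = kron a b := fun a b => h.at a b
  have hric : ∀ a b, D.ricci g x (fun i => E i x) (E a x) (E b x)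
      = ricComp (fun a b c d => curvFn D.conn g.1 E a b c d x) a b := fun a b => rfl
  have hr : ∀ a b, D.normalizedRicci g x (fun i => E i x) (E a x) (E b x)
      = nricComp (fun a b c d => curvFn D.conn g.1 E a b c d x) a b := by
    intro a b
    simp only [WeylDerivative.normalizedRicci, WeylDerivative.scalar, hric, hk, nricComp]
    push_cast
    ring
  simp only [WeylDerivative.weyl, WeylDerivative.ricciBracket, hr, hk, bracketComp]
  rfl

lemma weyl_swap (D : WeylDerivative C) {g : C.Gauge} (e : Fin 4 → TangentSpace (𝓡 4) x)
    (u v w z : TangentSpace (𝓡 4) x) :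
    D.weyl g x e v u w z = - D.weyl g x e u v w z := by
  have hs : ∀ u v w : TangentSpace (𝓡 4) x,
      curvature D.conn x v u w = - curvature D.conn x u v w := by
    intro u v w
    have e : ∀ v : TangentSpace (𝓡 4) x,
      SmoothNear (FiberBundle.extend (Model 4) v : VField 4 M) x := smoothNear_extend
    have := curvature_eq_curvatureField D.smooth g.1 (e u) (e v) (e w)
    have h2 := curvature_eq_curvatureField D.smooth g.1 (e v) (e u) (e w)
    rw [curvatureField_swap, ← this] at h2
    simpa using h2
  simp only [WeylDerivative.weyl, hs u v w, map_neg, neg_apply]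
  ring

/-- In a selfdual conformal structure, the antiselfdual part of the curvature of a Weyl connection
has no symmetric tracefree part. -/
lemma ConformalStructure.IsSelfdual.symTracefreeVanishes (hC : C.IsSelfdual o)
    (D : WeylDerivative C) {g : C.Gauge} (h : IsFrameNear g.1 E x)
    (ho : 0 < o.form x (fun i => E i x)) :
    SymTracefreeVanishes (asdCurv (fun a b c d => curvFn D.conn g.1 E a b c d x)) := by
  refine symTracefreeVanishes_of_bracketComp
    (r := nricComp (fun a b c d => curvFn D.conn g.1 E a b c d x)) fun c d i => ?_
  have := (hodgeStar_eq_iff (o := o) ⟨h.at, ho⟩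
    (α := fun a b => D.weyl g x (fun i => E i x) a b (E c x) (E d x))
    (fun v => D.isLinearMap_weyl₁ g _ v _ _) (fun v w => weyl_swap D _ v w _ _)).1
    (fun u v => hC D g x _ ⟨h.at, ho⟩ u v (E c x) (E d x)) i
  simpa only [weyl_eq_bracketComp D h] using this

/-- Sufficient condition for selfduality in terms of one frame for each Weyl derivative. -/
lemma ConformalStructure.isSelfdual_of_symTracefreeVanishes
    (H : ∀ (D : WeylDerivative C) (x : M), ∃ (g : C.Gauge) (E : Fin 4 → VField 4 M),
      IsFrameNear g.1 E x ∧ 0 < o.form x (fun i => E i x) ∧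
      SymTracefreeVanishes (asdCurv (fun a b c d => curvFn D.conn g.1 E a b c d x))) :
    C.IsSelfdual o := by
  intro D g' x e' he' u v w z
  obtain ⟨g, E, h, ho, hN⟩ := H D x
  obtain ⟨f, -, hf⟩ := (C.mem_iff g.1 g.2 g'.1).1 g'.2
  have hg : ∀ v w, g'.1.inner x v w = Real.exp (f x) ^ 2 * g.1.inner x v w := by
    intro v w
    rw [hf, ← Real.exp_nat_mul]
    norm_num
  have he : IsOrientedFrame g.1 o x (fun i => E i x) := ⟨h.at, ho⟩
  -- The Weyl tensor acquires a factor and the star none, so selfduality for the arbitrary gauge and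
  -- frame `g'`, `e'` follows from selfduality for the chosen `g`, `E`.
  have hW := WeylDerivative.weyl_eq_of_conformal (D := D) h.at he'.1 hg
  simp only [hW]
  have key : ∀ u v w z, hodgeStar o x (fun i => E i x)
      (fun a b => D.weyl g x (fun i => E i x) a b w z) u v
      = D.weyl g x (fun i => E i x) u v w z := by
    intro u v w z
    refine (hodgeStar_eq_iff he (α := fun a b => D.weyl g x (fun i => E i x) a b w z)
      (fun v => D.isLinearMap_weyl₁ g _ v _ _) (fun v w => weyl_swap D _ v w _ _)).2 ?_ u v
    intro i
    have l1 : ∀ z, IsLinearMap ℝ fun w => asdComp (fun a b =>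
        D.weyl g x (fun i => E i x) (E a x) (E b x) w z) i := by
      intro z
      have := fun a b => D.isLinearMap_weyl₃ g (fun i => E i x) (E a x) (E b x) z
      fin_cases i <;> constructor <;> intros <;> simp only [asdComp, Fin.zero_eta, Fin.mk_one,
        Fin.reduceFinMk, Matrix.cons_val, (this _ _).map_add, (this _ _).map_smul, smul_eq_mul]
        <;> ring
    have l2 : ∀ w, IsLinearMap ℝ fun z => asdComp (fun a b =>
        D.weyl g x (fun i => E i x) (E a x) (E b x) w z) i := by
      intro w
      have := fun a b => D.isLinearMap_weyl₄ g (fun i => E i x) (E a x) (E b x) w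
      fin_cases i <;> constructor <;> intros <;> simp only [asdComp, Fin.zero_eta, Fin.mk_one,
        Fin.reduceFinMk, Matrix.cons_val, (this _ _).map_add, (this _ _).map_smul, smul_eq_mul]
        <;> ring
    have l0 : IsLinearMap ℝ (fun _ : TangentSpace (𝓡 4) x => (0 : ℝ)) :=
      ⟨by simp, by simp⟩
    refine he.1.eq_of_isLinearMap (l1 z) l0 (fun c => ?_) w
    refine he.1.eq_of_isLinearMap (l2 (E c x)) l0 (fun d => ?_) z
    simp only [weyl_eq_bracketComp D h]
    exact asdComp_bracketComp_eq_zero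
      -- These are the frame components of the Faraday curvature of `D`.
      (F := fun a b => dir (E a) (fun y => D.form g y (E b y)) x
        - dir (E b) (fun y => D.form g y (E a y)) x
        - ∑ f, structFn g.1 E a b f x * D.form g x (E f x))
      (fun a b c d => curvFn_swap D.smooth h a b c d) (fun a b c d => D.curvFn_skew h a b c d)
      (fun a b c d => curvFn_bianchi D.smooth D.torsion_eq_zero h a b c d) hN c d i
  rw [hodgeStar_eq_of_conformal (Real.exp_pos _) he he' hg, ← key]
  · simp only [hodgeStar, Finset.mul_sum]
    refine Finset.sum_congr rfl fun i _ => Finset.sum_congr rfl fun j _ => by ring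
  · intro b
    constructor <;> intros <;> simp only [(D.isLinearMap_weyl₁ g _ _ _ _).map_add,
      (D.isLinearMap_weyl₁ g _ _ _ _).map_smul, smul_eq_mul] <;> ring
  · intro b
    constructor <;> intros <;> simp only [(D.isLinearMap_weyl₂ g _ _ _ _).map_add,
      (D.isLinearMap_weyl₂ g _ _ _ _).map_smul, smul_eq_mul] <;> ring

end Selfduality

/-! ### Vector fields related by a smooth map. -/

section RelatedFields

variable {m n : ℕ} {M B : Type*} [TopologicalSpace M] [ChartedSpace (Model m) M]
  [IsManifold (𝓡 m) ∞ M] [TopologicalSpace B] [ChartedSpace (Model n) B] [IsManifold (𝓡 n) ∞ B]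
  {p : M → B} {x : M}

lemma FnSmoothNear.comp_map (hp : ContMDiff (𝓡 m) (𝓡 n) ∞ p) {F : B → ℝ}
    (hF : FnSmoothNear (n := n) F (p x)) : FnSmoothNear (n := m) (fun y => F (p y)) x := by
  filter_upwards [hp.continuous.continuousAt.eventually hF] with y hy
  exact hy.comp y hp.contMDiffAt

lemma mvfderiv_comp_map (hp : ContMDiff (𝓡 m) (𝓡 n) ∞ p) {F : B → ℝ}
    (hF : FnSmoothNear (n := n) F (p x)) (v : TangentSpace (𝓡 m) x) :
    mvfderiv (𝓡 m) (fun y => F (p y)) x v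
      = mvfderiv (𝓡 n) F (p x) (mfderiv (𝓡 m) (𝓡 n) p x v) := by
  have := mfderiv_comp_apply x hF.mdiff (hp.mdifferentiableAt (x := x) (by simp)) v
  simp only [mvfderiv]
  exact this

lemma dir_comp_map (hp : ContMDiff (𝓡 m) (𝓡 n) ∞ p) {F : B → ℝ}
    (hF : FnSmoothNear (n := n) F (p x)) {V : VField m M} {V' : VField n B}
    (h : mfderiv (𝓡 m) (𝓡 n) p x (V x) = V' (p x)) :
    dir V (fun y => F (p y)) x = dir V' F (p x) := by
  simp only [dir]
  rw [mvfderiv_comp_map hp hF, h]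

/-- The differential of a chart is invertible, so the coordinate functions already separate tangent
vectors. -/
lemma eq_of_mvfderiv_eq {b : B} {v w : TangentSpace (𝓡 n) b}
    (h : ∀ F : B → ℝ, FnSmoothNear (n := n) F b → mvfderiv (𝓡 n) F b v = mvfderiv (𝓡 n) F b w) :
    v = w := by
  have hinv := isInvertible_mfderiv_extChartAt (I := 𝓡 n) (mem_extChartAt_source (I := 𝓡 n) b)
  refine hinv.injective ?_
  refine PiLp.ext fun i => ?_
  have hs : ∀ᶠ y in 𝓝 b, ContMDiffAt (𝓡 n) 𝓘(ℝ, Model n) ∞ (extChartAt (𝓡 n) b) y := by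
    filter_upwards [extChartAt_source_mem_nhds (I := 𝓡 n) b] with y hy
    exact contMDiffAt_extChartAt' (by simpa using hy)
  let L : Model n →L[ℝ] ℝ := EuclideanSpace.proj i
  have hF : FnSmoothNear (n := n) (fun y => L (extChartAt (𝓡 n) b y)) b := by
    filter_upwards [hs] with y hy
    exact L.contMDiff.contMDiffAt.comp y hy
  have key : ∀ u : TangentSpace (𝓡 n) b, mvfderiv (𝓡 n) (fun y => L (extChartAt (𝓡 n) b y)) b u
      = L (mfderiv (𝓡 n) 𝓘(ℝ, Model n) (extChartAt (𝓡 n) b) b u) := by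
    intro u
    have := mfderiv_comp_apply (I := 𝓡 n) (I' := 𝓘(ℝ, Model n)) (I'' := 𝓘(ℝ, ℝ)) b
      (L.mdifferentiableAt (x := extChartAt (𝓡 n) b b))
      (hs.self_of_nhds.mdifferentiableAt (by simp)) u
    rw [L.mfderiv_eq] at this
    exact this
  exact (key v).symm.trans ((h _ hF).trans (key w))

/-- Brackets of related vector fields are related. -/
lemma mfderiv_mlieBracket (hp : ContMDiff (𝓡 m) (𝓡 n) ∞ p) {V W : VField m M} {V' W' : VField n B}
    (hV : SmoothNear V x) (hW : SmoothNear W x) (hV' : SmoothNear V' (p x))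
    (hW' : SmoothNear W' (p x)) (hr : ∀ᶠ y in 𝓝 x, mfderiv (𝓡 m) (𝓡 n) p y (V y) = V' (p y))
    (hs : ∀ᶠ y in 𝓝 x, mfderiv (𝓡 m) (𝓡 n) p y (W y) = W' (p y)) :
    mfderiv (𝓡 m) (𝓡 n) p x (VectorField.mlieBracket (𝓡 m) V W x)
      = VectorField.mlieBracket (𝓡 n) V' W' (p x) := by
  -- Both sides are compared as derivations on functions `F` of the base, where a bracket is a
  -- commutator and relatedness turns derivatives of `F ∘ p` into pullbacks.
  refine eq_of_mvfderiv_eq fun F hF => ?_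
  rw [← mvfderiv_comp_map hp hF]
  have h1 := dir_bracket hV hW (hF.comp_map hp)
  have h2 := dir_bracket hV' hW' hF
  have hF' := hp.continuous.continuousAt.eventually hF.eventually
  simp only [dir] at h1 h2
  change dir (VectorField.mlieBracket (𝓡 m) V W) _ x
    = dir (VectorField.mlieBracket (𝓡 n) V' W') F (p x)
  rw [dir_bracket hV hW (hF.comp_map hp), dir_bracket hV' hW' hF]
  have e1 : dir V (dir W fun y => F (p y)) x = dir V (fun y => dir W' F (p y)) x :=
    dir_congr (by filter_upwards [hs, hF'] with y h1 h2 using dir_comp_map hp h2 h1)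
  have e2 : dir W (dir V fun y => F (p y)) x = dir W (fun y => dir V' F (p y)) x :=
    dir_congr (by filter_upwards [hr, hF'] with y h1 h2 using dir_comp_map hp h2 h1)
  rw [e1, e2, dir_comp_map hp (hF.dir hW') hr.self_of_nhds,
    dir_comp_map hp (hF.dir hV') hs.self_of_nhds]

end RelatedFields

/-! ### Conformal rescaling of metrics. -/

section ScaledMetric

variable {n : ℕ} {M : Type*} [TopologicalSpace M] [ChartedSpace (Model n) M]
  [IsManifold (𝓡 n) ∞ M]

set_option synthInstance.maxHeartbeats 200000 in
/-- The metric `e^{2f} g`. -/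
def scaledMetric (g : Metric n M) (f : M → ℝ) (hf : ContMDiff (𝓡 n) 𝓘(ℝ, ℝ) ∞ f) :
    Metric n M where
  inner x := Real.exp (2 * f x) • g.inner x
  symm x v w := by simp [g.symm x v w]
  pos x v hv := by
    have := g.pos x v hv
    simp only [smul_apply, smul_eq_mul]
    positivity
  isVonNBounded x := by
    -- The unit ball of e^{2f} g is the image of that of `g` under multiplication by e^{-f}.
    have h := (g.isVonNBounded x).image
      ((Real.exp (- f x)) • ContinuousLinearMap.id ℝ (TangentSpace (𝓡 n) x))
    refine Bornology.IsVonNBounded.subset (fun v hv => ?_) h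
    refine ⟨Real.exp (f x) • v, ?_, ?_⟩
    · simp only [smul_apply, smul_eq_mul, mem_ofPred_eq, map_smul] at hv ⊢
      rw [two_mul, Real.exp_add, mul_assoc] at hv
      exact hv
    · simp [smul_smul, ← Real.exp_add]
  contMDiff := by
    have hf' : ContMDiff (𝓡 n) 𝓘(ℝ, ℝ) ∞ (fun x => Real.exp (2 * f x)) :=
      (Real.contDiff_exp.comp (contDiff_const.mul contDiff_id)).contMDiff.comp hf
    exact hf'.smul_section g.contMDiff

lemma ConformalStructure.exists_gauge (C : ConformalStructure n M) (g : C.Gauge) {f : M → ℝ}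
    (hf : ContMDiff (𝓡 n) 𝓘(ℝ, ℝ) ∞ f) : ∃ g' : C.Gauge, ∀ x (v w : TangentSpace (𝓡 n) x),
      g'.1.inner x v w = Real.exp (2 * f x) * g.1.inner x v w :=
  ⟨⟨scaledMetric g.1 f hf, (C.mem_iff g.1 g.2 _).2 ⟨f, hf, fun _ _ _ => rfl⟩⟩, fun _ _ _ => rfl⟩

end ScaledMetric

/-! ### Pullback gauges and adapted frames. -/

section ConformalSubmersions

variable {M B : Type*} [TopologicalSpace M] [ChartedSpace (Model 4) M] [IsManifold (𝓡 4) ∞ M]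
  [TopologicalSpace B] [ChartedSpace (Model 3) B] [IsManifold (𝓡 3) ∞ B]
  {C : ConformalStructure 4 M} {CB : ConformalStructure 3 B} {p : M → B} {ξ : Congruence C}
  {g : C.Gauge} {h : CB.Gauge} {x : M}

lemma IsTangentToFibres.mfderiv_field (hξ : IsTangentToFibres (n := 3) p ξ) (g : C.Gauge) (x : M) :
    mfderiv (𝓡 4) (𝓡 3) p x (ξ.field g x) = 0 :=
  (hξ g x _).2 ⟨1, by simp⟩

lemma IsTangentToFibres.isHorizontal_iff (hξ : IsTangentToFibres (n := 3) p ξ)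
    {v : TangentSpace (𝓡 4) x} :
    IsHorizontal (n := 3) p g.1 x v ↔ g.1.inner x (ξ.field g x) v = 0 := by
  refine ⟨fun hv => hv _ (hξ.mfderiv_field g x), fun hv u hu => ?_⟩
  obtain ⟨t, rfl⟩ := (hξ g x u).1 hu
  simp [hv]

/-- The difference is vertical, hence a multiple of the unit field, and that multiple is its inner
product with the field. -/
lemma IsTangentToFibres.eq_of_mfderiv_eq (hξ : IsTangentToFibres (n := 3) p ξ)
    {v w : TangentSpace (𝓡 4) x}
    (h1 : mfderiv (𝓡 4) (𝓡 3) p x v = mfderiv (𝓡 4) (𝓡 3) p x w)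
    (h2 : g.1.inner x (ξ.field g x) v = g.1.inner x (ξ.field g x) w) : v = w := by
  obtain ⟨t, ht⟩ := (hξ g x (v - w)).1 (by rw [map_sub, h1, sub_self])
  have : g.1.inner x (ξ.field g x) (v - w) = t := by
    rw [ht]; simp [ξ.unit]
  rw [map_sub, h2, sub_self] at this
  rw [← this, zero_smul] at ht
  exact sub_eq_zero.1 ht

lemma IsTangentToFibres.inner_sub_smul (ξ : Congruence C) (g : C.Gauge) {x : M}
    (v : TangentSpace (𝓡 4) x) : g.1.inner x (ξ.field g x)
      (v - g.1.inner x (ξ.field g x) v • ξ.field g x) = 0 := by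
  simp [ξ.unit]

lemma IsTangentToFibres.mfderiv_sub_smul (hξ : IsTangentToFibres (n := 3) p ξ)
    (v : TangentSpace (𝓡 4) x) (t : ℝ) :
    mfderiv (𝓡 4) (𝓡 3) p x (v - t • ξ.field g x) = mfderiv (𝓡 4) (𝓡 3) p x v := by
  rw [map_sub, map_smul, hξ.mfderiv_field, smul_zero, sub_zero]

lemma IsConformalSubmersion.exists_lift (hp : IsConformalSubmersion C CB p)
    (hξ : IsTangentToFibres (n := 3) p ξ) (g : C.Gauge) (x : M) (w : TangentSpace (𝓡 3) (p x)) :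
    ∃ v : TangentSpace (𝓡 4) x, mfderiv (𝓡 4) (𝓡 3) p x v = w ∧
      g.1.inner x (ξ.field g x) v = 0 := by
  obtain ⟨v, rfl⟩ := hp.submersion x w
  exact ⟨_, hξ.mfderiv_sub_smul v _, IsTangentToFibres.inner_sub_smul ξ g v⟩

/-- Only one of the vectors has to be horizontal: the vertical part of `u` is killed by dp and is
orthogonal to `v`. -/
lemma IsPullbackGauge.inner_eq (hgh : IsPullbackGauge p g h)
    (hξ : IsTangentToFibres (n := 3) p ξ) (u : TangentSpace (𝓡 4) x) {v : TangentSpace (𝓡 4) x}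
    (hv : g.1.inner x (ξ.field g x) v = 0) :
    h.1.inner (p x) (mfderiv (𝓡 4) (𝓡 3) p x u) (mfderiv (𝓡 4) (𝓡 3) p x v)
      = g.1.inner x u v := by
  have := hgh x (u - g.1.inner x (ξ.field g x) u • ξ.field g x) v
    (hξ.isHorizontal_iff.2 (IsTangentToFibres.inner_sub_smul ξ g u)) (hξ.isHorizontal_iff.2 hv)
  rw [hξ.mfderiv_sub_smul] at this
  rw [this]
  simp [hv]

/-- Every gauge on the base can be pulled back. -/
lemma IsConformalSubmersion.exists_isPullbackGauge (hp : IsConformalSubmersion C CB p)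
    (hξ : IsTangentToFibres (n := 3) p ξ) (h : CB.Gauge) : ∃ g : C.Gauge, IsPullbackGauge p g h := by
  obtain ⟨g₀, hg₀⟩ := C.nonempty
  let g : C.Gauge := ⟨g₀, hg₀⟩
  choose c hc hc' using fun x => hp.conformal g h x
  -- The trace of p^*h with respect to `g` counts `c` once for each of the three horizontal
  -- directions. As `c` comes from a pointwise choice, this formula is what makes it smooth.
  have hsum : ∀ x (e : Fin 4 → TangentSpace (𝓡 4) x), IsOrthonormalFrame g.1 x e →
      ∑ a, h.1.inner (p x) (mfderiv (𝓡 4) (𝓡 3) p x (e a)) (mfderiv (𝓡 4) (𝓡 3) p x (e a))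
        = 3 * c x := by
    intro x e he
    have h1 : ∀ a, h.1.inner (p x) (mfderiv (𝓡 4) (𝓡 3) p x (e a))
        (mfderiv (𝓡 4) (𝓡 3) p x (e a))
        = c x - c x * (g.1.inner x (ξ.field g x) (e a) * g.1.inner x (ξ.field g x) (e a)) := by
      intro a
      have h2 := hξ.isHorizontal_iff.2 (IsTangentToFibres.inner_sub_smul ξ g (e a))
      have h3 := hc' x _ _ h2 h2
      rw [hξ.mfderiv_sub_smul] at h3
      rw [h3]
      have h4 := he a a
      rw [if_pos rfl] at h4
      simp only [map_sub, map_smul, sub_apply, smul_apply, smul_eq_mul, h4, ξ.unit,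
        g.1.symm x (e a) (ξ.field g x)]
      ring
    rw [Finset.sum_congr rfl fun a _ => h1 a, Finset.sum_sub_distrib, ← Finset.mul_sum,
      ← he.inner_eq, ξ.unit]
    simp
    ring
  have hsm : ∀ x, FnSmoothNear (n := 4) c x := by
    intro x
    obtain ⟨e, he⟩ := exists_isOrthonormalFrame g.1 x
    obtain ⟨E, -, hE, ho⟩ := he.exists_extension
    have h1 : FnSmoothNear (n := 4) (fun y => (1 / 3) * ∑ a, h.1.inner (p y)
        (mfderiv (𝓡 4) (𝓡 3) p y (E a y)) (mfderiv (𝓡 4) (𝓡 3) p y (E a y))) x := by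
      refine (FnSmoothNear.const _).mul (FnSmoothNear.sum fun a _ => ?_)
      filter_upwards [hE a] with y hy
      exact contMDiffAt_metric h.1 (contMDiffAt_mfderiv_apply hy hp.smooth.contMDiffAt)
        (contMDiffAt_mfderiv_apply hy hp.smooth.contMDiffAt)
    refine h1.congr ?_
    filter_upwards [ho] with y hy
    rw [hsum y _ hy]; ring
  -- The exponent is ½ log c, since a gauge change by `f` multiplies the metric by e^{2f}.
  have hf : ContMDiff (𝓡 4) 𝓘(ℝ, ℝ) ∞ (fun x => (1 / 2) * Real.log (c x)) := fun x =>
    ((FnSmoothNear.const (1 / 2)).mul ((hsm x).comp (φ := Real.log)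
      (Filter.Eventually.of_forall fun y => Real.contDiffAt_log.2 (hc y).ne'))).at
  obtain ⟨g', hg'⟩ := C.exists_gauge g hf
  have hg2 : ∀ x (v w : TangentSpace (𝓡 4) x), g'.1.inner x v w = c x * g.1.inner x v w := by
    intro x v w
    rw [hg', ← mul_assoc, show (2 : ℝ) * (1 / 2) = 1 by norm_num, one_mul, Real.exp_log (hc x)]
  refine ⟨g', fun x v w hv hw => ?_⟩
  have hor : ∀ v : TangentSpace (𝓡 4) x, IsHorizontal (n := 3) p g'.1 x v →
      IsHorizontal (n := 3) p g.1 x v := by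
    intro v hv u hu
    have := hv u hu
    rw [hg2] at this
    exact (mul_eq_zero.1 this).resolve_left (hc x).ne'
  rw [hc' x v w (hor v hv) (hor w hw), hg2]

/-- An orthonormal frame consisting of the vertical unit vector field and the horizontal lifts of
an orthonormal frame of the base. -/
structure IsAdaptedFrame (p : M → B) (ξ : Congruence C) (g : C.Gauge) (h : CB.Gauge)
    (E : Fin 4 → VField 4 M) (f : Fin 3 → VField 3 B) (x : M) : Prop where
  frame : IsFrameNear g.1 E x
  base : IsFrameNear h.1 f (p x)
  vertical : E 0 = ξ.field g
  related : ∀ᶠ y in 𝓝 x, ∀ i : Fin 3, mfderiv (𝓡 4) (𝓡 3) p y (E i.succ y) = f i (p y)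

lemma IsAdaptedFrame.eventually {E : Fin 4 → VField 4 M} {f : Fin 3 → VField 3 B}
    (hp : ContMDiff (𝓡 4) (𝓡 3) ∞ p) (hE : IsAdaptedFrame p ξ g h E f x) :
    ∀ᶠ y in 𝓝 x, IsAdaptedFrame p ξ g h E f y := by
  filter_upwards [hE.frame.eventually, hE.related.eventually_nhds,
    hp.continuous.continuousAt.eventually hE.base.eventually] with y h1 h2 h3
  exact ⟨h1, h3, hE.vertical, h2⟩

lemma IsConformalSubmersion.exists_isAdaptedFrame (hp : IsConformalSubmersion C CB p)
    (hξ : IsTangentToFibres (n := 3) p ξ) (hgh : IsPullbackGauge p g h) {f : Fin 3 → VField 3 B}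
    (hf : IsFrameNear h.1 f (p x)) :
    ∃ E : Fin 4 → VField 4 M, IsAdaptedFrame p ξ g h E f x := by
  choose L hL hL' using fun (y : M) (w : TangentSpace (𝓡 3) (p y)) => hp.exists_lift hξ g y w
  have hsm : ∀ i, SmoothNear (fun y => L y (f i (p y))) x := by
    intro i
    obtain ⟨e, he⟩ := exists_isOrthonormalFrame g.1 x
    obtain ⟨E, -, hE, ho⟩ := he.exists_extension
    refine smoothNear_of_frame hE ho fun a => ?_
    -- The lifts `L` are chosen pointwise; their components in a smooth frame are g(L f_i, E_a) =
    -- h(dp E_a, f_i), which no longer involve the choice and are visibly smooth.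
    have e1 : ∀ y, g.1.inner y (L y (f i (p y))) (E a y)
        = h.1.inner (p y) (mfderiv (𝓡 4) (𝓡 3) p y (E a y)) (f i (p y)) := by
      intro y
      rw [g.1.symm, ← hgh.inner_eq hξ _ (hL' y (f i (p y))), hL]
    refine FnSmoothNear.congr ?_ (Filter.Eventually.of_forall e1)
    filter_upwards [hE a, hp.smooth.continuous.continuousAt.eventually (hf.smooth i)] with y hy h2
    exact contMDiffAt_metric h.1 (contMDiffAt_mfderiv_apply hy hp.smooth.contMDiffAt)
      (ContMDiffAt.comp y h2 hp.smooth.contMDiffAt)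
  let E : Fin 4 → VField 4 M := Fin.cons (ξ.field g) fun i y => L y (f i (p y))
  have E0 : E 0 = ξ.field g := rfl
  have Es : ∀ (i : Fin 3), E i.succ = fun y => L y (f i (p y)) := fun i => rfl
  refine ⟨E, ⟨⟨fun a => ?_, ?_⟩, hf, E0, ?_⟩⟩
  · refine Fin.cases ?_ (fun i => ?_) a
    · rw [E0]; exact Filter.Eventually.of_forall fun y => ξ.smooth g y
    · rw [Es]; exact hsm i
  · filter_upwards [hp.smooth.continuous.continuousAt.eventually hf.orthonormal] with y hy
    intro a b
    change g.1.inner y (E a y) (E b y) = _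
    refine Fin.cases (Fin.cases ?_ (fun j => ?_) b) (fun i => Fin.cases ?_ (fun j => ?_) b) a
    · rw [E0, ξ.unit, if_pos rfl]
    · rw [E0, Es, hL', if_neg (Fin.succ_ne_zero j).symm]
    · rw [E0, Es, g.1.symm, hL', if_neg (Fin.succ_ne_zero i)]
    · rw [Es, Es, ← hgh.inner_eq hξ _ (hL' y _), hL, hL, hy i j]
      simp
  · exact Filter.Eventually.of_forall fun y i => hL y _

/-- Reversing one leg of the base frame reverses the orientation of the adapted frame above it. -/
lemma IsFrameNear.flip {n : ℕ} {N : Type*} [TopologicalSpace N] [ChartedSpace (Model n) N]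
    [IsManifold (𝓡 n) ∞ N] {g : Metric n N} {E : Fin n → VField n N} {x : N}
    (hE : IsFrameNear g E x) (i : Fin n) : IsFrameNear g (Function.update E i (-E i)) x := by
  constructor
  · intro j
    by_cases hj : j = i
    · subst hj
      rw [Function.update_self]
      filter_upwards [hE.smooth j] with y hy using hy.neg_section
    · rw [Function.update_of_ne hj]; exact hE.smooth j
  · filter_upwards [hE.orthonormal] with y hy
    intro j k
    have := hy j k
    change g.inner y (E j y) (E k y) = _ at this
    change g.inner y (Function.update E i (-E i) j y) (Function.update E i (-E i) k y) = _
    by_cases hj : j = i <;> by_cases hk : k = i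
    · subst hj; subst hk; simpa using this
    · subst hj
      rw [Function.update_self, Function.update_of_ne hk, if_neg (Ne.symm hk)]
      rw [if_neg (Ne.symm hk)] at this
      simp [this]
    · subst hk
      rw [Function.update_self, Function.update_of_ne hj, if_neg hj]
      rw [if_neg hj] at this
      simp [this]
    · rw [Function.update_of_ne hj, Function.update_of_ne hk, this]

/-- There are positively oriented adapted frames near every point. -/
lemma IsConformalSubmersion.exists_isAdaptedFrame_oriented (hp : IsConformalSubmersion C CB p)
    (hξ : IsTangentToFibres (n := 3) p ξ) (hgh : IsPullbackGauge p g h) (o : OrientationForm 4 M)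
    (x : M) : ∃ (E : Fin 4 → VField 4 M) (f : Fin 3 → VField 3 B),
      IsAdaptedFrame p ξ g h E f x ∧ 0 < o.form x (fun a => E a x) := by
  obtain ⟨e, he⟩ := exists_isOrthonormalFrame h.1 (p x)
  obtain ⟨f, -, hf, ho⟩ := he.exists_extension
  have hfr : IsFrameNear h.1 f (p x) := ⟨hf, ho⟩
  obtain ⟨E, hE⟩ := hp.exists_isAdaptedFrame hξ hgh hfr
  obtain ⟨E', hE'⟩ := hp.exists_isAdaptedFrame hξ hgh (hfr.flip 0)
  have h0 : o.form x (fun a => E a x) ≠ 0 := by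
    intro h0
    -- An alternating form vanishing on one basis is zero, so the orientation form has a definite
    -- sign on `E`.
    refine o.ne_zero x (hE.frame.at.basis.ext_alternating fun v hv => ?_)
    obtain ⟨σ, rfl⟩ : ∃ σ : Equiv.Perm (Fin 4), v = σ :=
      ⟨Equiv.ofBijective v (Finite.injective_iff_bijective.1 hv), rfl⟩
    have : (fun i => hE.frame.at.basis (σ i)) = (fun a => E a x) ∘ σ := by
      funext i; simp [IsOrthonormalFrame.basis_apply]
    rw [this, AlternatingMap.map_perm, h0]
    simp
  rcases lt_or_gt_of_ne h0 with h0 | h0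
  · refine ⟨E', _, hE', ?_⟩
    -- If `E` is negative, use the frame over the flipped base frame. Leg 0 of the base frame lifts
    -- to leg 1, and at `x` the two frames differ only in the sign of that leg.
    have hup : (fun a => E' a x) = Function.update (fun a => E a x) 1 (- E 1 x) := by
      have hr := hE.related.self_of_nhds
      have hr' := hE'.related.self_of_nhds
      have z : ∀ {E : Fin 4 → VField 4 M} {f : Fin 3 → VField 3 B},
          IsAdaptedFrame p ξ g h E f x → ∀ i : Fin 3,
          g.1.inner x (ξ.field g x) (E i.succ x) = 0 := by
        intro E f hE i
        have := hE.frame.at 0 i.succ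
        change g.1.inner x (E 0 x) (E i.succ x) = _ at this
        rwa [hE.vertical, if_neg (Fin.succ_ne_zero i).symm] at this
      funext a
      refine Fin.cases ?_ (fun i => ?_) a
      · rw [Function.update_of_ne (by decide), hE.vertical, hE'.vertical]
      · by_cases hi : i = 0
        · subst hi
          refine hξ.eq_of_mfderiv_eq (g := g) ?_ ?_
          · rw [hr' 0]
            simp only [Fin.succ_zero_eq_one, Function.update_self, map_neg]
            rw [show (1 : Fin 4) = Fin.succ 0 from rfl, hr 0]; rfl
          · rw [z hE']
            simp only [Fin.succ_zero_eq_one, Function.update_self, map_neg]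
            rw [show (1 : Fin 4) = Fin.succ 0 from rfl, z hE]; simp
        · have h1 : i.succ ≠ (1 : Fin 4) := by
            exact fun h => hi (Fin.succ_injective _ h)
          refine hξ.eq_of_mfderiv_eq (g := g) ?_ ?_
          · rw [Function.update_of_ne h1, hr' i, hr i, Function.update_of_ne hi]
          · rw [Function.update_of_ne h1, z hE, z hE']
    rw [hup, AlternatingMap.map_update_neg]
    simpa using h0
  · exact ⟨E, f, hE, h0⟩

end ConformalSubmersions

/-! ### Structure functions, minimality and twist in an adapted frame. -/

section AdaptedFrames

variable {M B : Type*} [TopologicalSpace M] [ChartedSpace (Model 4) M] [IsManifold (𝓡 4) ∞ M]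
  [TopologicalSpace B] [ChartedSpace (Model 3) B] [IsManifold (𝓡 3) ∞ B]
  {C : ConformalStructure 4 M} {CB : ConformalStructure 3 B} {p : M → B} {ξ : Congruence C}
  {g : C.Gauge} {h : CB.Gauge} {E : Fin 4 → VField 4 M} {f : Fin 3 → VField 3 B} {x : M}

lemma IsFrameNear.inner {n : ℕ} {N : Type*} [TopologicalSpace N] [ChartedSpace (Model n) N]
    [IsManifold (𝓡 n) ∞ N] {g : Metric n N} {E : Fin n → VField n N} {x : N}
    (hE : IsFrameNear g E x) (a b : Fin n) :
    g.inner x (E a x) (E b x) = if a = b then 1 else 0 := hE.at a b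

lemma IsAdaptedFrame.field_eq (hE : IsAdaptedFrame p ξ g h E f x) (y : M) :
    E 0 y = ξ.field g y := by rw [hE.vertical]

lemma IsAdaptedFrame.mfderiv_zero (hE : IsAdaptedFrame p ξ g h E f x)
    (hξ : IsTangentToFibres (n := 3) p ξ) (y : M) : mfderiv (𝓡 4) (𝓡 3) p y (E 0 y) = 0 := by
  rw [hE.field_eq, hξ.mfderiv_field]

lemma IsAdaptedFrame.mfderiv_succ (hE : IsAdaptedFrame p ξ g h E f x) (i : Fin 3) :
    mfderiv (𝓡 4) (𝓡 3) p x (E i.succ x) = f i (p x) := hE.related.self_of_nhds i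

lemma IsAdaptedFrame.inner_succ (hE : IsAdaptedFrame p ξ g h E f x)
    (hξ : IsTangentToFibres (n := 3) p ξ) (hgh : IsPullbackGauge p g h)
    (u : TangentSpace (𝓡 4) x) (i : Fin 3) : g.1.inner x u (E i.succ x)
      = h.1.inner (p x) (mfderiv (𝓡 4) (𝓡 3) p x u) (f i (p x)) := by
  rw [← hgh.inner_eq hξ, hE.mfderiv_succ]
  rw [← hE.field_eq, hE.frame.inner, if_neg (Fin.succ_ne_zero i).symm]

/-- `E 0` is related to the zero field and `E i.succ` to `f i`, so their bracket is vertical. -/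
lemma IsAdaptedFrame.structFn_zero_succ (hE : IsAdaptedFrame p ξ g h E f x)
    (hp : ContMDiff (𝓡 4) (𝓡 3) ∞ p) (hξ : IsTangentToFibres (n := 3) p ξ)
    (hgh : IsPullbackGauge p g h) (i k : Fin 3) : structFn g.1 E 0 i.succ k.succ x = 0 := by
  have h0 : SmoothNear (0 : VField 3 B) (p x) :=
    Filter.Eventually.of_forall fun y => contMDiff_zeroSection _ _ y
  have := mfderiv_mlieBracket hp (hE.frame.smooth 0) (hE.frame.smooth i.succ) h0 (hE.base.smooth i)
    (Filter.Eventually.of_forall fun y => hE.mfderiv_zero hξ y) (hE.related.mono fun y hy => hy i)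
  rw [structFn, hE.inner_succ hξ hgh, this]
  simp

lemma IsAdaptedFrame.structFn_succ (hE : IsAdaptedFrame p ξ g h E f x)
    (hp : ContMDiff (𝓡 4) (𝓡 3) ∞ p) (hξ : IsTangentToFibres (n := 3) p ξ)
    (hgh : IsPullbackGauge p g h) (i j k : Fin 3) :
    structFn g.1 E i.succ j.succ k.succ x = structFn h.1 f i j k (p x) := by
  have := mfderiv_mlieBracket hp (hE.frame.smooth i.succ) (hE.frame.smooth j.succ)
    (hE.base.smooth i) (hE.base.smooth j)
    (hE.related.mono fun y hy => hy i) (hE.related.mono fun y hy => hy j)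
  rw [structFn, hE.inner_succ hξ hgh, this]
  rfl

lemma IsAdaptedFrame.dir_zero (hE : IsAdaptedFrame p ξ g h E f x)
    (hp : ContMDiff (𝓡 4) (𝓡 3) ∞ p) (hξ : IsTangentToFibres (n := 3) p ξ) {F : B → ℝ}
    (hF : FnSmoothNear (n := 3) F (p x)) : dir (E 0) (fun y => F (p y)) x = 0 := by
  rw [dir_comp_map hp hF (V' := 0) (hE.mfderiv_zero hξ x)]
  simp [dir]

lemma IsAdaptedFrame.dir_succ (hE : IsAdaptedFrame p ξ g h E f x)
    (hp : ContMDiff (𝓡 4) (𝓡 3) ∞ p) (i : Fin 3) {F : B → ℝ}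
    (hF : FnSmoothNear (n := 3) F (p x)) :
    dir (E i.succ) (fun y => F (p y)) x = dir (f i) F (p x) :=
  dir_comp_map hp hF (hE.mfderiv_succ i)

variable {D0 : WeylDerivative C} {o : OrientationForm 4 M}

lemma inner_derivCongruence (h0 : E 0 = ξ.field g) (hE : IsFrameNear g.1 E x) (a b : Fin 4) :
    g.1.inner x (D0.derivCongruence g x ξ (E a x)) (E b x)
      = connFn D0.conn g.1 E a 0 b x - D0.form g x (E a x) * if 0 = b then 1 else 0 := by
  simp only [WeylDerivative.derivCongruence, sub_apply, map_sub,
    ContinuousLinearMap.smulRight_apply, map_smul, smul_apply, smul_eq_mul, ← h0, hE.inner]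
  rfl

lemma trace_eq_sum_inner {n : ℕ} {N : Type*} [TopologicalSpace N] [ChartedSpace (Model n) N]
    [IsManifold (𝓡 n) ∞ N] {g : Metric n N} {x : N} {e : Fin n → TangentSpace (𝓡 n) x}
    (he : IsOrthonormalFrame g x e) (T : TangentSpace (𝓡 n) x →ₗ[ℝ] TangentSpace (𝓡 n) x) :
    LinearMap.trace ℝ _ T = ∑ i, g.inner x (T (e i)) (e i) := by
  rw [LinearMap.trace_eq_matrix_trace ℝ he.basis, Matrix.trace]
  refine Finset.sum_congr rfl fun i _ => ?_
  rw [Matrix.diag_apply, LinearMap.toMatrix_apply, he.basis_apply]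
  conv_rhs => rw [← he.basis.sum_repr (T (e i))]
  simp [he _ i]

/-- In the trace of D⁰ξ, each of the three horizontal directions contributes α(E_0) by the Koszul
formula, the structure functions involved being zero, while the vertical direction contributes
nothing. The vanishing trace is therefore 3 α(E_0). -/
lemma IsAdaptedFrame.form_zero (hE : IsAdaptedFrame p ξ g h E f x)
    (hp : ContMDiff (𝓡 4) (𝓡 3) ∞ p) (hξ : IsTangentToFibres (n := 3) p ξ)
    (hgh : IsPullbackGauge p g h) (hD0 : D0.IsMinimal ξ) : D0.form g x (E 0 x) = 0 := by
  have h1 := (hD0 g x).2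
  have s : ∀ i : Fin 3, structFn g.1 E i.succ 0 i.succ x = 0 := fun i => by
    rw [structFn_swap, hE.structFn_zero_succ hp hξ hgh, neg_zero]
  have s' : ∀ i : Fin 3, structFn g.1 E i.succ i.succ 0 x = 0 := fun i => by
    linarith [structFn_swap (g := g.1) (E := E) (x := x) i.succ i.succ 0]
  rw [trace_eq_sum_inner hE.frame.at] at h1
  simp only [ContinuousLinearMap.coe_coe, inner_derivCongruence hE.vertical hE.frame] at h1
  simp only [Fin.sum_univ_succ (n := 3), D0.connFn_eq hE.frame, s, s',
    hE.structFn_zero_succ hp hξ hgh] at h1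
  simp [Fin.succ_ne_zero, (Fin.succ_ne_zero _).symm] at h1
  have s0 : structFn g.1 E 0 0 0 x = 0 := by
    linarith [structFn_swap (g := g.1) (E := E) (x := x) 0 0 0]
  linarith

/-- D⁰_ξ ξ = 0, paired with `E i.succ`, reads -c_0i0 - α_i = 0 by the Koszul formula. -/
lemma IsAdaptedFrame.structFn_zero_zero (hE : IsAdaptedFrame p ξ g h E f x)
    (hD0 : D0.IsMinimal ξ) (i : Fin 3) :
    structFn g.1 E 0 i.succ 0 x = - D0.form g x (E i.succ x) := by
  have h1 := (hD0 g x).1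
  have h2 := inner_derivCongruence (D0 := D0) hE.vertical hE.frame 0 i.succ
  rw [hE.field_eq, h1, D0.connFn_eq hE.frame] at h2
  have s : structFn g.1 E 0 0 i.succ x = 0 := by
    linarith [structFn_swap (g := g.1) (E := E) (x := x) 0 0 i.succ]
  rw [s, structFn_swap i.succ 0 0] at h2
  simp [(Fin.succ_ne_zero _).symm] at h2
  linarith

lemma IsAdaptedFrame.extDeriv_succ (hE : IsAdaptedFrame p ξ g h E f x)
    (hp : ContMDiff (𝓡 4) (𝓡 3) ∞ p) (hξ : IsTangentToFibres (n := 3) p ξ)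
    (hgh : IsPullbackGauge p g h) (i j : Fin 3) :
    D0.extDerivCongruence g x ξ (E i.succ x) (E j.succ x)
      = - structFn g.1 E i.succ j.succ 0 x := by
  simp only [WeylDerivative.extDerivCongruence, inner_derivCongruence hE.vertical hE.frame,
    D0.connFn_eq hE.frame]
  have e1 := structFn_swap (g := g.1) (E := E) (x := x) i.succ 0 j.succ
  have e2 := structFn_swap (g := g.1) (E := E) (x := x) j.succ 0 i.succ
  have e3 := structFn_swap (g := g.1) (E := E) (x := x) j.succ i.succ 0
  simp only [e1, e2, e3, hE.structFn_zero_succ hp hξ hgh, if_neg (Fin.succ_ne_zero _).symm,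
    if_neg (Fin.succ_ne_zero _), eq_comm (a := j.succ) (b := i.succ)]
  ring

lemma WeylDerivative.extDerivCongruence_swap (D : WeylDerivative C) (v w : TangentSpace (𝓡 4) x) :
    D.extDerivCongruence g x ξ w v = - D.extDerivCongruence g x ξ v w := by
  simp only [WeylDerivative.extDerivCongruence]; ring

lemma WeylDerivative.isLinearMap_extDerivCongruence₁ (D : WeylDerivative C)
    (w : TangentSpace (𝓡 4) x) :
    IsLinearMap ℝ (fun v => D.extDerivCongruence g x ξ v w) := by
  constructor <;> intros <;> simp only [WeylDerivative.extDerivCongruence, map_add, map_smul,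
    add_apply, smul_apply, smul_eq_mul] <;> ring

lemma WeylDerivative.isLinearMap_extDerivCongruence₂ (D : WeylDerivative C)
    (v : TangentSpace (𝓡 4) x) :
    IsLinearMap ℝ (D.extDerivCongruence g x ξ v) := by
  constructor <;> intros <;> simp only [WeylDerivative.extDerivCongruence, map_add, map_smul,
    add_apply, smul_apply, smul_eq_mul] <;> ring

lemma WeylDerivative.isLinearMap_twistForm (D : WeylDerivative C)
    (e : Fin 4 → TangentSpace (𝓡 4) x) : IsLinearMap ℝ (D.twistForm o ξ g x e) := by
  have := isLinearMap_hodgeStar₂ (o := o) e (D.extDerivCongruence g x ξ) (ξ.field g x)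
  constructor <;> intros <;> simp only [twistForm, this.map_add, this.map_smul, neg_add, smul_neg]

/-- The twist form does not depend on the choice of the frame. -/
lemma WeylDerivative.twistForm_eq (D : WeylDerivative C) {e e' : Fin 4 → TangentSpace (𝓡 4) x}
    (he : IsOrientedFrame g.1 o x e) (he' : IsOrientedFrame g.1 o x e')
    (v : TangentSpace (𝓡 4) x) : D.twistForm o ξ g x e' v = D.twistForm o ξ g x e v := by
  rw [twistForm, twistForm, hodgeStar_eq_of_conformal one_pos he he' (by simp)
    D.isLinearMap_extDerivCongruence₁ D.isLinearMap_extDerivCongruence₂]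

lemma IsAdaptedFrame.twistForm_zero (hE : IsAdaptedFrame p ξ g h E f x)
    (e : Fin 4 → TangentSpace (𝓡 4) x) : D0.twistForm o ξ g x e (E 0 x) = 0 := by
  rw [WeylDerivative.twistForm, hE.field_eq]
  linarith [hodgeStar_swap (o := o) e (D0.extDerivCongruence g x ξ) (ξ.field g x) (ξ.field g x)]

/-- The twist form in an oriented adapted frame. -/
lemma IsAdaptedFrame.twistForm_succ (hE : IsAdaptedFrame p ξ g h E f x)
    (hp : ContMDiff (𝓡 4) (𝓡 3) ∞ p) (hξ : IsTangentToFibres (n := 3) p ξ)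
    (hgh : IsPullbackGauge p g h) (ho : 0 < o.form x (fun a => E a x))
    {e : Fin 4 → TangentSpace (𝓡 4) x} (he : IsOrientedFrame g.1 o x e) :
    D0.twistForm o ξ g x e (E 1 x) = - structFn g.1 E 2 3 0 x ∧
    D0.twistForm o ξ g x e (E 2 x) = - structFn g.1 E 3 1 0 x ∧
    D0.twistForm o ξ g x e (E 3 x) = - structFn g.1 E 1 2 0 x := by
  have key := D0.twistForm_eq (ξ := ξ) (o := o) ⟨hE.frame.at, ho⟩ he
  rw [key, key, key]
  simp only [WeylDerivative.twistForm]
  obtain ⟨h1, -, h2, -, h3, -⟩ := hodgeStar_frame (o := o) (e := fun a => E a x) ho.ne'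
    (α := D0.extDerivCongruence g x ξ) (fun v w => D0.extDerivCongruence_swap v w)
  rw [← hE.field_eq, h1, h2, h3, neg_neg, neg_neg, neg_neg]
  exact ⟨hE.extDeriv_succ hp hξ hgh 1 2, hE.extDeriv_succ hp hξ hgh 2 0,
    hE.extDeriv_succ hp hξ hgh 0 1⟩

end AdaptedFrames

/-! ### The antiselfdual curvature of a connection in terms of its antiselfdual coefficients. -/

section AsdAlgebra

/-- The antiselfdual part of the second structure equation. -/
lemma asdComp_curvature {Γ : Fin 4 → Fin 4 → Fin 4 → ℝ} {φ : Fin 4 → ℝ}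
    (hΓ : ∀ a c d, Γ a c d + Γ a d c = 2 * φ a * if c = d then 1 else 0)
    (dΓ : Fin 4 → Fin 4 → Fin 4 → Fin 4 → ℝ) (s : Fin 4 → Fin 4 → Fin 4 → ℝ) (a b : Fin 4)
    (J : Fin 3) :
    asdComp (fun c d => dΓ a b c d - dΓ b a c d
      + ∑ f, (Γ b c f * Γ a f d - Γ a c f * Γ b f d - s a b f * Γ f c d)) J
      = asdComp (dΓ a b) J - asdComp (dΓ b a) J
        + (asdComp (Γ b) (J + 2) * asdComp (Γ a) (J + 1)
          - asdComp (Γ b) (J + 1) * asdComp (Γ a) (J + 2)) - ∑ f, s a b f * asdComp (Γ f) J := by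
  have d : ∀ a c, Γ a c c = φ a := fun a c => by
    have := hΓ a c c; simp at this; linarith
  have sk : ∀ a c d, c ≠ d → Γ a d c = - Γ a c d := fun a c d h => by
    have := hΓ a c d; simp [h] at this; linarith
  have s10 := fun a => sk a 0 1 (by decide)
  have s20 := fun a => sk a 0 2 (by decide)
  have s30 := fun a => sk a 0 3 (by decide)
  have s21 := fun a => sk a 1 2 (by decide)
  have s31 := fun a => sk a 1 3 (by decide)
  have s32 := fun a => sk a 2 3 (by decide)
  clear sk hΓ
  -- The diagonal of each Γ a is the scalar φ a, which commutes with everything, and so(4) splits as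
  -- so(3) ⊕ so(3). So the quadratic terms reduce to a vector product of antiselfdual components.
  -- Indices in `Fin 3` are cyclic.
  fin_cases J <;>
  simp only [Fin.zero_eta, Fin.mk_one, Fin.reduceFinMk, Fin.reduceAdd, zero_add, asdComp,
    Matrix.cons_val, Fin.sum_univ_four, d, s10, s20, s30, s21, s31, s32] <;> ring

/-- The 1-form (γ₀, γ) enters the coefficients so that its first derivatives give a skew matrix plus
a multiple of the identity, and so do its products with itself and with the remaining data. For the
bracket terms this depends on A: the contribution of `s` through c_0l0 = -(A l - s l) cancels the
one through c_jk0 = -s l, leaving only A. The five symmetric tracefree components of N and K are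
then equal, not merely zero together. -/
lemma symTracefreeVanishes_asd_iff {γ₀ : ℝ} {γ : Fin 3 → ℝ} {dγ₀ : Fin 4 → ℝ}
    {dγ : Fin 4 → Fin 3 → ℝ} {G : Fin 3 → Fin 3 → Fin 3 → ℝ}
    {dG : Fin 3 → Fin 3 → Fin 3 → Fin 3 → ℝ} {A s : Fin 3 → ℝ}
    {Γ : Fin 3 → Fin 4 → ℝ} {dΓ : Fin 4 → Fin 3 → Fin 4 → ℝ} {c : Fin 4 → Fin 4 → Fin 4 → ℝ}
    {N K : Fin 3 → Fin 3 → ℝ}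
    (hG : ∀ a j k, G a j k + G a k j = 2 * A a * if j = k then 1 else 0)
    (hΓ0 : ∀ J, Γ J 0 = - γ J)
    (hΓ : ∀ J l, Γ J l.succ = G l (J + 1) (J + 2) + γ (J + 1) * (if l = J + 2 then 1 else 0)
      - γ (J + 2) * (if l = J + 1 then 1 else 0) + γ₀ * if l = J then 1 else 0)
    (hdΓ0 : ∀ a J, dΓ a J 0 = - dγ a J)
    (hdΓ : ∀ J l, dΓ 0 J l.succ = dγ 0 (J + 1) * (if l = J + 2 then 1 else 0)
      - dγ 0 (J + 2) * (if l = J + 1 then 1 else 0) + dγ₀ 0 * if l = J then 1 else 0)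
    (hdΓs : ∀ m J l, dΓ m.succ J l.succ = dG m l (J + 1) (J + 2)
      + dγ m.succ (J + 1) * (if l = J + 2 then 1 else 0)
      - dγ m.succ (J + 2) * (if l = J + 1 then 1 else 0) + dγ₀ m.succ * if l = J then 1 else 0)
    (hc : ∀ l k : Fin 3, c 0 l.succ k.succ = 0) (hc0 : ∀ l : Fin 3, c 0 l.succ 0 = - (A l - s l))
    (hcs : ∀ l m k : Fin 3, c l.succ m.succ k.succ = G l m k - G m l k)
    (hs : ∀ l : Fin 3, c (l + 1).succ (l + 2).succ 0 = - s l)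
    (hN : ∀ I J, N I J = asdComp (fun a b => dΓ a J b - dΓ b J a
      + (Γ (J + 2) b * Γ (J + 1) a - Γ (J + 1) b * Γ (J + 2) a) - ∑ f, c a b f * Γ J f) I)
    (hK : ∀ I J, K I J = dG (I + 1) (I + 2) (J + 1) (J + 2) - dG (I + 2) (I + 1) (J + 1) (J + 2)
      + ∑ f, (G (I + 2) (J + 1) f * G (I + 1) f (J + 2) - G (I + 1) (J + 1) f * G (I + 2) f (J + 2)
        - (G (I + 1) (I + 2) f - G (I + 2) (I + 1) f) * G f (J + 1) (J + 2))) :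
    SymTracefreeVanishes N ↔ SymTracefreeVanishes K := by
  have d : ∀ a c, G a c c = A a := fun a c => by
    have := hG a c c; simp at this; linarith
  have sk : ∀ a c d, c ≠ d → G a d c = - G a c d := fun a c d h => by
    have := hG a c d; simp [h] at this; linarith
  have s10 := fun a => sk a 0 1 (by decide)
  have s02 := fun a => sk a 2 0 (by decide)
  have s21 := fun a => sk a 1 2 (by decide)
  have g1 : ∀ J, Γ J 1 = _ := fun J => hΓ J 0
  have g2 : ∀ J, Γ J 2 = _ := fun J => hΓ J 1
  have g3 : ∀ J, Γ J 3 = _ := fun J => hΓ J 2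
  have d1 : ∀ J, dΓ 0 J 1 = _ := fun J => hdΓ J 0
  have d2 : ∀ J, dΓ 0 J 2 = _ := fun J => hdΓ J 1
  have d3 : ∀ J, dΓ 0 J 3 = _ := fun J => hdΓ J 2
  have d23 : ∀ J, dΓ 2 J 3 = _ := fun J => hdΓs 1 J 2
  have d32 : ∀ J, dΓ 3 J 2 = _ := fun J => hdΓs 2 J 1
  have d31 : ∀ J, dΓ 3 J 1 = _ := fun J => hdΓs 2 J 0
  have d13 : ∀ J, dΓ 1 J 3 = _ := fun J => hdΓs 0 J 2
  have d12 : ∀ J, dΓ 1 J 2 = _ := fun J => hdΓs 0 J 1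
  have d21 : ∀ J, dΓ 2 J 1 = _ := fun J => hdΓs 1 J 0
  have u10 : c 0 1 0 = _ := hc0 0
  have u20 : c 0 2 0 = _ := hc0 1
  have u30 : c 0 3 0 = _ := hc0 2
  have u11 : c 0 1 1 = 0 := hc 0 0
  have u12 : c 0 1 2 = 0 := hc 0 1
  have u13 : c 0 1 3 = 0 := hc 0 2
  have u21 : c 0 2 1 = 0 := hc 1 0
  have u22 : c 0 2 2 = 0 := hc 1 1
  have u23 : c 0 2 3 = 0 := hc 1 2
  have u31 : c 0 3 1 = 0 := hc 2 0
  have u32 : c 0 3 2 = 0 := hc 2 1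
  have u33 : c 0 3 3 = 0 := hc 2 2
  have v0 : c 2 3 0 = - s 0 := hs 0
  have v1 : c 3 1 0 = - s 1 := hs 1
  have v2 : c 1 2 0 = - s 2 := hs 2
  have w01 : c 2 3 1 = _ := hcs 1 2 0
  have w02 : c 2 3 2 = _ := hcs 1 2 1
  have w03 : c 2 3 3 = _ := hcs 1 2 2
  have w11 : c 3 1 1 = _ := hcs 2 0 0
  have w12 : c 3 1 2 = _ := hcs 2 0 1
  have w13 : c 3 1 3 = _ := hcs 2 0 2
  have w21 : c 1 2 1 = _ := hcs 0 1 0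
  have w22 : c 1 2 2 = _ := hcs 0 1 1
  have w23 : c 1 2 3 = _ := hcs 0 1 2
  have z1 : Fin.succ (0 : Fin 3) = 1 := rfl
  have z2 : Fin.succ (1 : Fin 3) = 2 := rfl
  have z3 : Fin.succ (2 : Fin 3) = 3 := rfl
  have key : N 0 1 + N 1 0 = K 0 1 + K 1 0 ∧ N 1 2 + N 2 1 = K 1 2 + K 2 1 ∧
      N 2 0 + N 0 2 = K 2 0 + K 0 2 ∧ N 0 0 - N 1 1 = K 0 0 - K 1 1 ∧
      N 1 1 - N 2 2 = K 1 1 - K 2 2 := by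
    simp only [hN, hK, asdComp, Matrix.cons_val, Fin.reduceAdd, zero_add, Fin.sum_univ_four,
      Fin.sum_univ_three, g1, g2, g3, hΓ0, hdΓ0, d1, d2, d3, d23, d32, d31, d13, d12, d21, u10, u20,
      u30, u11, u12, u13, u21, u22, u23, u31, u32, u33, v0, v1, v2, w01, w02, w03, w11, w12, w13,
      w21, w22, w23, d, s10, s02, s21, z1, z2, z3, Fin.reduceEq, if_true, if_false, Fin.isValue]
    refine ⟨?_, ?_, ?_, ?_, ?_⟩ <;> ring
  obtain ⟨k1, k2, k3, k4, k5⟩ := key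
  simp only [SymTracefreeVanishes, k1, k2, k3]
  rw [← sub_eq_zero (a := N 0 0), ← sub_eq_zero (a := N 1 1), k4, k5, sub_eq_zero, sub_eq_zero]

end AsdAlgebra

/-! ### Antiselfdual connection coefficients over the base. -/

section AsdKoszul

/-- The purely horizontal structure functions give the coefficients of the base connection. Koszul's
formula halves the vertical components -s of horizontal brackets, while A = α + s carries all of
`s`; comparing the two leaves the same combination φ - α - s/2 in every component. -/
lemma asdComp_koszul {c : Fin 4 → Fin 4 → Fin 4 → ℝ} {φ : Fin 4 → ℝ}
    {cB : Fin 3 → Fin 3 → Fin 3 → ℝ} {A α s : Fin 3 → ℝ} {Γ : Fin 4 → Fin 4 → Fin 4 → ℝ}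
    {G : Fin 3 → Fin 3 → Fin 3 → ℝ} (hsw : ∀ a b d, c a b d = - c b a d)
    (h0 : ∀ l k : Fin 3, c 0 l.succ k.succ = 0) (h00 : ∀ l : Fin 3, c 0 l.succ 0 = - α l)
    (hc : ∀ l m k : Fin 3, c l.succ m.succ k.succ = cB l m k)
    (hs : ∀ l : Fin 3, c (l + 1).succ (l + 2).succ 0 = - s l) (hA : ∀ l, A l = α l + s l)
    (hΓ : ∀ a b d, Γ a b d = (c a b d - c b d a + c d a b) / 2 + φ a * (if b = d then 1 else 0)
      + φ b * (if a = d then 1 else 0) - φ d * (if a = b then 1 else 0))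
    (hG : ∀ a b d, G a b d = (cB a b d - cB b d a + cB d a b) / 2
      + A a * (if b = d then 1 else 0) + A b * (if a = d then 1 else 0)
      - A d * (if a = b then 1 else 0)) :
    (∀ J, asdComp (Γ 0) J = - (φ J.succ - α J - s J / 2)) ∧
    ∀ J l, asdComp (Γ l.succ) J = G l (J + 1) (J + 2)
      + (φ (J + 1).succ - α (J + 1) - s (J + 1) / 2) * (if l = J + 2 then 1 else 0)
      - (φ (J + 2).succ - α (J + 2) - s (J + 2) / 2) * (if l = J + 1 then 1 else 0)
      + φ 0 * if l = J then 1 else 0 := by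
  have z : ∀ a d, c a a d = 0 := fun a d => by linarith [hsw a a d]
  have r10 := hsw 1 0
  have r20 := hsw 2 0
  have r30 := hsw 3 0
  have r21 := hsw 2 1
  have r32 := hsw 3 2
  have r13 := hsw 1 3
  have t10 : c 0 1 0 = _ := h00 0
  have t20 : c 0 2 0 = _ := h00 1
  have t30 : c 0 3 0 = _ := h00 2
  have u11 : c 0 1 1 = 0 := h0 0 0
  have u12 : c 0 1 2 = 0 := h0 0 1
  have u13 : c 0 1 3 = 0 := h0 0 2
  have u21 : c 0 2 1 = 0 := h0 1 0
  have u22 : c 0 2 2 = 0 := h0 1 1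
  have u23 : c 0 2 3 = 0 := h0 1 2
  have u31 : c 0 3 1 = 0 := h0 2 0
  have u32 : c 0 3 2 = 0 := h0 2 1
  have u33 : c 0 3 3 = 0 := h0 2 2
  have v0 : c 2 3 0 = - s 0 := hs 0
  have v1 : c 3 1 0 = - s 1 := hs 1
  have v2 : c 1 2 0 = - s 2 := hs 2
  have w01 : c 2 3 1 = _ := hc 1 2 0
  have w02 : c 2 3 2 = _ := hc 1 2 1
  have w03 : c 2 3 3 = _ := hc 1 2 2
  have w11 : c 3 1 1 = _ := hc 2 0 0
  have w12 : c 3 1 2 = _ := hc 2 0 1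
  have w13 : c 3 1 3 = _ := hc 2 0 2
  have w21 : c 1 2 1 = _ := hc 0 1 0
  have w22 : c 1 2 2 = _ := hc 0 1 1
  have w23 : c 1 2 3 = _ := hc 0 1 2
  have y : ∀ a b d, cB a b d = - cB b a d := fun a b d => by rw [← hc, ← hc, hsw]
  have y0 : ∀ a d, cB a a d = 0 := fun a d => by linarith [y a a d]
  have y1 := y 1 0
  have y2 := y 2 1
  have y3 := y 0 2
  have z1 : Fin.succ (0 : Fin 3) = 1 := rfl
  have z2 : Fin.succ (1 : Fin 3) = 2 := rfl
  have z3 : Fin.succ (2 : Fin 3) = 3 := rfl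
  clear y hc h0 h00 hs hsw
  constructor
  · intro J
    fin_cases J <;>
    simp only [asdComp, Matrix.cons_val, Fin.zero_eta, Fin.mk_one, Fin.reduceFinMk, Fin.reduceAdd,
      zero_add, hΓ, z, r10, r20, r30, r21, r32, r13, t10, t20, t30, u11, u12, u13, u21, u22, u23,
      u31, u32, u33, v0, v1, v2, w01, w02, w03, w11, w12, w13, w21, w22, w23, y0, y1, y2, y3, z1,
      z2, z3, Fin.reduceEq, if_true, if_false, Fin.isValue] <;> ring
  · intro J l
    fin_cases J <;> fin_cases l <;>
    simp only [asdComp, Matrix.cons_val, Fin.zero_eta, Fin.mk_one, Fin.reduceFinMk, Fin.reduceAdd,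
      zero_add, hΓ, hG, hA, z, r10, r20, r30, r21, r32, r13, t10, t20, t30, u11, u12, u13, u21, u22,
      u23, u31, u32, u33, v0, v1, v2, w01, w02, w03, w11, w12, w13, w21, w22, w23, y0, y1, y2, y3,
      z1, z2, z3, Fin.reduceEq, if_true, if_false, Fin.isValue] <;> ring

end AsdKoszul

/-! ### Comparing the curvature of M with that of D^B. -/

section Comparison

variable {M B : Type*} [TopologicalSpace M] [ChartedSpace (Model 4) M] [IsManifold (𝓡 4) ∞ M]
  [TopologicalSpace B] [ChartedSpace (Model 3) B] [IsManifold (𝓡 3) ∞ B]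
  {C : ConformalStructure 4 M} {CB : ConformalStructure 3 B} {p : M → B} {ξ : Congruence C}
  {g : C.Gauge} {h : CB.Gauge} {E : Fin 4 → VField 4 M} {f : Fin 3 → VField 3 B} {x : M}
  {D0 : WeylDerivative C} {o : OrientationForm 4 M} {DB : WeylDerivative CB}

lemma eventually_form_pos (hE : ∀ a, SmoothNear (E a) x) (ho : 0 < o.form x (fun a => E a x)) :
    ∀ᶠ y in 𝓝 x, 0 < o.form y (fun a => E a y) :=
  (o.smooth x E fun a => (hE a).at).continuousAt.eventually (lt_mem_nhds ho)

/-- The components of the twist form in an adapted frame. -/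
def twistFn (g : C.Gauge) (E : Fin 4 → VField 4 M) (i : Fin 3) (y : M) : ℝ :=
  - structFn g.1 E (i + 1).succ (i + 2).succ 0 y

lemma IsAdaptedFrame.twistForm_eq_twistFn (hE : IsAdaptedFrame p ξ g h E f x)
    (hp : ContMDiff (𝓡 4) (𝓡 3) ∞ p) (hξ : IsTangentToFibres (n := 3) p ξ)
    (hgh : IsPullbackGauge p g h) (ho : 0 < o.form x (fun a => E a x))
    {e : Fin 4 → TangentSpace (𝓡 4) x} (he : IsOrientedFrame g.1 o x e) (i : Fin 3) :
    D0.twistForm o ξ g x e (E i.succ x) = twistFn g E i x := by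
  obtain ⟨h1, h2, h3⟩ := hE.twistForm_succ (D0 := D0) hp hξ hgh ho he
  fin_cases i
  · exact h1
  · exact h2
  · exact h3

lemma IsDescentOf.form_eq (hd : IsDescentOf o p ξ D0 DB) (hE : IsAdaptedFrame p ξ g h E f x)
    (hp : ContMDiff (𝓡 4) (𝓡 3) ∞ p) (hξ : IsTangentToFibres (n := 3) p ξ)
    (hgh : IsPullbackGauge p g h) (ho : 0 < o.form x (fun a => E a x)) (i : Fin 3) :
    DB.form h (p x) (f i (p x)) = D0.form g x (E i.succ x) + twistFn g E i x := by
  rw [← hE.mfderiv_succ, hd g h hgh x _ ⟨hE.frame.at, ho⟩,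
    hE.twistForm_eq_twistFn hp hξ hgh ho ⟨hE.frame.at, ho⟩]

/-- The antiselfdual part of the connection coefficients of a Weyl connection on `M` in an adapted
frame, in terms of the connection coefficients on `B`. -/
lemma IsDescentOf.asdComp_connFn (hd : IsDescentOf o p ξ D0 DB)
    (hE : IsAdaptedFrame p ξ g h E f x)
    (hp : ContMDiff (𝓡 4) (𝓡 3) ∞ p) (hξ : IsTangentToFibres (n := 3) p ξ)
    (hgh : IsPullbackGauge p g h) (hD0 : D0.IsMinimal ξ) (ho : 0 < o.form x (fun a => E a x))
    (D : WeylDerivative C) :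
    (∀ J, asdComp (fun c d => connFn D.conn g.1 E 0 c d x) J
      = - (D.form g x (E J.succ x) - D0.form g x (E J.succ x) - twistFn g E J x / 2)) ∧
    ∀ J l, asdComp (fun c d => connFn D.conn g.1 E l.succ c d x) J
      = connFn DB.conn h.1 f l (J + 1) (J + 2) (p x)
      + (D.form g x (E (J + 1).succ x) - D0.form g x (E (J + 1).succ x) - twistFn g E (J + 1) x / 2)
        * (if l = J + 2 then 1 else 0)
      - (D.form g x (E (J + 2).succ x) - D0.form g x (E (J + 2).succ x) - twistFn g E (J + 2) x / 2)
        * (if l = J + 1 then 1 else 0)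
      + D.form g x (E 0 x) * if l = J then 1 else 0 :=
  asdComp_koszul (c := fun a b d => structFn g.1 E a b d x) (φ := fun a => D.form g x (E a x))
    (cB := fun a b d => structFn h.1 f a b d (p x)) (A := fun i => DB.form h (p x) (f i (p x)))
    (α := fun i => D0.form g x (E i.succ x)) (s := fun i => twistFn g E i x)
    (Γ := fun a b d => connFn D.conn g.1 E a b d x)
    (G := fun a b d => connFn DB.conn h.1 f a b d (p x))
    (fun a b d => structFn_swap a b d) (hE.structFn_zero_succ hp hξ hgh)
    (hE.structFn_zero_zero hD0) (hE.structFn_succ hp hξ hgh) (fun l => by simp [twistFn])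
    (hd.form_eq hE hp hξ hgh ho) (D.connFn_eq hE.frame) (DB.connFn_eq hE.base)

/-- The antiselfdual part of the curvature of a Weyl connection on `M` has no symmetric tracefree
part if and only if this holds for the curvature of the Weyl connection on `B`. -/
lemma IsDescentOf.symTracefreeVanishes_iff [T2Space M] [T2Space B] (hd : IsDescentOf o p ξ D0 DB)
    (hE : IsAdaptedFrame p ξ g h E f x)
    (hp : ContMDiff (𝓡 4) (𝓡 3) ∞ p) (hξ : IsTangentToFibres (n := 3) p ξ)
    (hgh : IsPullbackGauge p g h) (hD0 : D0.IsMinimal ξ) (ho : 0 < o.form x (fun a => E a x))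
    (D : WeylDerivative C) :
    SymTracefreeVanishes (asdCurv (fun a b c d => curvFn D.conn g.1 E a b c d x)) ↔
    SymTracefreeVanishes (fun I J : Fin 3 =>
      curvFn DB.conn h.1 f (I + 1) (I + 2) (J + 1) (J + 2) (p x)) := by
  -- γ and γ₀ are the horizontal and vertical components of D - D⁰ - ω/2; both α and ω vanish on `E
  -- 0`.
  set γ : Fin 3 → M → ℝ := fun i y =>
    D.form g y (E i.succ y) - D0.form g y (E i.succ y) - twistFn g E i y / 2 with hγ
  set γ₀ : M → ℝ := fun y => D.form g y (E 0 y) with hγ₀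
  have sφ : ∀ a, FnSmoothNear (n := 4) (fun y => D.form g y (E a y)) x := fun a =>
    D.formSmoothNear x _ (hE.frame.smooth a)
  have sα : ∀ a, FnSmoothNear (n := 4) (fun y => D0.form g y (E a y)) x := fun a =>
    D0.formSmoothNear x _ (hE.frame.smooth a)
  have sγ : ∀ i, FnSmoothNear (n := 4) (γ i) x := by
    intro i
    have := ((sφ i.succ).sub (sα i.succ)).sub
      ((hE.frame.smooth_structFn (i + 1).succ (i + 2).succ 0).mul (.const (-(1 / 2))))
    refine this.congr (Filter.Eventually.of_forall fun y => ?_)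
    simp only [hγ, twistFn]; ring
  have sG : ∀ a b c, FnSmoothNear (n := 3) (connFn DB.conn h.1 f a b c) (p x) := fun a b c =>
    hE.base.smooth_connFn DB.smooth a b c
  have sΓ : ∀ a b c, FnSmoothNear (n := 4) (connFn D.conn g.1 E a b c) x := fun a b c =>
    hE.frame.smooth_connFn D.smooth a b c
  -- The formulas hold at all points `y` near `x`, so they may be differentiated.
  have key := fun {y} (hy : IsAdaptedFrame p ξ g h E f y) (hoy : 0 < o.form y (fun a => E a y)) =>
    hd.asdComp_connFn hy hp hξ hgh hD0 hoy D
  have ev := (hE.eventually hp).and (eventually_form_pos hE.frame.smooth ho)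
  have dasd : ∀ a b J, asdComp (fun c d => dir (E a) (connFn D.conn g.1 E b c d) x) J
      = dir (E a) (fun y => asdComp (fun c d => connFn D.conn g.1 E b c d y) J) x := by
    intro a b J
    fin_cases J <;> simp only [asdComp, Fin.zero_eta, Fin.mk_one, Fin.reduceFinMk,
      Matrix.cons_val] <;> rw [dir_add (sΓ _ _ _) (sΓ _ _ _)]
  refine symTracefreeVanishes_asd_iff (γ₀ := γ₀ x) (γ := fun i => γ i x)
    (dγ₀ := fun a => dir (E a) γ₀ x) (dγ := fun a i => dir (E a) (γ i) x)
    (G := fun a b c => connFn DB.conn h.1 f a b c (p x))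
    (dG := fun l a b c => dir (f l) (connFn DB.conn h.1 f a b c) (p x))
    (A := fun i => DB.form h (p x) (f i (p x))) (s := fun i => twistFn g E i x)
    (Γ := fun J a => asdComp (fun c d => connFn D.conn g.1 E a c d x) J)
    (dΓ := fun a J b => asdComp (fun c d => dir (E a) (connFn D.conn g.1 E b c d) x) J)
    (c := fun a b d => structFn g.1 E a b d x)
    (DB.connFn_metric hE.base) (key hE ho).1 (key hE ho).2 ?_ ?_ ?_
    (hE.structFn_zero_succ hp hξ hgh) ?_ ?_ (fun l => by simp [twistFn]) ?_ ?_
  · intro a J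
    rw [dasd, dir_congr (ev.mono fun y hy => (key hy.1 hy.2).1 J), dir_neg]
  -- In the vertical direction the coefficients of `DB` are constant, so only derivatives of γ and
  -- γ₀ remain.
  · intro J l
    rw [dasd, dir_congr (ev.mono fun y hy => (key hy.1 hy.2).2 J l)]
    have e1 := (sG l (J + 1) (J + 2)).comp_map (x := x) hp
    have e2 := (sγ (J + 1)).mul (FnSmoothNear.const (if l = J + 2 then 1 else 0))
    have e3 := (sγ (J + 2)).mul (FnSmoothNear.const (if l = J + 1 then 1 else 0))
    have e4 := (sφ 0).mul (FnSmoothNear.const (if l = J then 1 else 0))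
    rw [dir_add ((e1.add e2).sub e3) e4, dir_sub (e1.add e2) e3, dir_add e1 e2,
      dir_mul (sγ _) (.const _), dir_mul (sγ _) (.const _), dir_mul (sφ _) (.const _),
      hE.dir_zero hp hξ (sG _ _ _)]
    simp [hγ₀]
  -- In a horizontal direction the pulled back coefficients are differentiated along the base frame.
  · intro m J l
    rw [dasd, dir_congr (ev.mono fun y hy => (key hy.1 hy.2).2 J l)]
    have e1 := (sG l (J + 1) (J + 2)).comp_map (x := x) hp
    have e2 := (sγ (J + 1)).mul (FnSmoothNear.const (if l = J + 2 then 1 else 0))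
    have e3 := (sγ (J + 2)).mul (FnSmoothNear.const (if l = J + 1 then 1 else 0))
    have e4 := (sφ 0).mul (FnSmoothNear.const (if l = J then 1 else 0))
    rw [dir_add ((e1.add e2).sub e3) e4, dir_sub (e1.add e2) e3, dir_add e1 e2,
      dir_mul (sγ _) (.const _), dir_mul (sγ _) (.const _), dir_mul (sφ _) (.const _),
      hE.dir_succ hp m (sG _ _ _)]
    simp [hγ₀]
  · intro l
    rw [hE.structFn_zero_zero hD0, hd.form_eq hE hp hξ hgh ho]
    ring
  · intro l m k
    rw [hE.structFn_succ hp hξ hgh, DB.connFn_torsion hE.base]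
  · intro I J
    have : ∀ a b J, asdComp (fun c d => curvFn D.conn g.1 E a b c d x) J = _ := fun a b J => by
      simp only [hE.frame.curvFn_eq D.smooth a b]
      exact asdComp_curvature (Γ := fun a c d => connFn D.conn g.1 E a c d x)
        (φ := fun a => D.form g x (E a x)) (D.connFn_metric hE.frame)
        (fun a b c d => dir (E a) (connFn D.conn g.1 E b c d) x)
        (fun a b f => structFn g.1 E a b f x) a b J
    simp only [asdCurv, this]
  · intro I J
    simp only [hE.base.curvFn_eq DB.smooth, DB.connFn_torsion hE.base]

end Comparison

/-! ### The symmetric tracefree Ricci tensor and the curvature in dimension 3. -/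

section EinsteinWeyl

/-- In dimension 3, the curvature is determined by the Ricci tensor. -/
lemma ricComp_symTracefree_iff {R : Fin 3 → Fin 3 → Fin 3 → Fin 3 → ℝ} {F : Fin 3 → Fin 3 → ℝ}
    (h1 : ∀ a b c d, R a b c d = - R b a c d)
    (h2 : ∀ a b c d, R a b c d + R a b d c = 2 * F a b * if c = d then 1 else 0) :
    (∀ a b, (ricComp R a b + ricComp R b a) / 2 - (∑ i, ricComp R i i) / 3 * kron a b = 0) ↔
    SymTracefreeVanishes (fun I J : Fin 3 => R (I + 1) (I + 2) (J + 1) (J + 2)) := by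
  have z : ∀ a c d, R a a c d = 0 := fun a c d => by linarith [h1 a a c d]
  have q : ∀ a b c, R a b c c = F a b := fun a b c => by
    have := h2 a b c c; simp at this; linarith
  have q' : ∀ a b c d, c ≠ d → R a b d c = - R a b c d := fun a b c d h => by
    have := h2 a b c d; simp [h] at this; linarith
  have t1 := h1 1 0
  have t2 := h1 2 1
  have t3 := h1 0 2
  have s1 := fun a b => q' a b 0 1 (by decide)
  have s2 := fun a b => q' a b 1 2 (by decide)
  have s3 := fun a b => q' a b 2 0 (by decide)
  simp only [SymTracefreeVanishes, Fin.isValue, Fin.reduceAdd, zero_add]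
  constructor
  · intro h
    have a1 := h 0 1
    have a2 := h 1 2
    have a3 := h 2 0
    have a4 := h 0 0
    have a5 := h 1 1
    simp only [ricComp, kron, Fin.sum_univ_three, z, t1, t2, t3, s1, s2, s3, q, Fin.reduceEq,
      if_true, if_false, Fin.isValue] at a1 a2 a3 a4 a5
    refine ⟨?_, ?_, ?_, ?_, ?_⟩ <;> linarith
  · rintro ⟨a1, a2, a3, a4, a5⟩ a b
    fin_cases a <;> fin_cases b <;>
    simp only [ricComp, kron, Fin.sum_univ_three, z, t1, t2, t3, s1, s2, s3, q, Fin.reduceEq,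
      if_true, if_false, Fin.isValue, Fin.zero_eta, Fin.mk_one, Fin.reduceFinMk] <;> linarith

variable {n : ℕ} {B : Type*} [TopologicalSpace B] [ChartedSpace (Model n) B] [IsManifold (𝓡 n) ∞ B]
  [T2Space B] {CB : ConformalStructure n B} (D : WeylDerivative CB) {h h' : CB.Gauge} {b : B}

lemma WeylDerivative.isLinearMap_ricciSymTracefree₁ (e : Fin n → TangentSpace (𝓡 n) b)
    (w : TangentSpace (𝓡 n) b) : IsLinearMap ℝ (fun v => D.ricciSymTracefree h b e v w) := by
  have h1 := D.isLinearMap_ricci₁ h e w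
  have h2 := D.isLinearMap_ricci₂ h e w
  constructor <;> intros <;> simp only [ricciSymTracefree, h1.map_add, h1.map_smul, h2.map_add,
    h2.map_smul, map_add, map_smul, add_apply, smul_apply, smul_eq_mul] <;> ring

lemma WeylDerivative.isLinearMap_ricciSymTracefree₂ (e : Fin n → TangentSpace (𝓡 n) b)
    (v : TangentSpace (𝓡 n) b) : IsLinearMap ℝ (D.ricciSymTracefree h b e v) := by
  have h1 := D.isLinearMap_ricci₁ h e v
  have h2 := D.isLinearMap_ricci₂ h e v
  constructor <;> intros <;> simp only [ricciSymTracefree, h1.map_add, h1.map_smul, h2.map_add,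
    h2.map_smul, map_add, map_smul, smul_eq_mul] <;> ring

variable {D} in
lemma WeylDerivative.ricciSymTracefree_eq {e e' : Fin n → TangentSpace (𝓡 n) b}
    (he : IsOrthonormalFrame h.1 b e) (he' : IsOrthonormalFrame h'.1 b e')
    (v w : TangentSpace (𝓡 n) b) :
    D.ricciSymTracefree h' b e' v w = D.ricciSymTracefree h b e v w := by
  obtain ⟨f, -, hf⟩ := (CB.mem_iff h.1 h.2 h'.1).1 h'.2
  have hg : ∀ v w, h'.1.inner b v w = Real.exp (f b) ^ 2 * h.1.inner b v w := by
    intro v w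
    rw [hf, ← Real.exp_nat_mul]
    norm_num
  simp only [ricciSymTracefree, ricci_eq_of_conformal he he' hg,
    ← scalar_eq_of_conformal (D := D) he he' hg, hg]
  ring

end EinsteinWeyl

/-! ### The equivalence of Einstein-Weyl and selfduality. -/

section EinsteinWeylThree

variable {B : Type*} [TopologicalSpace B] [ChartedSpace (Model 3) B] [IsManifold (𝓡 3) ∞ B]
  [T2Space B] {CB : ConformalStructure 3 B} (D : WeylDerivative CB) {h : CB.Gauge} {b : B}
  {f : Fin 3 → VField 3 B}

lemma WeylDerivative.ricciSymTracefree_iff (hf : IsFrameNear h.1 f b) :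
    (∀ v w, D.ricciSymTracefree h b (fun i => f i b) v w = 0) ↔
    SymTracefreeVanishes (fun I J : Fin 3 =>
      curvFn D.conn h.1 f (I + 1) (I + 2) (J + 1) (J + 2) b) := by
  rw [← ricComp_symTracefree_iff (R := fun a c d e => curvFn D.conn h.1 f a c d e b)
    (fun a c d e => curvFn_swap D.smooth hf a c d e) (fun a c d e => D.curvFn_skew hf a c d e)]
  have e : ∀ a c, D.ricciSymTracefree h b (fun i => f i b) (f a b) (f c b)
      = (ricComp (fun a c d e => curvFn D.conn h.1 f a c d e b) a c
        + ricComp (fun a c d e => curvFn D.conn h.1 f a c d e b) c a) / 2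
        - (∑ i, ricComp (fun a c d e => curvFn D.conn h.1 f a c d e b) i i) / 3 * kron a c := by
    intro a c
    have : h.1.inner b (f a b) (f c b) = kron a c := hf.inner a c
    simp only [WeylDerivative.ricciSymTracefree, this]
    push_cast
    rfl
  have l0 : IsLinearMap ℝ (fun _ : TangentSpace (𝓡 3) b => (0 : ℝ)) := ⟨by simp, by simp⟩
  refine ⟨fun H a c => by rw [← e, H], fun H v w => ?_⟩
  refine hf.at.eq_of_isLinearMap (D.isLinearMap_ricciSymTracefree₁ _ w) l0 (fun a => ?_) v
  refine hf.at.eq_of_isLinearMap (D.isLinearMap_ricciSymTracefree₂ _ _) l0 (fun c => ?_) w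
  rw [e, H]

variable {M : Type*} [TopologicalSpace M] [ChartedSpace (Model 4) M] [IsManifold (𝓡 4) ∞ M]
  [T2Space M] {C : ConformalStructure 4 M} {p : M → B} {ξ : Congruence C}
  {D0 : WeylDerivative C} {o : OrientationForm 4 M} {DB : WeylDerivative CB}

/-- The Weyl derivative on the quotient is Einstein-Weyl if and only if the conformal structure
on `M` is selfdual. -/
theorem IsDescentOf.isEinsteinWeyl_iff (hd : IsDescentOf o p ξ D0 DB)
    (hp : IsConformalSubmersion C CB p) (hξ : IsTangentToFibres (n := 3) p ξ)
    (hD0 : D0.IsMinimal ξ) : DB.IsEinsteinWeyl ↔ C.IsSelfdual o := by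
  obtain ⟨h₀, hh₀⟩ := CB.nonempty
  let h : CB.Gauge := ⟨h₀, hh₀⟩
  obtain ⟨g, hgh⟩ := hp.exists_isPullbackGauge hξ h
  constructor
  · intro H
    -- Selfduality is asked of every Weyl derivative `D` on `M`, and the comparison with `DB` is
    -- available for each of them.
    refine C.isSelfdual_of_symTracefreeVanishes fun D x => ?_
    obtain ⟨E, f, hE, ho⟩ := hp.exists_isAdaptedFrame_oriented hξ hgh o x
    refine ⟨g, E, hE.frame, ho,
      (hd.symTracefreeVanishes_iff hE hp.smooth hξ hgh hD0 ho D).2 ?_⟩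
    exact (DB.ricciSymTracefree_iff hE.base).1 fun v w => H h (p x) _ hE.base.at v w
  · intro H h' b e' he' v w
    obtain ⟨x, rfl⟩ := hp.surjective b
    obtain ⟨E, f, hE, ho⟩ := hp.exists_isAdaptedFrame_oriented hξ hgh o x
    rw [WeylDerivative.ricciSymTracefree_eq hE.base.at he']
    -- Conversely, one Weyl derivative on `M` is enough, and D⁰ is at hand.
    exact (DB.ricciSymTracefree_iff hE.base).2
      ((hd.symTracefreeVanishes_iff hE hp.smooth hξ hgh hD0 ho D0).1
        (H.symTracefreeVanishes D0 hE.frame ho)) v w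

end EinsteinWeylThree

/-! ### The Jacobi identity for structure functions. -/

section Jacobi

variable {n : ℕ} {M : Type*} [TopologicalSpace M] [ChartedSpace (Model n) M]
  [IsManifold (𝓡 n) ∞ M] {C : ConformalStructure n M} {g : C.Gauge}
  {E : Fin n → VField n M} {x : M}

/-- The Jacobi identity for the structure functions of an orthonormal frame. -/
lemma WeylDerivative.structFn_jacobi [T2Space M] (D : WeylDerivative C) (h : IsFrameNear g.1 E x) (a b c d : Fin n) :
    dir (E a) (structFn g.1 E b c d) x + dir (E b) (structFn g.1 E c a d) x
      + dir (E c) (structFn g.1 E a b d) x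
      + ∑ f, (structFn g.1 E b c f x * structFn g.1 E a f d x
        + structFn g.1 E c a f x * structFn g.1 E b f d x
        + structFn g.1 E a b f x * structFn g.1 E c f d x) = 0 := by
  -- The structure functions are the skew parts of the coefficients of any torsion-free connection,
  -- so the Bianchi identity of the auxiliary `D` turns into the Jacobi identity.
  have hb := curvFn_bianchi D.smooth D.torsion_eq_zero h a b c d
  have sΓ := fun a b c => h.smooth_connFn D.smooth a b c
  have hd : ∀ a b c, dir (E a) (structFn g.1 E b c d) x
      = dir (E a) (connFn D.conn g.1 E b c d) x - dir (E a) (connFn D.conn g.1 E c b d) x := by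
    intro a b c
    rw [← dir_sub (sΓ _ _ _) (sΓ _ _ _)]
    exact dir_congr (h.eventually.mono fun y hy => (D.connFn_torsion hy b c d).symm)
  have e : ∀ f, structFn g.1 E b c f x * structFn g.1 E a f d x
        + structFn g.1 E c a f x * structFn g.1 E b f d x
        + structFn g.1 E a b f x * structFn g.1 E c f d x
      = (connFn D.conn g.1 E b c f x * connFn D.conn g.1 E a f d x
        - connFn D.conn g.1 E a c f x * connFn D.conn g.1 E b f d x
        - structFn g.1 E a b f x * connFn D.conn g.1 E f c d x)
      + (connFn D.conn g.1 E c a f x * connFn D.conn g.1 E b f d x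
        - connFn D.conn g.1 E b a f x * connFn D.conn g.1 E c f d x
        - structFn g.1 E b c f x * connFn D.conn g.1 E f a d x)
      + (connFn D.conn g.1 E a b f x * connFn D.conn g.1 E c f d x
        - connFn D.conn g.1 E c b f x * connFn D.conn g.1 E a f d x
        - structFn g.1 E c a f x * connFn D.conn g.1 E f b d x) := by
    intro f
    simp only [← D.connFn_torsion h]
    ring
  rw [Finset.sum_congr rfl fun f _ => e f, Finset.sum_add_distrib, Finset.sum_add_distrib]
  rw [h.curvFn_eq D.smooth, h.curvFn_eq D.smooth, h.curvFn_eq D.smooth] at hb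
  rw [hd, hd, hd]
  linarith

end Jacobi

/-! ### D⁰ + ω is constant along the fibres. -/

section Invariance

variable {M B : Type*} [TopologicalSpace M] [ChartedSpace (Model 4) M] [IsManifold (𝓡 4) ∞ M]
  [TopologicalSpace B] [ChartedSpace (Model 3) B] [IsManifold (𝓡 3) ∞ B]
  {C : ConformalStructure 4 M} {CB : ConformalStructure 3 B} {p : M → B} {ξ : Congruence C}
  {g : C.Gauge} {h : CB.Gauge} {E : Fin 4 → VField 4 M} {f : Fin 3 → VField 3 B} {x : M}
  {D0 : WeylDerivative C} {o : OrientationForm 4 M}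

/-- The 1-form vanishes on `E 0`, and [E_0, E_i] is vertical, so two of the three terms of the
exterior derivative disappear. -/
lemma IsAdaptedFrame.faraday_zero_succ [T2Space M] (hE : IsAdaptedFrame p ξ g h E f x)
    (hp : ContMDiff (𝓡 4) (𝓡 3) ∞ p) (hξ : IsTangentToFibres (n := 3) p ξ)
    (hgh : IsPullbackGauge p g h) (hD0 : D0.IsMinimal ξ) (i : Fin 3) :
    D0.faraday g x (E 0 x) (E i.succ x)
      = dir (E 0) (fun y => D0.form g y (E i.succ y)) x := by
  have hz : ∀ᶠ y in 𝓝 x, D0.form g y (E 0 y) = 0 :=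
    (hE.eventually hp).mono fun y hy => hy.form_zero hp hξ hgh hD0
  rw [WeylDerivative.faraday, extDerivOneForm_eq g.1 (D0.formSmoothNear x) (hE.frame.smooth _)
    (hE.frame.smooth _), dir_congr (h := fun _ => (0 : ℝ)) hz, hE.frame.bracket_eq,
    Fin.sum_univ_succ]
  simp [hE.structFn_zero_succ hp hξ hgh, hz.self_of_nhds]

/-- This is the `E 0` component of the Jacobi identity for (0, i, j): c_0i0 = -α_i turns its other
derivative terms into E_i(α_j) - E_j(α_i). -/
lemma IsAdaptedFrame.faraday_succ_succ [T2Space M] (hE : IsAdaptedFrame p ξ g h E f x)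
    (hp : ContMDiff (𝓡 4) (𝓡 3) ∞ p) (hξ : IsTangentToFibres (n := 3) p ξ)
    (hgh : IsPullbackGauge p g h) (hD0 : D0.IsMinimal ξ) (i j : Fin 3) :
    D0.faraday g x (E i.succ x) (E j.succ x)
      = - dir (E 0) (structFn g.1 E i.succ j.succ 0) x := by
  have hc : ∀ k : Fin 3, ∀ᶠ y in 𝓝 x, structFn g.1 E 0 k.succ 0 y = - D0.form g y (E k.succ y) :=
    fun k => (hE.eventually hp).mono fun y hy => hy.structFn_zero_zero hD0 k
  have hc' : ∀ k : Fin 3, ∀ᶠ y in 𝓝 x, structFn g.1 E k.succ 0 0 y = D0.form g y (E k.succ y) :=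
    fun k => (hc k).mono fun y hy => by rw [structFn_swap, hy, neg_neg]
  have j1 := D0.structFn_jacobi hE.frame 0 i.succ j.succ 0
  rw [dir_congr (hc i), dir_congr (hc' j), dir_neg] at j1
  have z0 : structFn g.1 E 0 0 0 x = 0 := by
    linarith [structFn_swap (g := g.1) (E := E) (x := x) 0 0 0]
  have z : ∀ i k : Fin 3, structFn g.1 E i.succ 0 k.succ x = 0 := fun i k => by
    rw [structFn_swap, hE.structFn_zero_succ hp hξ hgh, neg_zero]
  simp only [Fin.sum_univ_succ (n := 3), hE.structFn_zero_succ hp hξ hgh, z, z0,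
    (hc _).self_of_nhds, (hc' _).self_of_nhds] at j1
  rw [WeylDerivative.faraday, extDerivOneForm_eq g.1 (D0.formSmoothNear x) (hE.frame.smooth _)
    (hE.frame.smooth _), hE.frame.bracket_eq, Fin.sum_univ_succ]
  simp only [map_add, map_smul, map_sum, smul_eq_mul, hE.form_zero hp hξ hgh hD0]
  simp only [zero_mul, add_zero, mul_neg, Finset.sum_neg_distrib] at j1
  linarith

/-- If the minimal Weyl derivative has selfdual curvature, the components of `D⁰ + ω` are constant
along the fibres. -/
lemma IsAdaptedFrame.dir_zero_eq_zero [T2Space M] (hE : IsAdaptedFrame p ξ g h E f x)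
    (hp : ContMDiff (𝓡 4) (𝓡 3) ∞ p) (hξ : IsTangentToFibres (n := 3) p ξ)
    (hgh : IsPullbackGauge p g h) (hD0 : D0.IsMinimal ξ) (hsd : D0.HasSelfdualFaraday o)
    (ho : 0 < o.form x (fun a => E a x)) (i : Fin 3) :
    dir (E 0) (fun y => D0.form g y (E i.succ y) + twistFn g E i y) x = 0 := by
  have s1 := hE.frame.smooth_structFn (i + 1).succ (i + 2).succ 0
  rw [dir_add (D0.formSmoothNear x _ (hE.frame.smooth _)) (by exact s1.neg)]
  have hsw : ∀ v w, D0.faraday g x w v = - D0.faraday g x v w := by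
    intro v w
    simp only [WeylDerivative.faraday, extDerivOneForm]
    rw [VectorField.mlieBracket_swap_apply]
    simp only [map_neg]; ring
  have hh := hsd g x _ ⟨hE.frame.at, ho⟩
  -- Selfduality with the sign *(e⁰ ∧ e¹) = -(e² ∧ e³). The opposite sign would require D⁰ - ω.
  have hF : D0.faraday g x (E 0 x) (E i.succ x)
      = - D0.faraday g x (E (i + 1).succ x) (E (i + 2).succ x) := by
    obtain ⟨h1, -, h2, -, h3, -⟩ := hodgeStar_frame (o := o) (e := fun a => E a x) ho.ne' hsw
    rw [← hh]
    fin_cases i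
    · exact h1
    · exact h2
    · exact h3
  rw [hE.faraday_zero_succ hp hξ hgh hD0, hE.faraday_succ_succ hp hξ hgh hD0] at hF
  have : dir (E 0) (twistFn g E i) x = - dir (E 0) (structFn g.1 E (i + 1).succ (i + 2).succ 0) x :=
    dir_neg
  change _ + dir (E 0) (twistFn g E i) x = 0
  rw [this, hF]; ring

end Invariance

/-! ### Local sections of a submersion between vector spaces. -/

section ImplicitFunction

/-- A submersion has a local section through every point, and functions which are locally constant
along its fibres factor through it. -/
lemma exists_section_of_surjective_fderiv {E F : Type*} [NormedAddCommGroup E] [NormedSpace ℝ E]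
    [FiniteDimensional ℝ E] [NormedAddCommGroup F] [NormedSpace ℝ F] [FiniteDimensional ℝ F]
    {P : E → F} {x : E} (hP : ∀ᶠ y in 𝓝 x, ContDiffAt ℝ ∞ P y)
    (hs : Function.Surjective (fderiv ℝ P x)) :
    ∃ σ : F → E, ContDiffAt ℝ ∞ σ (P x) ∧ σ (P x) = x ∧ (∀ᶠ z in 𝓝 (P x), P (σ z) = z) ∧
      ∀ U : E → ℝ, (∀ᶠ y in 𝓝 x, DifferentiableAt ℝ U y ∧
        ∀ v, fderiv ℝ P y v = 0 → fderiv ℝ U y v = 0) → ∀ᶠ y in 𝓝 x, U y = U (σ (P y)) := by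
  have : CompleteSpace E := FiniteDimensional.complete ℝ E
  have : CompleteSpace F := FiniteDimensional.complete ℝ F
  have hst : HasStrictFDerivAt P (fderiv ℝ P x) x :=
    hP.self_of_nhds.hasStrictFDerivAt (by simp)
  -- Near `x`, P is straightened to the projection of F × ker onto F; the inverse straightening is
  -- Φ, and the section is its slice at 0.
  set φ := hst.implicitFunctionDataOfComplemented P (fderiv ℝ P x)
    (LinearMap.range_eq_top.2 hs) (Submodule.ClosedComplemented.of_finiteDimensional _) with hφ
  have hl : φ.leftFun = P := rfl
  have hpt : φ.pt = x := rfl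
  have hr : φ.rightFun x = 0 := by
    simp [hφ, HasStrictFDerivAt.implicitFunctionDataOfComplemented]
  have hrc : ContDiff ℝ ∞ φ.rightFun := by
    simp only [hφ, HasStrictFDerivAt.implicitFunctionDataOfComplemented]
    exact (ContinuousLinearMap.contDiff _).comp (contDiff_id.sub contDiff_const)
  have hq : φ.prodFun φ.pt = (P x, 0) := by
    rw [φ.prodFun_apply, hl, hpt, hr]
  set Φ : F × (fderiv ℝ P x).ker → E := φ.implicitFunction.uncurry with hΦ
  have hΦs : ContDiffAt ℝ ∞ Φ (P x, 0) := by
    have := φ.contDiffAt_implicitFunction (n := ∞) hP.self_of_nhds hrc.contDiffAt (by simp)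
    rwa [hq] at this
  have hΦ0 : Φ (P x, 0) = x := by
    have := φ.implicitFunction_apply_image.self_of_nhds
    rw [hpt, hr, hl] at this
    exact this
  have hPΦ : ∀ᶠ q in 𝓝 (P x, (0 : (fderiv ℝ P x).ker)), P (Φ q) = q.1 := by
    have := φ.leftFun_implicitFunction
    rwa [hq] at this
  have hin : Filter.Tendsto (fun z : F => (z, (0 : (fderiv ℝ P x).ker))) (𝓝 (P x))
      (𝓝 (P x, 0)) := (Continuous.prodMk_left _).tendsto _
  refine ⟨fun z => Φ (z, 0), ?_, hΦ0, hin.eventually hPΦ, fun U hU => ?_⟩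
  · exact ContDiffAt.comp (P x) hΦs (contDiffAt_id.prodMk contDiffAt_const)
  have hΦc : Filter.Tendsto Φ (𝓝 (P x, 0)) (𝓝 x) := by
    have := hΦs.continuousAt.tendsto
    rwa [hΦ0] at this
  have hΦd : ∀ᶠ q in 𝓝 (P x, (0 : (fderiv ℝ P x).ker)), DifferentiableAt ℝ Φ q := by
    have h1 := (hΦs.of_le (m := 1) (by exact_mod_cast le_top)).eventually (by simp)
    exact h1.mono fun q hq => hq.differentiableAt one_ne_zero
  have hgood := (hΦc.eventually hU).and ((hΦc.eventually hP).and (hΦd.and hPΦ.eventually_nhds))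
  obtain ⟨r, hr0, hr1⟩ := Metric.eventually_nhds_iff_ball.1 hgood
  -- P ∘ Φ is the first projection, so DΦ maps the kernel directions into the kernel of DP, where
  -- `U` has zero derivative. `U ∘ Φ` is then constant on each convex slice.
  have key : ∀ z ∈ Metric.ball (P x) r, ∀ k ∈ Metric.ball (0 : (fderiv ℝ P x).ker) r,
      U (Φ (z, k)) = U (Φ (z, 0)) := by
    intro z hz k hk
    have hd : ∀ k ∈ Metric.ball (0 : (fderiv ℝ P x).ker) r,
        HasFDerivAt (fun k => U (Φ (z, k))) (0 : (fderiv ℝ P x).ker →L[ℝ] ℝ) k := by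
      intro k hk
      obtain ⟨⟨hU1, hU2⟩, hP1, hΦ1, hPΦ1⟩ := hr1 (z, k) (by
        rw [← ball_prod_same]; exact ⟨hz, hk⟩)
      have h1 : HasFDerivAt (fun k => Φ (z, k))
          ((fderiv ℝ Φ (z, k)).comp (ContinuousLinearMap.inr ℝ F _)) k :=
        hΦ1.hasFDerivAt.comp k (hasFDerivAt_prodMk_right z k)
      have h2 := hU1.hasFDerivAt.comp k h1
      have h3 := (hP1.differentiableAt (by simp)).hasFDerivAt.comp (z, k) hΦ1.hasFDerivAt
      have h4 : HasFDerivAt (P ∘ Φ) (ContinuousLinearMap.fst ℝ F (fderiv ℝ P x).ker) (z, k) :=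
        hasFDerivAt_fst.congr_of_eventuallyEq hPΦ1
      have h5 := h3.unique h4
      refine h2.congr_fderiv ?_
      ext κ
      refine hU2 _ ?_
      have := DFunLike.congr_fun h5 (0, κ)
      simpa using this
    refine (convex_ball (0 : (fderiv ℝ P x).ker) r).is_const_of_fderivWithin_eq_zero (𝕜 := ℝ)
      (f := fun k => U (Φ (z, k)))
      (fun k hk => (hd k hk).differentiableAt.differentiableWithinAt) (fun k hk => ?_) hk
      (Metric.mem_ball_self hr0)
    rw [fderivWithin_of_isOpen Metric.isOpen_ball hk, (hd k hk).fderiv]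
  have hev : ∀ᶠ y in 𝓝 x, P y ∈ Metric.ball (P x) r ∧
      φ.rightFun y ∈ Metric.ball (0 : (fderiv ℝ P x).ker) r := by
    refine (hP.self_of_nhds.continuousAt.eventually (Metric.ball_mem_nhds _ hr0)).and ?_
    have := hrc.continuous.tendsto x
    rw [hr] at this
    exact this.eventually (Metric.ball_mem_nhds _ hr0)
  filter_upwards [hev, φ.implicitFunction_apply_image] with y hy hy2
  have e : Φ (P y, φ.rightFun y) = y := hy2
  conv_lhs => rw [← e]
  exact key _ hy.1 _ hy.2

end ImplicitFunction

/-! ### Local sections of a submersion between manifolds. -/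

section LocalSections

variable {m n : ℕ} {M B : Type*} [TopologicalSpace M] [ChartedSpace (Model m) M]
  [IsManifold (𝓡 m) ∞ M] [TopologicalSpace B] [ChartedSpace (Model n) B] [IsManifold (𝓡 n) ∞ B]
  {p : M → B}

/-- Read in charts, this is the statement for vector spaces. The chart differentials are invertible,
so surjectivity and kernels of the differential carry over. -/
lemma exists_section_of_surjective_mfderiv (hp : ContMDiff (𝓡 m) (𝓡 n) ∞ p) {x : M}
    (hs : Function.Surjective (mfderiv (𝓡 m) (𝓡 n) p x)) :
    ∃ σ : B → M, ContMDiffAt (𝓡 n) (𝓡 m) ∞ σ (p x) ∧ σ (p x) = x ∧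
      (∀ᶠ b in 𝓝 (p x), p (σ b) = b) ∧
      ∀ u : M → ℝ, FnSmoothNear (n := m) u x →
        (∀ᶠ y in 𝓝 x, ∀ v, mfderiv (𝓡 m) (𝓡 n) p y v = 0 → mvfderiv (𝓡 m) u y v = 0) →
        ∀ᶠ y in 𝓝 x, u y = u (σ (p y)) := by
  set φ := extChartAt (𝓡 m) x with hφ
  set ψ := extChartAt (𝓡 n) (p x) with hψ
  have φs : ∀ᶠ y' in 𝓝 (φ x), ContMDiffAt 𝓘(ℝ, Model m) (𝓡 m) ∞ φ.symm y' := by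
    filter_upwards [extChartAt_target_mem_nhds (I := 𝓡 m) x] with y' h1
    exact (contMDiffOn_extChartAt_symm x).contMDiffAt
      ((isOpen_extChartAt_target (I := 𝓡 m) x).mem_nhds h1)
  have φc : Filter.Tendsto φ.symm (𝓝 (φ x)) (𝓝 x) := by
    have := φs.self_of_nhds.continuousAt.tendsto
    rwa [hφ, extChartAt_to_inv] at this
  have ψs : ∀ᶠ b in 𝓝 (p x), ContMDiffAt (𝓡 n) 𝓘(ℝ, Model n) ∞ ψ b ∧
      (mfderiv (𝓡 n) 𝓘(ℝ, Model n) ψ b).IsInvertible := by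
    filter_upwards [extChartAt_source_mem_nhds (I := 𝓡 n) (p x)] with b hb
    exact ⟨contMDiffAt_extChartAt' (by simpa using hb), isInvertible_mfderiv_extChartAt hb⟩
  have pc : Filter.Tendsto (fun y' => p (φ.symm y')) (𝓝 (φ x)) (𝓝 (p x)) :=
    (hp.continuous.tendsto x).comp φc
  set P : Model m → Model n := fun y' => ψ (p (φ.symm y')) with hPdef
  have hPx : P (φ x) = ψ (p x) := by simp [hPdef, hφ]
  have hP : ∀ᶠ y' in 𝓝 (φ x), ContDiffAt ℝ ∞ P y' := by
    filter_upwards [φs, pc.eventually ψs] with y' h1 h2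
    exact (h2.1.comp y' (hp.contMDiffAt.comp y' h1)).contDiffAt
  have hPd : ∀ᶠ y' in 𝓝 (φ x), ∀ v, fderiv ℝ P y' v = mfderiv (𝓡 n) 𝓘(ℝ, Model n) ψ
      (p (φ.symm y')) (mfderiv (𝓡 m) (𝓡 n) p (φ.symm y')
        (mfderiv 𝓘(ℝ, Model m) (𝓡 m) φ.symm y' v)) := by
    filter_upwards [φs, pc.eventually ψs] with y' h1 h2 v
    have d1 := h1.mdifferentiableAt (by simp)
    have d2 := hp.mdifferentiableAt (x := φ.symm y') (by simp)
    have d3 := h2.1.mdifferentiableAt (by simp)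
    rw [← mfderiv_eq_fderiv]
    have e1 := mfderiv_comp_apply y' (I := 𝓘(ℝ, Model m)) (I' := 𝓡 n) (I'' := 𝓘(ℝ, Model n))
      (f := fun y' => p (φ.symm y')) (g := ψ) d3 (d2.comp y' d1) v
    have e2 := mfderiv_comp_apply y' (I := 𝓘(ℝ, Model m)) (I' := 𝓡 m) (I'' := 𝓡 n)
      (f := φ.symm) (g := p) d2 d1 v
    exact e1.trans (congrArg _ e2)
  have hφinv : Function.Surjective (mfderiv 𝓘(ℝ, Model m) (𝓡 m) φ.symm (φ x)) := by
    have := isInvertible_mfderivWithin_extChartAt_symm (I := 𝓡 m)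
      (mem_extChartAt_target (I := 𝓡 m) x)
    simp only [modelWithCornersSelf_coe, range_id, mfderivWithin_univ] at this
    exact this.bijective.surjective
  have hsurj : Function.Surjective (fderiv ℝ P (φ x)) := by
    intro w
    obtain ⟨w1, hw1⟩ := (pc.eventually ψs).self_of_nhds.2.bijective.surjective w
    have hs' : Function.Surjective (mfderiv (𝓡 m) (𝓡 n) p (φ.symm (φ x))) := by
      rw [hφ, extChartAt_to_inv]; exact hs
    obtain ⟨w2, hw2⟩ := hs' w1
    obtain ⟨w3, hw3⟩ := hφinv w2
    refine ⟨w3, ?_⟩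
    refine (hPd.self_of_nhds w3).trans ?_
    rw [hw3, hw2, hw1]
  obtain ⟨σ, hσ, hσx, hσP, hσU⟩ := exists_section_of_surjective_fderiv hP hsurj
  rw [hPx] at hσ hσx hσP
  have ψc : Filter.Tendsto ψ (𝓝 (p x)) (𝓝 (ψ (p x))) := ψs.self_of_nhds.1.continuousAt
  have σs : ContMDiffAt (𝓡 n) 𝓘(ℝ, Model m) ∞ (fun b => σ (ψ b)) (p x) :=
    hσ.contMDiffAt.comp (p x) ψs.self_of_nhds.1
  have σc : Filter.Tendsto (fun b => σ (ψ b)) (𝓝 (p x)) (𝓝 (φ x)) := by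
    have := σs.continuousAt.tendsto
    rwa [hσx] at this
  refine ⟨fun b => φ.symm (σ (ψ b)), ?_, ?_, ?_, ?_⟩
  · refine ContMDiffAt.comp (p x) ?_ σs
    rw [hσx]; exact φs.self_of_nhds
  · change φ.symm (σ (ψ (p x))) = x
    rw [hσx, hφ, extChartAt_to_inv]
  · filter_upwards [ψc.eventually hσP, extChartAt_source_mem_nhds (I := 𝓡 n) (p x),
      (pc.comp σc).eventually (extChartAt_source_mem_nhds (I := 𝓡 n) (p x))] with b h1 h2 h3
    exact ψ.injOn h3 h2 h1
  · intro u hu hv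
    have hφc : Filter.Tendsto φ (𝓝 x) (𝓝 (φ x)) := continuousAt_extChartAt (I := 𝓡 m) x
    have hev := hσU (fun y' => u (φ.symm y')) (by
      filter_upwards [φs, φc.eventually hu, φc.eventually hv, hPd, pc.eventually ψs]
        with y' h1 h2 h3 h4 h5
      refine ⟨((h2.comp y' h1).contDiffAt).differentiableAt (by simp), fun v hv => ?_⟩
      rw [h4] at hv
      have h6 := h3 _ (h5.2.bijective.injective (hv.trans (map_zero _).symm))
      rw [← mfderiv_eq_fderiv]
      have e2 := mfderiv_comp_apply y' (I := 𝓘(ℝ, Model m)) (I' := 𝓡 m) (I'' := 𝓘(ℝ, ℝ))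
        (f := φ.symm) (g := u) (h2.mdifferentiableAt (by simp)) (h1.mdifferentiableAt (by simp)) v
      exact e2.trans h6)
    filter_upwards [hφc.eventually hev, extChartAt_source_mem_nhds (I := 𝓡 m) x] with y h1 h2
    have e : φ.symm (φ y) = y := φ.left_inv h2
    simp only [hPdef, e] at h1
    exact h1

end LocalSections

/-! ### Descending the 1-form of D⁰ + ω to the base. -/

section Descent

variable {M B : Type*} [TopologicalSpace M] [ChartedSpace (Model 4) M] [IsManifold (𝓡 4) ∞ M]
  [TopologicalSpace B] [ChartedSpace (Model 3) B] [IsManifold (𝓡 3) ∞ B]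
  {C : ConformalStructure 4 M} {CB : ConformalStructure 3 B} {p : M → B} {ξ : Congruence C}
  {g : C.Gauge} {h : CB.Gauge} {x : M} {D0 : WeylDerivative C} {o : OrientationForm 4 M}
  {A : (x : M) → TangentSpace (𝓡 4) x →ₗ[ℝ] ℝ}

/-- `twistForm` takes a frame as an argument but does not depend on it, so D⁰ + ω is one linear form
at each point. -/
lemma exists_twistedForm (hp : IsConformalSubmersion C CB p)
    (hξ : IsTangentToFibres (n := 3) p ξ) (hgh : IsPullbackGauge p g h) (D0 : WeylDerivative C)
    (o : OrientationForm 4 M) : ∃ A : (x : M) → TangentSpace (𝓡 4) x →ₗ[ℝ] ℝ,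
      ∀ x (e : Fin 4 → TangentSpace (𝓡 4) x), IsOrientedFrame g.1 o x e →
        ∀ v, A x v = D0.form g x v + D0.twistForm o ξ g x e v := by
  choose E f hE ho using hp.exists_isAdaptedFrame_oriented hξ hgh o
  refine ⟨fun x => (D0.form g x).toLinearMap +
    (D0.isLinearMap_twistForm (o := o) (ξ := ξ) (g := g) fun a => E x a x).mk', fun x e he v => ?_⟩
  rw [D0.twistForm_eq ⟨(hE x).frame.at, ho x⟩ he]
  rfl

/-- Locally, the form `D⁰ + ω` is a pullback from the base. -/
lemma exists_local_descent [T2Space M] (hp : IsConformalSubmersion C CB p)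
    (hξ : IsTangentToFibres (n := 3) p ξ) (hgh : IsPullbackGauge p g h) (hD0 : D0.IsMinimal ξ)
    (hsd : D0.HasSelfdualFaraday o)
    (hA : ∀ x (e : Fin 4 → TangentSpace (𝓡 4) x), IsOrientedFrame g.1 o x e →
      ∀ v, A x v = D0.form g x v + D0.twistForm o ξ g x e v) (x : M) :
    ∃ (f : Fin 3 → VField 3 B) (F : Fin 3 → B → ℝ), IsFrameNear h.1 f (p x) ∧
      (∀ i, ContMDiffAt (𝓡 3) 𝓘(ℝ, ℝ) ∞ (F i) (p x)) ∧
      (∀ᶠ y in 𝓝 x, ∀ v, A y v = ∑ i, h.1.inner (p y) (mfderiv (𝓡 4) (𝓡 3) p y v) (f i (p y))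
        * F i (p y)) ∧
      ∀ s ∈ 𝓝 x, ∀ᶠ b in 𝓝 (p x), ∃ y ∈ s, p y = b := by
  obtain ⟨E, f, hE, ho⟩ := hp.exists_isAdaptedFrame_oriented hξ hgh o x
  obtain ⟨σ, hσ, hσx, hσp, hσu⟩ := exists_section_of_surjective_mfderiv hp.smooth (hp.submersion x)
  have hev := (hE.eventually hp.smooth).and (eventually_form_pos hE.frame.smooth ho)
  set u : Fin 3 → M → ℝ := fun i y => D0.form g y (E i.succ y) + twistFn g E i y with hu
  have us : ∀ i, FnSmoothNear (n := 4) (u i) x := fun i =>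
    (D0.formSmoothNear x _ (hE.frame.smooth _)).add
      (hE.frame.smooth_structFn (i + 1).succ (i + 2).succ 0).neg
  have uσ : ∀ᶠ y in 𝓝 x, ∀ i, u i y = u i (σ (p y)) := by
    refine Filter.eventually_all.2 fun i => hσu _ (us i) ?_
    filter_upwards [hev] with y hy v hv
    obtain ⟨t, rfl⟩ := (hξ g y v).1 hv
    rw [map_smul, ← hy.1.field_eq]
    have := hy.1.dir_zero_eq_zero hp.smooth hξ hgh hD0 hsd hy.2 i
    simp only [dir] at this
    rw [this, smul_zero]
  -- The components `u i` are locally constant along the fibres, hence determined near `x` by their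
  -- values on the section σ.
  refine ⟨f, fun i b => u i (σ b), hE.base, fun i => ?_, ?_, fun s hs => ?_⟩
  · have := (us i).at
    rw [← hσx] at this
    exact this.comp (p x) hσ
  · filter_upwards [hev, uσ] with y hy hy2 v
    have he : IsOrientedFrame g.1 o y (fun a => E a y) := ⟨hy.1.frame.at, hy.2⟩
    have A0 : A y (E 0 y) = 0 := by
      rw [hA y _ he, hy.1.form_zero hp.smooth hξ hgh hD0, hy.1.twistForm_zero, add_zero]
    have As : ∀ i : Fin 3, A y (E i.succ y) = u i y := fun i => by
      rw [hA y _ he, hy.1.twistForm_eq_twistFn hp.smooth hξ hgh hy.2 he]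
    conv_lhs => rw [← hy.1.frame.at.sum_eq v, Fin.sum_univ_succ]
    simp only [map_add, map_smul, map_sum, smul_eq_mul, A0, As, mul_zero, zero_add,
      hy.1.inner_succ hξ hgh, hy2]
  -- Openness of `p` at `x`: the section provides a nearby preimage of every nearby `b`.
  · have hc : Filter.Tendsto σ (𝓝 (p x)) (𝓝 x) := by
      have := hσ.continuousAt.tendsto
      rwa [hσx] at this
    filter_upwards [hc.eventually hs, hσp] with b h1 h2 using ⟨σ b, h1, h2⟩

/-- If the fibres are connected, the form `D⁰ + ω` is a pullback from the base. -/
lemma exists_descended_form [T2Space M] (hp : IsConformalSubmersion C CB p)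
    (hξ : IsTangentToFibres (n := 3) p ξ) (hgh : IsPullbackGauge p g h) (hD0 : D0.IsMinimal ξ)
    (hsd : D0.HasSelfdualFaraday o) (hconn : ∀ b : B, IsConnected (p ⁻¹' {b})) :
    ∃ a : (b : B) → TangentSpace (𝓡 3) b →L[ℝ] ℝ, (∀ b, FormSmoothNear a b) ∧
      ∀ x (e : Fin 4 → TangentSpace (𝓡 4) x), IsOrientedFrame g.1 o x e →
        ∀ v, a (p x) (mfderiv (𝓡 4) (𝓡 3) p x v)
          = D0.form g x v + D0.twistForm o ξ g x e v := by
  obtain ⟨A, hA⟩ := exists_twistedForm hp hξ hgh D0 o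
  have loc := exists_local_descent hp hξ hgh hD0 hsd hA
  have A_congr : ∀ x (v w : TangentSpace (𝓡 4) x),
      mfderiv (𝓡 4) (𝓡 3) p x v = mfderiv (𝓡 4) (𝓡 3) p x w → A x v = A x w := by
    intro x v w hvw
    obtain ⟨f, F, -, -, hF, -⟩ := loc x
    rw [hF.self_of_nhds, hF.self_of_nhds, hvw]
  choose L hL using hp.submersion
  -- Tangent vectors at `p x` and `p y` are compared through a field `W` on the base, since p x = p
  -- y identifies their types only after rewriting.
  have const : ∀ (W : VField 3 B) (x y : M), p x = p y →
      A x (L x (W (p x))) = A y (L y (W (p y))) := by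
    intro W x y hxy
    have : PreconnectedSpace (p ⁻¹' {p y}) :=
      isPreconnected_iff_preconnectedSpace.1 (hconn (p y)).isPreconnected
    have hlc : IsLocallyConstant (fun z : p ⁻¹' {p y} => A z.1 (L z.1 (W (p z.1)))) := by
      refine (IsLocallyConstant.iff_eventually_eq _).2 fun z => ?_
      obtain ⟨f, F, -, -, hF, -⟩ := loc z.1
      filter_upwards [continuous_subtype_val.continuousAt.eventually hF] with w hw
      rw [hw, hF.self_of_nhds, hL, hL, show p w.1 = p z.1 from w.2.trans z.2.symm]
    exact hlc.apply_eq_of_preconnectedSpace ⟨x, hxy⟩ ⟨y, rfl⟩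
  choose s hs using hp.surjective
  -- α is evaluated at a chosen point of the fibre on a chosen lift; `αp` shows that neither choice
  -- matters.
  set α : (b : B) → TangentSpace (𝓡 3) b → ℝ := fun b w =>
    A (s b) (L (s b) ((FiberBundle.extend (Model 3) w : VField 3 B) (p (s b)))) with hα
  have αp : ∀ x v, α (p x) (mfderiv (𝓡 4) (𝓡 3) p x v) = A x v := by
    intro x v
    simp only [hα]
    rw [const _ (s (p x)) x (hs (p x))]
    refine A_congr x _ _ ?_
    rw [hL, FiberBundle.extend_apply_self]
  have αlin : ∀ b, IsLinearMap ℝ (α b) := by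
    intro b
    obtain ⟨x, rfl⟩ := hp.surjective b
    constructor
    · intro v w
      obtain ⟨v, rfl⟩ := hp.submersion x v
      obtain ⟨w, rfl⟩ := hp.submersion x w
      rw [← map_add, αp, αp, αp, map_add]
    · intro c v
      obtain ⟨v, rfl⟩ := hp.submersion x v
      rw [← map_smul, αp, αp, map_smul]
  have t2 : ∀ b : B, T2Space (TangentSpace (𝓡 3) b) := fun b =>
    inferInstanceAs (T2Space (Model 3))
  refine ⟨fun b => (αlin b).mk'.toContinuousLinearMap, fun b V hV => ?_, fun x e he v => ?_⟩
  · filter_upwards [hV.eventually] with b' hb'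
    change ContMDiffAt (𝓡 3) 𝓘(ℝ, ℝ) ∞ (fun y => α y (V y)) b'
    obtain ⟨x, rfl⟩ := hp.surjective b'
    obtain ⟨f, F, hf, Fs, hF, ho⟩ := loc x
    have hs : ContMDiffAt (𝓡 3) 𝓘(ℝ, ℝ) ∞
        (fun y => ∑ i, h.1.inner y (V y) (f i y) * F i y) (p x) :=
      ContMDiffAt.sum fun i _ => (FnSmoothNear.metric h.1 hb' (hf.smooth i)).at.mul (Fs i)
    refine hs.congr_of_eventuallyEq ?_
    -- The local formula is known only at points of `M` near `x`; openness of `p` carries it to a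
    -- whole neighbourhood in the base.
    filter_upwards [ho _ hF] with y hy
    obtain ⟨z, hz, rfl⟩ := hy
    obtain ⟨v, hv⟩ := hp.submersion z (V (p z))
    rw [← hv, αp]
    exact hz v
  · exact (αp x v).trans (hA x e he v)

end Descent

/-! ### Smoothness of endomorphism fields. -/

section HomSections

variable {n : ℕ} {M : Type*} [TopologicalSpace M] [ChartedSpace (Model n) M]
  [IsManifold (𝓡 n) ∞ M]

lemma contMDiffAt_of_apply_basis {E F : Type*} [NormedAddCommGroup E] [NormedSpace ℝ E]
    [FiniteDimensional ℝ E] [NormedAddCommGroup F] [NormedSpace ℝ F] {ι : Type*} [Fintype ι]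
    (b : Module.Basis ι ℝ E) {Φ : M → E →L[ℝ] F} {x : M}
    (h : ∀ i, ContMDiffAt (𝓡 n) 𝓘(ℝ, F) ∞ (fun y => Φ y (b i)) x) :
    ContMDiffAt (𝓡 n) 𝓘(ℝ, E →L[ℝ] F) ∞ Φ x := by
  have e : Φ = fun y => ∑ i, ContinuousLinearMap.smulRightL ℝ E F
      (LinearMap.toContinuousLinearMap (b.coord i)) (Φ y (b i)) := by
    funext y
    ext v
    simp only [ContinuousLinearMap.smulRightL, sum_apply]
    simp only [LinearMap.mkContinuous₂_apply, LinearMap.coe_mk, AddHom.coe_mk,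
      ContinuousLinearMap.coe_smulRightₗ, ContinuousLinearMap.smulRight_apply,
      LinearMap.coe_toContinuousLinearMap', Module.Basis.coord_apply]
    conv_lhs => rw [← b.sum_repr v]
    rw [map_sum]
    exact Finset.sum_congr rfl fun i _ => map_smul _ _ _
  rw [e]
  exact ContMDiffAt.sum fun i _ =>
    (ContinuousLinearMap.contMDiff _).contMDiffAt.comp x (h i)

/-- Smoothness of a section of the endomorphisms of the tangent bundle can be tested on vector
fields. -/
lemma contMDiffAt_hom_of_apply {T : (x : M) → TangentSpace (𝓡 n) x →L[ℝ] TangentSpace (𝓡 n) x}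
    {x : M} (hT : ∀ V : VField n M, SmoothNear V x → SmoothNear (fun y => T y (V y)) x) :
    ContMDiffAt (𝓡 n) ((𝓡 n).prod 𝓘(ℝ, Model n →L[ℝ] Model n)) ∞
      (fun y => TotalSpace.mk' (Model n →L[ℝ] Model n)
        (E := fun x : M => TangentSpace (𝓡 n) x →L[ℝ] TangentSpace (𝓡 n) x) y (T y)) x := by
  set e := trivializationAt (Model n) (fun x : M => TangentSpace (𝓡 n) x) x with he
  have hx : x ∈ e.baseSet := FiberBundle.mem_baseSet_trivializationAt' x
  refine contMDiffAt_hom_bundle _ |>.2 ⟨contMDiffAt_id, ?_⟩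
  let b : Module.Basis (Fin n) ℝ (Model n) := (EuclideanSpace.basisFun (Fin n) ℝ).toBasis
  refine contMDiffAt_of_apply_basis b fun i => ?_
  have hV : SmoothNear (e.localFrame b i) x := by
    filter_upwards [e.open_baseSet.mem_nhds hx] with y hy
    exact contMDiffAt_localFrame_of_mem (n := ∞) e b i hy
  have h1 := (contMDiffAt_section x).1 (hT _ hV).at
  refine h1.congr_of_eventuallyEq ?_
  filter_upwards [e.open_baseSet.mem_nhds hx] with y hy
  rw [ContinuousLinearMap.inCoordinates_eq hy hy]
  simp only [ContinuousLinearMap.comp_apply]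
  rw [e.localFrame_apply_of_mem_baseSet b hy]
  rfl

end HomSections

/-! ### The Koszul connection of a frame. -/

section FrameConnection

variable {n : ℕ} {M : Type*} [TopologicalSpace M] [ChartedSpace (Model n) M]
  [IsManifold (𝓡 n) ∞ M]

/-- The right hand side of the Koszul formula. -/
def koszulFn (g : Metric n M) (a : (x : M) → TangentSpace (𝓡 n) x →L[ℝ] ℝ)
    (E : Fin n → VField n M) (j i k : Fin n) (x : M) : ℝ :=
  (structFn g E j i k x - structFn g E i k j x + structFn g E k j i x) / 2
    + a x (E j x) * (if i = k then 1 else 0) + a x (E i x) * (if j = k then 1 else 0)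
    - a x (E k x) * (if j = i then 1 else 0)

/-- The connection with the coefficients given by the Koszul formula. -/
def frameConn (g : Metric n M) (a : (x : M) → TangentSpace (𝓡 n) x →L[ℝ] ℝ)
    (E : Fin n → VField n M) (σ : VField n M) (x : M) :
    TangentSpace (𝓡 n) x →L[ℝ] TangentSpace (𝓡 n) x :=
  ∑ k, (mvfderiv (𝓡 n) (fun z => g.inner z (σ z) (E k z)) x
    + ∑ i, ∑ j, (g.inner x (σ x) (E i x) * koszulFn g a E j i k x) •
        g.inner x (E j x)).smulRight (E k x)

variable {g : Metric n M} {a : (x : M) → TangentSpace (𝓡 n) x →L[ℝ] ℝ} {E : Fin n → VField n M}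
  {x : M}

lemma mvfderiv_fun_sum {ι : Type*} {s : Finset ι} {f : ι → M → ℝ}
    (hf : ∀ i ∈ s, MDifferentiableAt (𝓡 n) 𝓘(ℝ, ℝ) (f i) x) :
    MDifferentiableAt (𝓡 n) 𝓘(ℝ, ℝ) (fun y => ∑ i ∈ s, f i y) x ∧
      ∀ v, mvfderiv (𝓡 n) (fun y => ∑ i ∈ s, f i y) x v = ∑ i ∈ s, mvfderiv (𝓡 n) (f i) x v := by
  classical
  induction s using Finset.induction_on with
  | empty =>
    simp only [Finset.sum_empty]
    exact ⟨mdifferentiableAt_const, fun v => by rw [mvfderiv_const]; rfl⟩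
  | insert b s hb ih =>
    obtain ⟨h1, h2⟩ := ih fun i hi => hf i (by simp [hi])
    have h3 := hf b (by simp)
    simp only [Finset.sum_insert hb]
    exact ⟨h3.add h1, fun v => by rw [mvfderiv_fun_add h3 h1, add_apply, h2]⟩

lemma mdifferentiableAt_metric (g : Metric n M) {Y Z : VField n M}
    (hY : MDifferentiableAt (𝓡 n) ((𝓡 n).prod 𝓘(ℝ, Model n)) (T% Y) x)
    (hZ : MDifferentiableAt (𝓡 n) ((𝓡 n).prod 𝓘(ℝ, Model n)) (T% Z) x) :
    MDifferentiableAt (𝓡 n) 𝓘(ℝ, ℝ) (fun y => g.inner y (Y y) (Z y)) x := by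
  have : MDifferentiableAt (𝓡 n) ((𝓡 n).prod 𝓘(ℝ, ℝ))
      (fun y ↦ TotalSpace.mk' ℝ (E := Bundle.Trivial M ℝ) y (g.inner y (Y y) (Z y))) x :=
    MDifferentiableAt.clm_bundle_apply₂ (F₁ := Model n) (F₂ := Model n)
      (g.contMDiff.mdifferentiableAt (by simp)) hY hZ
  exact (mdifferentiableAt_totalSpace _ _ |>.1 this).2

lemma IsFrameNear.inner_frameConn (h : IsFrameNear g E x) (σ : VField n M)
    (v : TangentSpace (𝓡 n) x) (k : Fin n) :
    g.inner x (frameConn g a E σ x v) (E k x)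
      = mvfderiv (𝓡 n) (fun z => g.inner z (σ z) (E k z)) x v
        + ∑ i, ∑ j, g.inner x (σ x) (E i x) * koszulFn g a E j i k x * g.inner x v (E j x) := by
  simp only [frameConn, sum_apply, ContinuousLinearMap.smulRight_apply, add_apply, smul_apply,
    map_sum, map_smul, smul_eq_mul, h.inner, g.symm x v]
  simp

lemma IsFrameNear.frameConn_add (h : IsFrameNear g E x) {σ τ : VField n M}
    (hσ : MDifferentiableAt (𝓡 n) ((𝓡 n).prod 𝓘(ℝ, Model n)) (T% σ) x)
    (hτ : MDifferentiableAt (𝓡 n) ((𝓡 n).prod 𝓘(ℝ, Model n)) (T% τ) x) :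
    frameConn g a E (σ + τ) x = frameConn g a E σ x + frameConn g a E τ x := by
  ext1 v
  refine h.at.ext fun k => ?_
  have e := mvfderiv_fun_add (mdifferentiableAt_metric g hσ (h.smooth k).mdiff)
    (mdifferentiableAt_metric g hτ (h.smooth k).mdiff)
  simp only [add_apply, map_add, h.inner_frameConn, Pi.add_apply, add_mul, Finset.sum_add_distrib]
  rw [e, add_apply]
  ring

lemma IsFrameNear.frameConn_smul (h : IsFrameNear g E x) {σ : VField n M} {f : M → ℝ}
    (hσ : MDifferentiableAt (𝓡 n) ((𝓡 n).prod 𝓘(ℝ, Model n)) (T% σ) x)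
    (hf : MDifferentiableAt (𝓡 n) 𝓘(ℝ, ℝ) f x) :
    frameConn g a E (f • σ) x
      = f x • frameConn g a E σ x + (mvfderiv (𝓡 n) f x).smulRight (σ x) := by
  ext1 v
  refine h.at.ext fun k => ?_
  have e := mvfderiv_fun_mul hf (mdifferentiableAt_metric g hσ (h.smooth k).mdiff)
  simp only [add_apply, smul_apply, map_add, map_smul, h.inner_frameConn, Pi.smul_apply',
    ContinuousLinearMap.smulRight_apply, smul_eq_mul, mul_add, Finset.mul_sum]
  rw [e]
  simp only [add_apply, smul_apply, smul_eq_mul, mul_assoc]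
  ring

lemma IsFrameNear.inner_frameConn_frame (h : IsFrameNear g E x) (j i k : Fin n) :
    g.inner x (frameConn g a E (E i) x (E j x)) (E k x) = koszulFn g a E j i k x := by
  have e : mvfderiv (𝓡 n) (fun z => g.inner z (E i z) (E k z)) x (E j x) = 0 := by
    change dir (E j) (fun z => g.inner z (E i z) (E k z)) x = 0
    rw [dir_congr (h := fun _ => if i = k then (1 : ℝ) else 0)
      (h.orthonormal.mono fun y hy => hy i k)]
    simp
  rw [h.inner_frameConn, e]
  simp [h.inner]

/-- Together with `koszulFn_sub`, this is the linear system solved by the Koszul formula: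
compatibility up to the 1-form, and zero torsion. -/
lemma koszulFn_add (j i k : Fin n) :
    koszulFn g a E j i k x + koszulFn g a E j k i x
      = 2 * a x (E j x) * if i = k then 1 else 0 := by
  have s1 := structFn_swap (g := g) (E := E) (x := x) j i k
  have s2 := structFn_swap (g := g) (E := E) (x := x) i k j
  have s3 := structFn_swap (g := g) (E := E) (x := x) k j i
  simp only [koszulFn, s1, s2, s3, eq_comm (a := k) (b := i)]
  ring

lemma koszulFn_sub (j i k : Fin n) :
    koszulFn g a E j i k x - koszulFn g a E i j k x = structFn g E j i k x := by
  have s1 := structFn_swap (g := g) (E := E) (x := x) j i k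
  have s2 := structFn_swap (g := g) (E := E) (x := x) i k j
  have s3 := structFn_swap (g := g) (E := E) (x := x) k j i
  simp only [koszulFn, s1, s2, s3, eq_comm (a := j) (b := i)]
  ring

/-- In frame components the derivative terms follow from the Leibniz rule, and the algebraic terms
are symmetric in the two fields, so `koszulFn_add` evaluates them. -/
lemma IsFrameNear.frameConn_metric (h : IsFrameNear g E x) {Y Z : VField n M}
    (hY : MDifferentiableAt (𝓡 n) ((𝓡 n).prod 𝓘(ℝ, Model n)) (T% Y) x)
    (hZ : MDifferentiableAt (𝓡 n) ((𝓡 n).prod 𝓘(ℝ, Model n)) (T% Z) x)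
    (v : TangentSpace (𝓡 n) x) :
    mvfderiv (𝓡 n) (fun y => g.inner y (Y y) (Z y)) x v
      = g.inner x (frameConn g a E Y x v) (Z x) + g.inner x (Y x) (frameConn g a E Z x v)
        - 2 * a x v * g.inner x (Y x) (Z x) := by
  set y : Fin n → M → ℝ := fun k z => g.inner z (Y z) (E k z) with hy
  set w : Fin n → M → ℝ := fun k z => g.inner z (Z z) (E k z) with hw
  have dy : ∀ k, MDifferentiableAt (𝓡 n) 𝓘(ℝ, ℝ) (y k) x := fun k =>
    mdifferentiableAt_metric g hY (h.smooth k).mdiff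
  have dw : ∀ k, MDifferentiableAt (𝓡 n) 𝓘(ℝ, ℝ) (w k) x := fun k =>
    mdifferentiableAt_metric g hZ (h.smooth k).mdiff
  have e1 : mvfderiv (𝓡 n) (fun y => g.inner y (Y y) (Z y)) x v
      = ∑ k, (mvfderiv (𝓡 n) (y k) x v * w k x + y k x * mvfderiv (𝓡 n) (w k) x v) := by
    have e2 : (fun y => g.inner y (Y y) (Z y)) =ᶠ[𝓝 x] fun z => ∑ k, y k z * w k z := by
      filter_upwards [h.orthonormal] with z hz using hz.inner_eq _ _
    have e3 : mvfderiv (𝓡 n) (fun y => g.inner y (Y y) (Z y)) x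
        = mvfderiv (𝓡 n) (fun z => ∑ k, y k z * w k z) x := by
      simp only [mvfderiv, e2.mfderiv_eq]
      rfl
    rw [e3, (mvfderiv_fun_sum (f := fun k z => y k z * w k z)
      fun k _ => (dy k).mul (dw k)).2]
    refine Finset.sum_congr rfl fun k _ => ?_
    rw [mvfderiv_fun_mul (dy k) (dw k)]
    simp only [add_apply, smul_apply, smul_eq_mul]
    ring
  have i1 : g.inner x (frameConn g a E Y x v) (Z x) = ∑ k, (mvfderiv (𝓡 n) (y k) x v
      + ∑ i, ∑ j, y i x * koszulFn g a E j i k x * g.inner x v (E j x)) * w k x := by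
    rw [h.at.inner_eq]
    exact Finset.sum_congr rfl fun k _ => by rw [h.inner_frameConn]
  have i2 : g.inner x (Y x) (frameConn g a E Z x v) = ∑ k, y k x * (mvfderiv (𝓡 n) (w k) x v
      + ∑ i, ∑ j, w i x * koszulFn g a E j i k x * g.inner x v (E j x)) := by
    rw [h.at.inner_eq]
    exact Finset.sum_congr rfl fun k _ => by rw [h.inner_frameConn]
  have e4 : ∑ k, ∑ i, ∑ j, y i x * koszulFn g a E j i k x * g.inner x v (E j x) * w k x
      + ∑ k, ∑ i, ∑ j, y k x * (w i x * koszulFn g a E j i k x * g.inner x v (E j x))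
      = 2 * a x v * g.inner x (Y x) (Z x) := by
    have e5 : ∑ k, ∑ i, ∑ j, y k x * (w i x * koszulFn g a E j i k x * g.inner x v (E j x))
        = ∑ k, ∑ i, ∑ j, y i x * (w k x * koszulFn g a E j k i x * g.inner x v (E j x)) :=
      Finset.sum_comm
    rw [e5]
    simp only [← Finset.sum_add_distrib]
    have e6 : ∀ k i j, y i x * koszulFn g a E j i k x * g.inner x v (E j x) * w k x
        + y i x * (w k x * koszulFn g a E j k i x * g.inner x v (E j x))
        = (if i = k then y i x * w k x else 0) * (2 * (g.inner x v (E j x) * a x (E j x))) := by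
      intro k i j
      have := koszulFn_add (g := g) (a := a) (E := E) (x := x) j i k
      split_ifs at this ⊢ <;>
        linear_combination y i x * w k x * g.inner x v (E j x) * this
    simp only [e6, ← Finset.mul_sum, ← Finset.sum_mul]
    have e7 : ∑ j, g.inner x v (E j x) * a x (E j x) = a x v := by
      conv_rhs => rw [← h.at.sum_eq v]
      simp
    rw [e7, h.at.inner_eq (Y x) (Z x)]
    simp
    ring
  rw [e1, i1, i2, ← e4]
  simp only [add_mul, mul_add, Finset.sum_mul, Finset.mul_sum, Finset.sum_add_distrib]
  ring

end FrameConnection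

/-! ### From a smooth 1-form to a Weyl derivative. -/

section WeylConnection

variable {n : ℕ} {M : Type*} [TopologicalSpace M] [ChartedSpace (Model n) M]
  [IsManifold (𝓡 n) ∞ M] {g : Metric n M} {a : (x : M) → TangentSpace (𝓡 n) x →L[ℝ] ℝ}
  {E : Fin n → VField n M} {x : M} {D : Conn n M}

/-- The connection `D` satisfies `D g = -2 a ⊗ g`. -/
def HasMetricForm (D : Conn n M) (g : Metric n M) (a : (x : M) → TangentSpace (𝓡 n) x →L[ℝ] ℝ) :
    Prop :=
  ∀ (x : M) (Y Z : VField n M),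
    MDifferentiableAt (𝓡 n) ((𝓡 n).prod 𝓘(ℝ, Model n)) (T% Y) x →
    MDifferentiableAt (𝓡 n) ((𝓡 n).prod 𝓘(ℝ, Model n)) (T% Z) x →
    ∀ v : TangentSpace (𝓡 n) x,
      mvfderiv (𝓡 n) (fun y => g.inner y (Y y) (Z y)) x v =
        g.inner x (D Y x v) (Z x) + g.inner x (Y x) (D Z x v)
          - 2 * a x v * g.inner x (Y x) (Z x)

/-- The Koszul formula. -/
lemma connFn_eq_koszulFn (ht : D.torsion = 0) (hm : HasMetricForm D g a) (h : IsFrameNear g E x)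
    (j i k : Fin n) : connFn D g E j i k x = koszulFn g a E j i k x := by
  have tor : ∀ j i k, connFn D g E j i k x - connFn D g E i j k x = structFn g E j i k x := by
    intro j i k
    have := (CovariantDerivative.torsion_eq_zero_iff D).1 ht (h.smooth j).mdiff (h.smooth i).mdiff
    simp only [structFn, ← this, connFn, nabla, map_sub, sub_apply]
  have met : ∀ j i k, connFn D g E j i k x + connFn D g E j k i x
      = 2 * a x (E j x) * if i = k then 1 else 0 := by
    intro j i k
    have h1 := hm x (E i) (E k) (h.smooth i).mdiff (h.smooth k).mdiff (E j x)
    have h2 : dir (E j) (fun y => g.inner y (E i y) (E k y)) x = 0 := by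
      rw [dir_congr (h := fun _ => if i = k then (1 : ℝ) else 0)
        (h.orthonormal.mono fun y hy => hy i k)]
      simp
    change dir (E j) (fun y => g.inner y (E i y) (E k y)) x = _ at h1
    rw [h2, h.at i k, g.symm x (E i x)] at h1
    simp only [connFn, nabla]
    linarith
  have t1 := tor j i k
  have t2 := tor i k j
  have t3 := tor k j i
  have m1 := met j i k
  have m2 := met i k j
  have m3 := met k j i
  have e1 : (if k = j then (1 : ℝ) else 0) = if j = k then 1 else 0 := by simp only [eq_comm]
  rw [e1] at m2
  simp only [koszulFn]
  linarith

lemma IsFrameNear.smooth_koszulFn (h : IsFrameNear g E x) (ha : FormSmoothNear a x)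
    (j i k : Fin n) : FnSmoothNear (n := n) (koszulFn g a E j i k) x := by
  have s := h.smooth_structFn
  have t := fun i => ha _ (h.smooth i)
  exact ((((((s j i k).sub (s i k j)).add (s k j i)).mul (.const (2⁻¹))).add
    ((t j).mul (.const _))).add ((t i).mul (.const _))).sub ((t k).mul (.const _))

/-- A torsion-free connection with `D g = -2 a ⊗ g` is smooth. -/
lemma contMDiffCovariantDerivative_of_hasMetricForm (ht : D.torsion = 0)
    (hm : HasMetricForm D g a) (ha : ∀ x, FormSmoothNear a x) :
    CovariantDerivative.ContMDiffCovariantDerivative D ∞ := by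
  refine ⟨⟨fun {σ} hσ => ?_⟩⟩
  have hσ' : ∀ x, SmoothNear σ x := fun x => Filter.Eventually.of_forall fun y =>
    (hσ.contMDiffAt Filter.univ_mem).of_le (by simp)
  refine fun x _ => ContMDiffAt.contMDiffWithinAt (contMDiffAt_hom_of_apply fun V hV => ?_)
  obtain ⟨e, he⟩ := exists_isOrthonormalFrame g x
  obtain ⟨E, -, hE, ho⟩ := he.exists_extension
  have h : IsFrameNear g E x := ⟨hE, ho⟩
  have sσ : ∀ {y}, IsFrameNear g E y → ∀ i,
      FnSmoothNear (n := n) (fun z => g.inner z (σ z) (E i z)) y := fun h i =>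
    .metric g (hσ' _) (h.smooth i)
  refine smoothNear_of_frame hE ho fun k => ?_
  have hs : FnSmoothNear (n := n) (fun y => ∑ j, g.inner y (V y) (E j y)
      * ∑ i, (g.inner y (σ y) (E i y) * koszulFn g a E j i k y
        + dir (E j) (fun z => g.inner z (σ z) (E i z)) y * (if i = k then 1 else 0))) x :=
    FnSmoothNear.sum fun j _ => (FnSmoothNear.metric g hV (hE j)).mul <|
      FnSmoothNear.sum fun i _ => ((sσ h i).mul (h.smooth_koszulFn (ha x) j i k)).add
        (((sσ h i).dir (hE j)).mul (.const _))
  refine hs.congr ?_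
  filter_upwards [h.eventually] with y hy
  have e1 : ∀ j, D σ y (E j y) = ∑ i, (g.inner y (σ y) (E i y) • nabla D (E j) (E i) y
      + dir (E j) (fun z => g.inner z (σ z) (E i z)) y • E i y) := by
    intro j
    rw [← nabla_sum_smul (fun i _ => hy.smooth i) (fun i _ => sσ hy i)]
    refine (nabla_congr (hσ' y) ?_).symm
    filter_upwards [hy.orthonormal] with z hz using hz.sum_eq _
  conv_lhs => rw [← hy.at.sum_eq (V y)]
  simp only [map_sum, map_smul, sum_apply, smul_apply, smul_eq_mul]
  refine Finset.sum_congr rfl fun j _ => ?_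
  rw [e1]
  congr 1
  simp only [map_sum, map_add, map_smul, sum_apply, add_apply, smul_apply, smul_eq_mul, hy.inner]
  refine Finset.sum_congr rfl fun i _ => ?_
  rw [← connFn_eq_koszulFn ht hm hy]
  rfl

/-- A metric and a 1-form determine a torsion-free connection. -/
lemma exists_conn_hasMetricForm (g : Metric n M) (a : (x : M) → TangentSpace (𝓡 n) x →L[ℝ] ℝ) :
    ∃ D : Conn n M, D.torsion = 0 ∧ HasMetricForm D g a := by
  have hex : ∀ x, ∃ E : Fin n → VField n M, IsFrameNear g E x := by
    intro x
    obtain ⟨e, he⟩ := exists_isOrthonormalFrame g x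
    obtain ⟨E, -, hE, ho⟩ := he.exists_extension
    exact ⟨E, hE, ho⟩
  choose E hE using hex
  -- At each point the connection is computed in that point's own frame and used at that point only,
  -- so no gluing is needed. Smoothness comes afterwards, from the Koszul formula in any smooth
  -- frame.
  let D : Conn n M := ⟨fun σ x => frameConn g a (E x) σ x,
    ⟨fun {_ _ x} hσ hτ _ => (hE x).frameConn_add hσ hτ,
      fun {_ _ x} hσ hf _ => (hE x).frameConn_smul hσ hf⟩⟩
  refine ⟨D, ?_, fun x Y Z hY hZ v => (hE x).frameConn_metric hY hZ v⟩
  funext x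
  have hb : ∀ i j, D.torsion x (E x i x) (E x j x) = 0 := by
    intro i j
    rw [D.torsion_apply ((hE x).smooth i).mdiff ((hE x).smooth j).mdiff]
    refine (hE x).at.ext fun k => ?_
    simp only [map_sub, sub_apply]
    change g.inner x (frameConn g a (E x) (E x j) x (E x i x)) (E x k x)
      - g.inner x (frameConn g a (E x) (E x i) x (E x j x)) (E x k x)
      - structFn g (E x) i j k x = _
    rw [(hE x).inner_frameConn_frame, (hE x).inner_frameConn_frame, koszulFn_sub, sub_self]
    simp
  ext1 v
  ext1 w
  rw [← (hE x).at.sum_eq v, ← (hE x).at.sum_eq w]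
  simp [hb]

/-- Differentiating e^{2f} adds 2 df to the derivative of the metric, and the form enters with the
factor -2; equivalently, the new length scale is e^{-f} μ. -/
lemma HasMetricForm.of_conformal (hm : HasMetricForm D g a) {g' : Metric n M} {f : M → ℝ}
    (hf : ContMDiff (𝓡 n) 𝓘(ℝ, ℝ) ∞ f)
    (hg : ∀ x (v w : TangentSpace (𝓡 n) x), g'.inner x v w = Real.exp (2 * f x) * g.inner x v w) :
    HasMetricForm D g' (fun x => a x - mvfderiv (𝓡 n) f x) := by
  intro x Y Z hY hZ v
  have h1 := hm x Y Z hY hZ v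
  have hfx := hf.mdifferentiableAt (x := x) (by simp)
  have he : HasMFDerivAt (𝓡 n) 𝓘(ℝ, ℝ) (fun y => Real.exp (2 * f y)) x
      ((Real.exp (2 * f x) * 2) • mvfderiv (𝓡 n) f x) := by
    have h2 : HasFDerivAt (fun t : ℝ => Real.exp (2 * t))
        ((Real.exp (2 * f x) * 2) • ContinuousLinearMap.id ℝ ℝ) (f x) := by
      have := ((hasDerivAt_id (f x)).const_mul 2).exp.hasFDerivAt
      refine this.congr_fderiv ?_
      ext; simp
    have := h2.hasMFDerivAt.comp x hfx.hasMFDerivAt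
    convert! this using 1
  have e1 := mvfderiv_fun_mul he.mdifferentiableAt (mdifferentiableAt_metric g hY hZ)
  have e2 : mvfderiv (𝓡 n) (fun y => Real.exp (2 * f y)) x
      = (Real.exp (2 * f x) * 2) • mvfderiv (𝓡 n) f x := by
    simp only [mvfderiv, he.mfderiv]
    rfl
  simp only [hg]
  rw [e1, e2]
  simp only [add_apply, sub_apply, smul_apply, smul_eq_mul, h1]
  ring

/-- The 1-form of a connection with respect to a metric is unique. -/
lemma HasMetricForm.eq [NeZero n] {a' : (x : M) → TangentSpace (𝓡 n) x →L[ℝ] ℝ}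
    (hm : HasMetricForm D g a) (hm' : HasMetricForm D g a') : a = a' := by
  funext x
  ext1 v
  obtain ⟨e, he⟩ := exists_isOrthonormalFrame g x
  have s := (smoothNear_extend (e 0)).mdiff
  have h1 := hm x _ _ s s v
  rw [hm' x _ _ s s v] at h1
  have h2 := he 0 0
  simp only [FiberBundle.extend_apply_self, h2, if_true] at h1
  linarith

/-- A smooth 1-form determines a Weyl derivative. -/
lemma ConformalStructure.exists_weylDerivative [NeZero n] (C : ConformalStructure n M)
    (g : C.Gauge) (ha : ∀ x, FormSmoothNear a x) : ∃ D : WeylDerivative C, D.form g = a := by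
  obtain ⟨D, ht, hm⟩ := exists_conn_hasMetricForm g.1 a
  choose f hf hg using fun g' : C.Gauge => (C.mem_iff g.1 g.2 g'.1).1 g'.2
  refine ⟨⟨D, contMDiffCovariantDerivative_of_hasMetricForm ht hm ha, ht,
    fun g' x => a x - mvfderiv (𝓡 n) (f g') x, fun g' => hm.of_conformal (hf g') (hg g')⟩, ?_⟩
  -- The exponent chosen for `g` relative to itself need not be syntactically zero, so uniqueness of
  -- the form is invoked.
  exact (hm.of_conformal (hf g) (hg g)).eq hm

lemma WeylDerivative.form_of_conformal [NeZero n] {C : ConformalStructure n M}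
    (D : WeylDerivative C) {g g' : C.Gauge} {f : M → ℝ} (hf : ContMDiff (𝓡 n) 𝓘(ℝ, ℝ) ∞ f)
    (hg : ∀ x (v w : TangentSpace (𝓡 n) x),
      g'.1.inner x v w = Real.exp (2 * f x) * g.1.inner x v w) (v : TangentSpace (𝓡 n) x) :
    D.form g' x v = D.form g x v - mvfderiv (𝓡 n) f x v := by
  have h1 : HasMetricForm D.conn g.1 (D.form g) := D.conn_metric g
  have h2 : HasMetricForm D.conn g'.1 (D.form g') := D.conn_metric g'
  rw [h2.eq (h1.of_conformal hf hg)]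
  rfl

end WeylConnection

/-! ### Gauge independence of the descent condition. -/

section GaugeChange

variable {M B : Type*} [TopologicalSpace M] [ChartedSpace (Model 4) M] [IsManifold (𝓡 4) ∞ M]
  [TopologicalSpace B] [ChartedSpace (Model 3) B] [IsManifold (𝓡 3) ∞ B]
  {C : ConformalStructure 4 M} {CB : ConformalStructure 3 B} {p : M → B} {ξ : Congruence C}
  {g g' : C.Gauge} {h h' : CB.Gauge} {x : M} {D0 : WeylDerivative C} {o : OrientationForm 4 M}

/-- Differentiating the factor in e^{-f} X gives -df, which cancels the change -df of the 1-form: Dξ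
is a well defined section of weight -1. -/
lemma WeylDerivative.derivCongruence_of_conformal (D : WeylDerivative C) {f : M → ℝ}
    (hf : ContMDiff (𝓡 4) 𝓘(ℝ, ℝ) ∞ f)
    (hg : ∀ x (v w : TangentSpace (𝓡 4) x),
      g'.1.inner x v w = Real.exp (2 * f x) * g.1.inner x v w) (v : TangentSpace (𝓡 4) x) :
    D.derivCongruence g' x ξ v = Real.exp (-f x) • D.derivCongruence g x ξ v := by
  have hX : ξ.field g' = (fun y => Real.exp (-f y)) • ξ.field g :=
    funext fun y => ξ.weight g g' f hg y
  have hfs : FnSmoothNear (n := 4) (fun y => Real.exp (-f y)) x :=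
    (FnSmoothNear.neg (Filter.Eventually.of_forall fun y => hf y)).comp
      (Filter.Eventually.of_forall fun y => Real.contDiff_exp.contDiffAt)
  have hm : mvfderiv (𝓡 4) (fun y => Real.exp (-f y)) x
      = - Real.exp (-f x) • mvfderiv (𝓡 4) f x := by
    have hfx := hf.mdifferentiableAt (x := x) (by simp)
    have h2 : HasFDerivAt (fun t : ℝ => Real.exp (-t))
        (- Real.exp (-f x) • ContinuousLinearMap.id ℝ ℝ) (f x) := by
      have := (hasDerivAt_id (f x)).neg.exp.hasFDerivAt
      refine this.congr_fderiv ?_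
      ext; simp
    have := h2.hasMFDerivAt.comp x hfx.hasMFDerivAt
    have he : HasMFDerivAt (𝓡 4) 𝓘(ℝ, ℝ) (fun y => Real.exp (-f y)) x
        (- Real.exp (-f x) • mvfderiv (𝓡 4) f x) := by
      convert! this using 1
    simp only [mvfderiv, he.mfderiv]
    rfl
  have hl := D.conn.isCovariantDerivativeOnUniv.leibniz (x := x)
    ((ξ.smooth g).mdifferentiableAt (by simp)) hfs.mdiff
  simp only [WeylDerivative.derivCongruence, hX]
  rw [hl, hm]
  simp only [sub_apply, add_apply, smul_apply, ContinuousLinearMap.smulRight_apply,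
    D.form_of_conformal hf hg, Pi.smul_apply']
  module

/-- d^D ξ scales by e^f and ξ by e^{-f}, while the star on 2-forms is invariant. So ω is a genuine
1-form, independent of the gauge. -/
lemma WeylDerivative.twistForm_of_conformal (D : WeylDerivative C) {f : M → ℝ}
    (hf : ContMDiff (𝓡 4) 𝓘(ℝ, ℝ) ∞ f)
    (hg : ∀ x (v w : TangentSpace (𝓡 4) x),
      g'.1.inner x v w = Real.exp (2 * f x) * g.1.inner x v w)
    {e e' : Fin 4 → TangentSpace (𝓡 4) x} (he : IsOrientedFrame g.1 o x e)
    (he' : IsOrientedFrame g'.1 o x e') (v : TangentSpace (𝓡 4) x) :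
    D.twistForm o ξ g' x e' v = D.twistForm o ξ g x e v := by
  have h1 : ∀ v w, D.extDerivCongruence g' x ξ v w
      = Real.exp (f x) * D.extDerivCongruence g x ξ v w := by
    intro v w
    simp only [WeylDerivative.extDerivCongruence, D.derivCongruence_of_conformal hf hg, hg,
      map_smul, smul_apply, smul_eq_mul]
    have : Real.exp (2 * f x) * Real.exp (-f x) = Real.exp (f x) := by
      rw [← Real.exp_add]; ring_nf
    rw [← this]
    ring
  have hg2 : ∀ v w : TangentSpace (𝓡 4) x,
      g'.1.inner x v w = Real.exp (f x) ^ 2 * g.1.inner x v w := by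
    intro v w
    rw [hg, ← Real.exp_nat_mul]
    simp
  rw [twistForm, twistForm, hodgeStar_eq_of_conformal (Real.exp_pos (f x)) he he' hg2
    D.isLinearMap_extDerivCongruence₁ D.isLinearMap_extDerivCongruence₂, ξ.weight g g' f hg x,
    (isLinearMap_hodgeStar₁ (o := o) e (D.extDerivCongruence g' x ξ) v).map_smul]
  have h2 : ∀ u, hodgeStar o x e (D.extDerivCongruence g' x ξ) u v
      = Real.exp (f x) * hodgeStar o x e (D.extDerivCongruence g x ξ) u v := by
    intro u
    simp only [hodgeStar, h1, Finset.mul_sum]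
    exact Finset.sum_congr rfl fun i _ => Finset.sum_congr rfl fun j _ => by ring
  rw [h2, smul_eq_mul, ← mul_assoc, ← Real.exp_add]
  simp

/-- The conformal factor between two pullback gauges is the pullback of the one on the base. -/
lemma IsPullbackGauge.eq_comp (hp : IsConformalSubmersion C CB p)
    (hξ : IsTangentToFibres (n := 3) p ξ) (hgh : IsPullbackGauge p g h)
    (hgh' : IsPullbackGauge p g' h') {f : B → ℝ}
    (hf : ∀ b (v w : TangentSpace (𝓡 3) b),
      h'.1.inner b v w = Real.exp (2 * f b) * h.1.inner b v w)
    (x : M) (v w : TangentSpace (𝓡 4) x) :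
    g'.1.inner x v w = Real.exp (2 * f (p x)) * g.1.inner x v w := by
  obtain ⟨F, -, hF⟩ := (C.mem_iff g.1 g.2 g'.1).1 g'.2
  obtain ⟨e, he⟩ := exists_isOrthonormalFrame h.1 (p x)
  -- The metrics `g` and `g'` are proportional, so their ratio can be read off on a single
  -- horizontal vector, here the lift of a unit vector.
  obtain ⟨u, hu, hu0⟩ := hp.exists_lift hξ g x (e 0)
  have hu0' : g'.1.inner x (ξ.field g' x) u = 0 := by
    rw [hF, ξ.weight g g' F hF x]
    simp [hu0]
  have h1 := hgh.inner_eq hξ u hu0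
  have h2 := hgh'.inner_eq hξ u hu0'
  have h3 := he 0 0
  rw [hu, h3, if_pos rfl] at h1
  rw [hF, ← h1, hu, hf, h3, if_pos rfl, mul_one, mul_one] at h2
  rw [hF, ← h2]

/-- The descent condition only has to be checked in one gauge. -/
lemma IsDescentOf.of_gauge (hp : IsConformalSubmersion C CB p)
    (hξ : IsTangentToFibres (n := 3) p ξ) (hgh : IsPullbackGauge p g h) {DB : WeylDerivative CB}
    (hd : ∀ (x : M) (e : Fin 4 → TangentSpace (𝓡 4) x), IsOrientedFrame g.1 o x e →
      ∀ v : TangentSpace (𝓡 4) x, DB.form h (p x) (mfderiv (𝓡 4) (𝓡 3) p x v)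
        = D0.form g x v + D0.twistForm o ξ g x e v) : IsDescentOf o p ξ D0 DB := by
  intro g' h' hgh' x e' he' v
  obtain ⟨f, hf, hh⟩ := (CB.mem_iff h.1 h.2 h'.1).1 h'.2
  have hg := hgh.eq_comp hp hξ hgh' hh
  have hfp : ContMDiff (𝓡 4) 𝓘(ℝ, ℝ) ∞ (fun x => f (p x)) := hf.comp hp.smooth
  obtain ⟨E, F, hE, ho⟩ := hp.exists_isAdaptedFrame_oriented hξ hgh o x
  have he : IsOrientedFrame g.1 o x (fun a => E a x) := ⟨hE.frame.at, ho⟩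
  -- ω does not change, and the forms of `DB` and D⁰ change by -df and by its pullback, so the two
  -- sides stay equal.
  rw [DB.form_of_conformal hf hh, D0.form_of_conformal hfp hg,
    D0.twistForm_of_conformal hfp hg he he', hd x _ he,
    mvfderiv_comp_map hp.smooth (Filter.Eventually.of_forall fun b => hf b)]
  ring

/-- If the fibres are connected, `D⁰ + ω` descends to the base. -/
theorem exists_isDescentOf [T2Space M] [T2Space B] (hp : IsConformalSubmersion C CB p)
    (hξ : IsTangentToFibres (n := 3) p ξ) (hD0 : D0.IsMinimal ξ) (hsd : D0.HasSelfdualFaraday o)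
    (hconn : ∀ b : B, IsConnected (p ⁻¹' {b})) :
    ∃ DB : WeylDerivative CB, IsDescentOf o p ξ D0 DB := by
  obtain ⟨h₀, hh₀⟩ := CB.nonempty
  obtain ⟨g, hgh⟩ := hp.exists_isPullbackGauge hξ ⟨h₀, hh₀⟩
  obtain ⟨a, ha, had⟩ := exists_descended_form hp hξ hgh hD0 hsd hconn
  obtain ⟨DB, rfl⟩ := CB.exists_weylDerivative ⟨h₀, hh₀⟩ ha
  exact ⟨DB, .of_gauge hp hξ hgh had⟩

end GaugeChange

end WeylGeometry

end

theorem theoremI {M B : Type*}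
    [TopologicalSpace M] [T2Space M] [SecondCountableTopology M]
    [ChartedSpace (Model 4) M] [IsManifold (𝓡 4) ∞ M]
    [TopologicalSpace B] [T2Space B] [SecondCountableTopology B]
    [ChartedSpace (Model 3) B] [IsManifold (𝓡 3) ∞ B]
    (C : ConformalStructure 4 M) (o : OrientationForm 4 M) (CB : ConformalStructure 3 B)
    (p : M → B) (hp : IsConformalSubmersion C CB p)
    (ξ : Congruence C) (hξ : IsTangentToFibres (n := 3) p ξ)
    (D0 : WeylDerivative C) (hD0 : D0.IsMinimal ξ) (hsd : D0.HasSelfdualFaraday o) :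
    ((∀ b : B, IsConnected (p ⁻¹' {b})) →
        ∃ DB : WeylDerivative CB, IsDescentOf o p ξ D0 DB) ∧
      ∀ DB : WeylDerivative CB, IsDescentOf o p ξ D0 DB →
        (DB.IsEinsteinWeyl ↔ C.IsSelfdual o) := by
  exact ⟨exists_isDescentOf hp hξ hD0 hsd, fun DB hd => hd.isEinsteinWeyl_iff hp hξ hD0⟩
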